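/- A sequence $\mathcal P$ of Beurling primes is a sequence $1<p_1\le p_2\le\cdots$ of real numbers with $p_j\to\infty$; let $\mathcal G$ be the free commutative semigroup with unit generated by the $p_j$ (equal values being distinct generators), with the multiplicative norm $|\cdot|$ given on the generators by $|p_j|=p_j$. Put $\mathcal N(x)=\#\{g\in\mathcal G:|g|\le x\}$, $\psi(x)=\sum_{|g|\le x}\Lambda(g)$, where $\Lambda(p_j^k)=\log p_j$ for $k\ge1$ and $\Lambda(g)=0$ for all other $g$, and $\zeta(s)=\sum_{g\in\mathcal G}|g|^{-s}$. For $\kappa>0$ and $0<\theta<1$, Axiom $A(\kappa,\theta)$ says that, for some constant $A$, $|\mathcal N(x)-\kappa(x-1)|\le Ax^{\theta}$ for all $x\ge1$. **Theorem.** Let $1/2\le r<1$, and let $\mathcal S$ be a finite multiset of complex numbers, symmetric with respect to the real axis (with multiplicities), all of whose elements satisfy $r<\Re\rho<1$. Then there are a sequence $\mathcal P$ of Beurling primes and a constant $\kappa$ with all of the following properties. 1. If $r>1/2$, then Axiom $A(\kappa,r)$ holds, while Axiom $A(\kappa',\theta)$ fails for every $\theta<r$ and every $\kappa'$. If $r=1/2$,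 then Axiom $A(\kappa,\theta)$ holds for every $\theta$ with $1/2<\theta<1$. 2. $\psi(x)\sim x$ as $x\to\infty$. Moreover, for $x\ge 1$, sums being taken with multiplicity, $$\psi(x)-x=\frac{x^r}{r}-\sum_{\rho\in\mathcal S}\frac{x^\rho}{\rho}+O(\sqrt x)\quad\text{if } r>1/2,\qquad \psi(x)-x=-\sum_{\rho\in\mathcal S}\frac{x^\rho}{\rho}+O(\sqrt x)\quad\text{if } r=1/2 .$$ 3. The series $\zeta(s)$ converges absolutely for $\Re s>1$ and has a meromorphic continuation to $\Re s>1/2$, which is analytic there except for a simple pole at $s=1$ with residue $\kappa$ and, if $r>1/2$, another simple pole at $s=r$. In this half-plane it vanishes precisely at the points of $\mathcal S$, with the multiplicities prescribed by $\mathcal S$. -/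

import Mathlib

open Filter Topology Asymptotics

noncomputable section

/-- A sequence of Beurling generalized primes `1 < p₀ ≤ p₁ ≤ p₂ ≤ …`, `p_j → ∞`
(repetitions are allowed). -/
structure BeurlingPrimes where
  /-- the primes (more precisely: their norms), listed in nondecreasing order -/
  p : ℕ → ℝ
  one_lt : ∀ j, 1 < p j
  mono : Monotone p
  tendsto : Tendsto p atTop atTop

namespace BeurlingPrimes

/-- The free commutative semigroup with unit generated by the primes, written additively:
`g : ℕ →₀ ℕ` stands for the formal product `∏ⱼ pⱼ ^ (g j)`. -/
abbrev Integers (_P : BeurlingPrimes) : Type := ℕ →₀ ℕ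

variable (P : BeurlingPrimes)

/-- The multiplicative norm `|g| = ∏ⱼ pⱼ ^ (g j)`. -/
def norm (g : P.Integers) : ℝ := g.prod fun j k => P.p j ^ k

/-- The counting function `N(x) = #{g : |g| ≤ x}` of the generalized integers, with
multiplicity (elements are counted, not values of the norm); the set is finite by
`finite_norm_le` below. -/
def N (x : ℝ) : ℕ := Set.ncard {g : P.Integers | P.norm g ≤ x}

open Classical in
/-- The generalized von Mangoldt function: `log p_j` on the powers `p_j ^ k`, `k ≥ 1`,
and `0` elsewhere. -/
def Lambda (g : P.Integers) : ℝ :=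
  if h : ∃ j k : ℕ, 0 < k ∧ g = Finsupp.single j k then Real.log (P.p h.choose) else 0

/-- `ψ(x) = ∑_{|g| ≤ x} Λ(g)`, a finite sum by `finite_norm_le` below. -/
def psi (x : ℝ) : ℝ := ∑ᶠ g ∈ {g : P.Integers | P.norm g ≤ x}, P.Lambda g

/-- Axiom A with the constants `κ > 0` and `0 < θ < 1`:
`|N(x) - κ (x - 1)| ≤ A x ^ θ` for all `x ≥ 1`, with some constant `A`. -/
def AxiomA (κ θ : ℝ) : Prop :=
  0 < κ ∧ 0 < θ ∧ θ < 1 ∧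
    ∃ A : ℝ, ∀ x : ℝ, 1 ≤ x → |(P.N x : ℝ) - κ * (x - 1)| ≤ A * x ^ θ

/-- `Z` is the meromorphic continuation to `Re s > σ` of the Beurling zeta function
`∑_g |g| ^ (-s)`, the series being absolutely convergent for `Re s > 1`. -/
def IsZetaContinuation (σ : ℝ) (Z : ℂ → ℂ) : Prop :=
  MeromorphicOn Z {s : ℂ | σ < s.re} ∧
    ∀ s : ℂ, 1 < s.re → HasSum (fun g : P.Integers => (P.norm g : ℂ) ^ (-s)) (Z s)

theorem Lambda_single (j k : ℕ) (hk : 0 < k) :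
    P.Lambda (Finsupp.single j k) = Real.log (P.p j) := by
  have h : ∃ j' k' : ℕ, 0 < k' ∧
      (Finsupp.single j k : ℕ →₀ ℕ) = Finsupp.single j' k' := ⟨j, k, hk, rfl⟩
  have h2 : j = h.choose := by
    obtain ⟨k', hk', he⟩ := h.choose_spec
    rcases (Finsupp.single_eq_single_iff _ _ _ _).1 he with h | h
    · exact h.1
    · omega
  unfold Lambda
  rw [dif_pos h, ← h2]

theorem pow_le_norm (g : P.Integers) (j : ℕ) : P.p j ^ g j ≤ P.norm g := by
  have h1 : ∀ i, 1 ≤ P.p i ^ g i := fun i => one_le_pow₀ (P.one_lt i).le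
  have h2 : ∀ s : Finset ℕ, 1 ≤ ∏ i ∈ s, P.p i ^ g i := fun s =>
    Finset.prod_induction _ (fun y : ℝ => 1 ≤ y) (fun _ _ => one_le_mul_of_one_le_of_one_le)
      le_rfl fun i _ => h1 i
  by_cases hj : j ∈ g.support
  · unfold norm Finsupp.prod
    rw [← Finset.mul_prod_erase _ _ hj]
    exact le_mul_of_one_le_right (zero_le_one.trans (h1 j))
      (h2 _)
  · rw [Finsupp.notMem_support_iff.1 hj, pow_zero]
    exact h2 _

theorem finite_norm_le (x : ℝ) : {g : P.Integers | P.norm g ≤ x}.Finite := by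
  obtain ⟨J, hJ⟩ := (P.tendsto.eventually_gt_atTop x).exists_forall_of_atTop
  obtain ⟨K, hK⟩ := pow_unbounded_of_one_lt x (P.one_lt 0)
  refine (Set.finite_Iic (Finsupp.indicator (Finset.range J) fun _ _ => K)).subset ?_
  intro g hg j
  have hgj := (P.pow_le_norm g j).trans hg
  by_cases hj : j < J
  · rw [Finsupp.indicator_of_mem (Finset.mem_range.2 hj)]
    by_contra! h
    have h1 : P.p 0 ^ K ≤ P.p 0 ^ g j := pow_le_pow_right₀ (P.one_lt 0).le h.le
    have h2 : P.p 0 ^ g j ≤ P.p j ^ g j :=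
      pow_le_pow_left₀ (zero_lt_one.trans (P.one_lt 0)).le (P.mono (Nat.zero_le j)) _
    linarith
  · rw [Finsupp.indicator_of_notMem (by simpa using hj)]
    by_contra! h
    have h1 : P.p j ≤ P.p j ^ g j := le_self_pow₀ (P.one_lt j).le (by omega)
    have := hJ j (by omega)
    linarith

end BeurlingPrimes

end

/-!
Since `∫₁^∞ u⁻ˢ u^(ρ-1) (1 - 1/u) / log u du = log ((s - ρ + 1) / (s - ρ))`, primes of density
`f(u) = (1 + u^(r-1) - ∑ u^(ρ-1)) (1 - 1/u) / log u` would have the zeta function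
`s / (s - 1) · (s - r + 1) / (s - r) · ∏ (s - ρ) / (s - ρ + 1) · exp (G(s))`, with `G` the
contribution of the higher prime powers. The density is positive from some `a` on. Cut `[a, ∞)`
into intervals of mass `1` and pick one prime at random in each. Then `θ(x)` differs from its mean
by only `O(log x)`, and `∑ p_j⁻ˢ - ∫ u⁻ˢ f(u) du` is analytic for `Re s > 0`, so that the zeta
function keeps its shape, with a different `G`. By Hoeffding's inequality and the Borel–Cantelli
lemma, almost surely the sums `∑ p_j^(-in)` over the first `J` primes are within
`O(√(J log (|n| + J)))` of their means. This gives `G(s) = O(√(log |s|))` for `Re s ≥ σ₀ > 1/2`,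
and `exp (G(s))` grows more slowly than any power of `|s|`.

With this growth, Mellin inversion of `∫₀ˣ N` on lines close to `Re s = 1/2`, followed by taking
differences with step `√x`, gives Axiom A up to the contribution of the pole at `r`. Conversely,
Axiom A with an exponent `θ < r` would continue the zeta function to `Re s > θ` without a pole at
`r`.
-/

noncomputable section

open MeasureTheory ProbabilityTheory

/-! ### Concentration of exponential sums -/

section CenteredSum

variable {Ω : ℕ → Type*} [∀ j, MeasurableSpace (Ω j)] (μ : ∀ j, Measure (Ω j))

/-- The partial sum `∑_{j < J} (φ_j(ω_j) - E φ_j)` of centred functions of the coordinates. -/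
def centeredSum {E : Type*} [NormedAddCommGroup E] [NormedSpace ℝ E] (φ : ∀ j, Ω j → E) (J : ℕ)
    (ω : ∀ j, Ω j) : E :=
  ∑ j ∈ Finset.range J, (φ j (ω j) - ∫ x, φ j x ∂μ j)

theorem centeredSum_neg (φ : ∀ j, Ω j → ℝ) (J : ℕ) (ω : ∀ j, Ω j) :
    centeredSum μ (fun j x => -φ j x) J ω = -centeredSum μ φ J ω := by
  simp only [centeredSum, integral_neg, ← Finset.sum_neg_distrib, sub_neg_eq_add, neg_sub,
    neg_add_eq_sub]

/-- Borel–Cantelli: almost surely only finitely many `i` violate `T i ω < c * b i`, and those are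
absorbed into the constant. -/
theorem ae_exists_forall_le_mul_of_summable {α ι : Type*} [Countable ι]
    [MeasurableSpace α] {ν : Measure α} [IsFiniteMeasure ν] {T : ι → α → ℝ} {b : ι → ℝ}
    (hb : ∀ i, 0 < b i) {c : ℝ} (hc : 0 ≤ c)
    (hs : Summable fun i => ν.real {ω | c * b i ≤ T i ω}) :
    ∀ᵐ ω ∂ν, ∃ C : ℝ, 0 ≤ C ∧ ∀ i, T i ω ≤ C * b i := by
  have htop : ∑' i, ν {ω | c * b i ≤ T i ω} ≠ ⊤ := by
    simpa only [ofReal_measureReal (measure_ne_top ν _)] using hs.tsum_ofReal_ne_top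
  filter_upwards [ae_finite_setOfPred_mem htop] with ω hω
  obtain ⟨M, hM⟩ := (hω.image fun i => T i ω / b i).bddAbove
  refine ⟨max c M, le_max_of_le_left hc, fun i => ?_⟩
  by_cases hi : c * b i ≤ T i ω
  · exact ((div_le_iff₀ (hb i)).1 (hM ⟨i, hi, rfl⟩)).trans
      (mul_le_mul_of_nonneg_right (le_max_right _ _) (hb i).le)
  · exact (not_le.1 hi).le.trans (mul_le_mul_of_nonneg_right (le_max_left _ _) (hb i).le)

variable [∀ j, IsProbabilityMeasure (μ j)]

theorem measureReal_le_centeredSum_le {φ : ∀ j, Ω j → ℝ} (hφ : ∀ j, Measurable (φ j))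
    (hb : ∀ j x, |φ j x| ≤ 1) (J : ℕ) {ε : ℝ} (hε : 0 ≤ ε) :
    (Measure.infinitePi μ).real {ω | ε ≤ centeredSum μ φ J ω} ≤ Real.exp (-ε ^ 2 / (2 * J)) := by
  have hindep : iIndepFun (fun j ω => φ j (ω j) - ∫ x, φ j x ∂μ j) (Measure.infinitePi μ) :=
    iIndepFun_infinitePi (X := fun j x => φ j x - ∫ y, φ j y ∂μ j) fun j => (hφ j).sub_const _
  have hmean (j : ℕ) : ∫ ω, φ j (ω j) ∂Measure.infinitePi μ = ∫ x, φ j x ∂μ j := by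
    rw [← (measurePreserving_eval_infinitePi μ j).map_eq]
    exact (integral_map (measurable_pi_apply j).aemeasurable (hφ j).aestronglyMeasurable).symm
  have hsub (j : ℕ) : HasSubgaussianMGF (fun ω => φ j (ω j) - ∫ x, φ j x ∂μ j) 1
      (Measure.infinitePi μ) := by
    have := hasSubgaussianMGF_of_mem_Icc (μ := Measure.infinitePi μ) (X := fun ω => φ j (ω j))
      (a := -1) (b := 1) ((hφ j).comp (measurable_pi_apply j)).aemeasurable
      (ae_of_all _ fun ω => abs_le.1 (hb j _))
    rw [hmean] at this
    convert this using 1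
    rw [← NNReal.coe_inj]
    norm_num
  simpa only [centeredSum, NNReal.coe_one, mul_one] using
    HasSubgaussianMGF.measure_sum_range_ge_le_of_iIndepFun hindep (fun j _ => hsub j) hε

theorem measureReal_le_abs_centeredSum_le {φ : ∀ j, Ω j → ℝ} (hφ : ∀ j, Measurable (φ j))
    (hb : ∀ j x, |φ j x| ≤ 1) (J : ℕ) {ε : ℝ} (hε : 0 ≤ ε) :
    (Measure.infinitePi μ).real {ω | ε ≤ |centeredSum μ φ J ω|}
      ≤ 2 * Real.exp (-ε ^ 2 / (2 * J)) := by
  have hneg := measureReal_le_centeredSum_le μ (φ := fun j x => -φ j x)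
    (fun j => (hφ j).neg) (fun j x => (abs_neg (φ j x)).trans_le (hb j x)) J hε
  simp only [centeredSum_neg] at hneg
  calc (Measure.infinitePi μ).real {ω | ε ≤ |centeredSum μ φ J ω|}
      ≤ (Measure.infinitePi μ).real
          ({ω | ε ≤ centeredSum μ φ J ω} ∪ {ω | ε ≤ -centeredSum μ φ J ω}) :=
        measureReal_mono fun ω (hω : ε ≤ |_|) => show _ ∨ _ from le_abs.1 hω
    _ ≤ _ := measureReal_union_le _ _
    _ ≤ 2 * Real.exp (-ε ^ 2 / (2 * J)) := by
        rw [two_mul]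
        exact add_le_add (measureReal_le_centeredSum_le μ hφ hb J hε) hneg

theorem measureReal_sqrt_mul_log_le_abs_centeredSum_le {φ : ∀ j, Ω j → ℝ}
    (hφ : ∀ j, Measurable (φ j)) (hb : ∀ j x, |φ j x| ≤ 1) {w : ℝ} (hw : 1 ≤ w) {J : ℕ}
    (hJ : 0 < J) :
    (Measure.infinitePi μ).real
        {ω | 4 * √(J * Real.log (w + J)) ≤ |centeredSum μ φ J ω|}
      ≤ 2 * (1 / w ^ 2 * (1 / (J : ℝ) ^ 2)) := by
  have hJ0 : (0 : ℝ) < J := Nat.cast_pos.2 hJ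
  have hlog : 0 ≤ Real.log (w + J) := Real.log_nonneg (by linarith)
  have hexponent : -(4 * √(J * Real.log (w + J))) ^ 2 / (2 * J) = Real.log (w + J) * (-8 : ℝ) := by
    rw [mul_pow, Real.sq_sqrt (by positivity)]
    field_simp
    ring
  refine (measureReal_le_abs_centeredSum_le μ hφ hb J (by positivity)).trans ?_
  rw [hexponent, ← Real.rpow_def_of_pos (by positivity), Real.rpow_neg (by positivity), ← one_div,
    one_div_mul_one_div]
  gcongr
  calc w ^ 2 * (J : ℝ) ^ 2 ≤ (w + J) ^ 2 * (w + J) ^ 2 := by gcongr <;> linarith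
    _ = (w + J) ^ 4 := by ring
    _ ≤ (w + J) ^ 8 := pow_le_pow_right₀ (by linarith) (by norm_num)
    _ = (w + J) ^ (8 : ℝ) := by norm_cast

variable {ι : Type*} [Countable ι] {w : ι → ℝ}

theorem ae_exists_abs_centeredSum_le (hw : ∀ i, 1 ≤ w i) (hws : Summable fun i => 1 / w i ^ 2)
    {φ : ι → ∀ j, Ω j → ℝ} (hφ : ∀ i j, Measurable (φ i j)) (hb : ∀ i j x, |φ i j x| ≤ 1) :
    ∀ᵐ ω ∂(Measure.infinitePi μ), ∃ C : ℝ, 0 ≤ C ∧ ∀ (i : ι) (J : ℕ),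
      |centeredSum μ (φ i) J ω| ≤ C * √(J * Real.log (w i + J)) := by
  have hJs : Summable fun J : ℕ => 1 / (↑(J + 1) : ℝ) ^ 2 :=
    (summable_nat_add_iff 1).2 (Real.summable_one_div_nat_pow.2 one_lt_two)
  have hpos (k : ι × ℕ) : 0 < √(↑(k.2 + 1) * Real.log (w k.1 + ↑(k.2 + 1))) := by
    have hlog : 0 < Real.log (w k.1 + ↑(k.2 + 1)) := Real.log_pos (by
      push_cast
      linarith [hw k.1, (Nat.cast_nonneg k.2 : (0 : ℝ) ≤ k.2)])
    positivity
  have hsum : Summable fun k : ι × ℕ => (Measure.infinitePi μ).real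
      {ω | 4 * √(↑(k.2 + 1) * Real.log (w k.1 + ↑(k.2 + 1))) ≤
        |centeredSum μ (φ k.1) (k.2 + 1) ω|} :=
    .of_nonneg_of_le (fun _ => measureReal_nonneg)
      (fun k => measureReal_sqrt_mul_log_le_abs_centeredSum_le μ (hφ k.1) (hb k.1) (hw k.1)
        k.2.succ_pos)
      ((hws.mul_of_nonneg hJs (fun _ => by positivity) fun _ => by positivity).mul_left 2)
  filter_upwards [ae_exists_forall_le_mul_of_summable hpos (by norm_num) hsum] with ω ⟨C, hC, h⟩
  refine ⟨C, hC, fun i J => ?_⟩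
  rcases J with _ | J
  · simp [centeredSum]
  · exact h (i, J)

theorem ae_exists_norm_centeredSum_le (hw : ∀ i, 1 ≤ w i) (hws : Summable fun i => 1 / w i ^ 2)
    {φ : ι → ∀ j, Ω j → ℂ} (hφ : ∀ i j, Measurable (φ i j)) (hb : ∀ i j x, ‖φ i j x‖ ≤ 1) :
    ∀ᵐ ω ∂(Measure.infinitePi μ), ∃ C : ℝ, 0 ≤ C ∧ ∀ (i : ι) (J : ℕ),
      ‖centeredSum μ (φ i) J ω‖ ≤ C * √(J * Real.log (w i + J)) := by
  have hint (i : ι) (j : ℕ) : Integrable (φ i j) (μ j) :=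
    .of_bound (hφ i j).aestronglyMeasurable 1 (ae_of_all _ (hb i j))
  have hre (i : ι) (J : ℕ) (ω : ∀ j, Ω j) :
      (centeredSum μ (φ i) J ω).re = centeredSum μ (fun j x => (φ i j x).re) J ω := by
    simp only [centeredSum, Complex.re_sum, Complex.sub_re]
    exact Finset.sum_congr rfl fun j _ =>
      congrArg _ (Complex.reCLM.integral_comp_comm (hint i j)).symm
  have him (i : ι) (J : ℕ) (ω : ∀ j, Ω j) :
      (centeredSum μ (φ i) J ω).im = centeredSum μ (fun j x => (φ i j x).im) J ω := by
    simp only [centeredSum, Complex.im_sum, Complex.sub_im]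
    exact Finset.sum_congr rfl fun j _ =>
      congrArg _ (Complex.imCLM.integral_comp_comm (hint i j)).symm
  filter_upwards [
    ae_exists_abs_centeredSum_le μ hw hws (fun i j => Complex.measurable_re.comp (hφ i j))
      fun i j x => (Complex.abs_re_le_norm _).trans (hb i j x),
    ae_exists_abs_centeredSum_le μ hw hws (fun i j => Complex.measurable_im.comp (hφ i j))
      fun i j x => (Complex.abs_im_le_norm _).trans (hb i j x)] with ω ⟨C₁, hC₁, h₁⟩ ⟨C₂, hC₂, h₂⟩
  refine ⟨C₁ + C₂, add_nonneg hC₁ hC₂, fun i J =>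
    (Complex.norm_le_abs_re_add_abs_im _).trans ?_⟩
  rw [add_mul, hre, him]
  exact add_le_add (h₁ i J) (h₂ i J)

end CenteredSum

theorem exists_quantiles {f : ℝ → ℝ} {a : ℝ} (hf : ContinuousOn f (Set.Ici a))
    (hpos : ∀ u, a ≤ u → 0 < f u) (hlim : Tendsto (fun x => ∫ u in a..x, f u) atTop atTop) :
    ∃ q : ℕ → ℝ, q 0 = a ∧ Monotone q ∧ ∀ j, ∫ u in q j..q (j + 1), f u = 1 := by
  set F : ℝ → ℝ := fun x => ∫ u in a..x, f u
  have hint {x y : ℝ} (hx : a ≤ x) (hy : a ≤ y) : IntervalIntegrable f volume x y :=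
    (hf.mono fun z hz => (le_min hx hy).trans hz.1).intervalIntegrable
  have hsub {x y : ℝ} (hx : a ≤ x) (hy : a ≤ y) : F y - F x = ∫ u in x..y, f u :=
    intervalIntegral.integral_interval_sub_left (hint le_rfl hy) (hint le_rfl hx)
  have hmono : StrictMonoOn F (Set.Ici a) := fun x hx y hy hxy => by
    rw [← sub_pos, hsub hx hy]
    exact intervalIntegral.intervalIntegral_pos_of_pos_on (hint hx hy)
      (fun z hz => hpos z (le_trans hx hz.1.le)) hxy
  have hFa : F a = 0 := intervalIntegral.integral_same
  have hsurj (j : ℕ) : ∃ x, a ≤ x ∧ F x = j := by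
    obtain ⟨b, hb, hab⟩ := ((hlim.eventually_ge_atTop (j : ℝ)).and (eventually_ge_atTop a)).exists
    have hc : ContinuousOn F (Set.Icc a b) := by
      simpa only [Set.uIcc_of_le hab] using intervalIntegral.continuousOn_primitive_interval'
        (hint le_rfl hab) Set.left_mem_uIcc
    obtain ⟨x, hx, hxj⟩ := intermediate_value_Icc hab hc ⟨hFa.trans_le j.cast_nonneg, hb⟩
    exact ⟨x, hx.1, hxj⟩
  choose q hqa hq using hsurj
  refine ⟨q, hmono.injOn (hqa 0) Set.self_mem_Ici ?_,
    monotone_nat_of_le_succ fun j => (hmono.le_iff_le (hqa j) (hqa (j + 1))).1 ?_, fun j => ?_⟩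
  · rw [hq, hFa, Nat.cast_zero]
  · rw [hq, hq, Nat.cast_le]
    exact Nat.le_succ j
  · rw [← hsub (hqa j) (hqa (j + 1)), hq, hq, Nat.cast_succ, add_sub_cancel_left]

/-- The measure `f(u) du` on the interval `(x, y]`. -/
def densityMeasure (f : ℝ → ℝ) (x y : ℝ) : Measure ℝ :=
  (volume.restrict (Set.Ioc x y)).withDensity fun u => ENNReal.ofReal (f u)

section DensityMeasure

variable {f : ℝ → ℝ} {x y : ℝ}

theorem ae_mem_Ioc_densityMeasure : ∀ᵐ u ∂densityMeasure f x y, u ∈ Set.Ioc x y :=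
  (withDensity_absolutelyContinuous _ _).ae_le (ae_restrict_mem measurableSet_Ioc)

theorem isProbabilityMeasure_densityMeasure (hxy : x ≤ y) (hf : IntervalIntegrable f volume x y)
    (hpos : ∀ u ∈ Set.Ioc x y, 0 ≤ f u) (h1 : ∫ u in x..y, f u = 1) :
    IsProbabilityMeasure (densityMeasure f x y) := by
  have hnonneg : 0 ≤ᵐ[volume.restrict (Set.Ioc x y)] f :=
    (ae_restrict_mem measurableSet_Ioc).mono hpos
  constructor
  rw [densityMeasure, withDensity_apply _ MeasurableSet.univ, Measure.restrict_univ,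
    ← ofReal_integral_eq_lintegral_ofReal
      ((intervalIntegrable_iff_integrableOn_Ioc_of_le hxy).1 hf) hnonneg,
    ← intervalIntegral.integral_of_le hxy, h1, ENNReal.ofReal_one]

theorem integral_densityMeasure (hxy : x ≤ y) (hf : IntervalIntegrable f volume x y)
    (hpos : ∀ u ∈ Set.Ioc x y, 0 ≤ f u) (φ : ℝ → ℂ) :
    ∫ u, φ u ∂densityMeasure f x y = ∫ u in x..y, (f u : ℂ) * φ u := by
  have hf' := (intervalIntegrable_iff_integrableOn_Ioc_of_le hxy).1 hf
  rw [densityMeasure, integral_withDensity_eq_integral_toReal_smul₀ hf'.aemeasurable.ennreal_ofReal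
    (ae_of_all _ fun _ => ENNReal.ofReal_lt_top), intervalIntegral.integral_of_le hxy]
  exact setIntegral_congr_fun measurableSet_Ioc fun u hu => by
    simp only [ENNReal.toReal_ofReal (hpos u hu), Complex.real_smul]

end DensityMeasure

/-- A sequence `p` sampling the density `f` on `[a, ∞)`: `[a, ∞)` is cut at the points `q j` into
intervals of mass `1`, each containing one `p j`, and the exponential sums over the `p j` are close
to the corresponding integrals. -/
structure DensitySampling (f : ℝ → ℝ) (a M : ℝ) where
  two_le : 2 ≤ a
  continuousOn : ContinuousOn f (Set.Ici a)
  pos : ∀ u, a ≤ u → 0 < f u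
  le : ∀ u, a ≤ u → f u ≤ M
  q : ℕ → ℝ
  q_zero : q 0 = a
  q_mono : Monotone q
  integral_q : ∀ j, ∫ u in q j..q (j + 1), f u = 1
  p : ℕ → ℝ
  p_mem : ∀ j, p j ∈ Set.Icc (q j) (q (j + 1))
  C : ℝ
  C_nonneg : 0 ≤ C
  norm_sum_le : ∀ (n : ℤ) (J : ℕ),
    ‖∑ j ∈ Finset.range J, ((p j : ℂ) ^ (-(n * Complex.I)) -
        ∫ u in q j..q (j + 1), (f u : ℂ) * (u : ℂ) ^ (-(n * Complex.I)))‖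
      ≤ C * √(J * Real.log (|(n : ℝ)| + 1 + J))

theorem summable_one_div_abs_intCast_add_one_sq :
    Summable fun n : ℤ => 1 / (|(n : ℝ)| + 1) ^ 2 := by
  have hs : Summable fun n : ℕ => 1 / ((n : ℝ) + 1) ^ 2 := by
    simpa using (summable_nat_add_iff 1).2 (Real.summable_one_div_nat_pow.2 one_lt_two)
  exact .of_nat_of_neg (by simpa using hs) (by simpa using hs)

theorem ofReal_cpow_neg_mul_I {x : ℝ} (hx : 0 < x) (t : ℝ) :
    (x : ℂ) ^ (-(t * Complex.I)) = Complex.exp (((-(t * Real.log x) : ℝ) : ℂ) * Complex.I) := by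
  rw [Complex.cpow_def_of_ne_zero (by exact_mod_cast hx.ne'), ← Complex.ofReal_log hx.le]
  push_cast
  ring_nf

theorem nonempty_densitySampling {f : ℝ → ℝ} {a M : ℝ} (ha : 2 ≤ a)
    (hf : ContinuousOn f (Set.Ici a)) (hpos : ∀ u, a ≤ u → 0 < f u) (hle : ∀ u, a ≤ u → f u ≤ M)
    (hlim : Tendsto (fun x => ∫ u in a..x, f u) atTop atTop) :
    Nonempty (DensitySampling f a M) := by
  obtain ⟨q, hq0, hqm, hqi⟩ := exists_quantiles hf hpos hlim
  have hqa (j : ℕ) : a ≤ q j := hq0 ▸ hqm (Nat.zero_le j)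
  have hqs (j : ℕ) : q j ≤ q (j + 1) := hqm (Nat.le_succ j)
  have hpos' (j : ℕ) : ∀ u ∈ Set.Ioc (q j) (q (j + 1)), 0 ≤ f u := fun u hu =>
    (hpos u ((hqa j).trans hu.1.le)).le
  have hint (j : ℕ) : IntervalIntegrable f volume (q j) (q (j + 1)) :=
    (hf.mono fun z hz => (le_min (hqa j) (hqa _)).trans hz.1).intervalIntegrable
  set μ : ℕ → Measure ℝ := fun j => densityMeasure f (q j) (q (j + 1))
  have (j : ℕ) : IsProbabilityMeasure (μ j) :=
    isProbabilityMeasure_densityMeasure (hqs j) (hint j) (hpos' j) (hqi j)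
  set φ : ℤ → ℝ → ℂ := fun n x =>
    Complex.exp (((-(((n : ℝ)) * Real.log x) : ℝ) : ℂ) * Complex.I)
  have hφ (n : ℤ) {x : ℝ} (hx : a ≤ x) : (x : ℂ) ^ (-(n * Complex.I)) = φ n x :=
    mod_cast ofReal_cpow_neg_mul_I (by linarith : 0 < x) n
  have hsums := ae_exists_norm_centeredSum_le μ (w := fun n : ℤ => |(n : ℝ)| + 1)
    (fun n => le_add_of_nonneg_left (abs_nonneg _)) summable_one_div_abs_intCast_add_one_sq
    (φ := fun n _ => φ n) (fun n _ => by fun_prop)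
    (fun n _ _ => (Complex.norm_exp_ofReal_mul_I _).le)
  have hmem : ∀ᵐ ω ∂Measure.infinitePi μ, ∀ j, ω j ∈ Set.Ioc (q j) (q (j + 1)) :=
    ae_all_iff.2 fun j => (measurePreserving_eval_infinitePi μ j).quasiMeasurePreserving.ae
      ae_mem_Ioc_densityMeasure
  obtain ⟨p, ⟨C, hC, hbound⟩, hp⟩ := (hsums.and hmem).exists
  refine ⟨⟨ha, hf, hpos, hle, q, hq0, hqm, hqi, p, fun j => Set.Ioc_subset_Icc_self (hp j), C, hC,
    fun n J => le_of_eq_of_le (congrArg _ ?_) (hbound n J)⟩⟩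
  refine Finset.sum_congr rfl fun j _ => congrArg₂ _ (hφ n ((hqa j).trans (hp j).1.le)) ?_
  rw [integral_densityMeasure (hqs j) (hint j) (hpos' j)]
  refine intervalIntegral.integral_congr fun u hu => ?_
  simp only [hφ n ((hqa j).trans (Set.uIcc_of_le (hqs j) ▸ hu).1)]

/-! ### The discrepancy of a sample -/

theorem continuousOn_rpow_const_uIcc {x y : ℝ} (hx : 0 < x) (hy : 0 < y) (b : ℝ) :
    ContinuousOn (fun v : ℝ => v ^ b) (Set.uIcc x y) := fun _ hv =>
  (Real.continuousAt_rpow_const _ _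
    (Or.inl ((lt_min hx hy).trans_le hv.1).ne')).continuousWithinAt

theorem intervalIntegrable_rpow_const {x y : ℝ} (hx : 0 < x) (hy : 0 < y) (b : ℝ) :
    IntervalIntegrable (fun v : ℝ => v ^ b) volume x y :=
  (continuousOn_rpow_const_uIcc hx hy b).intervalIntegrable

theorem cpow_sub_cpow_eq_integral {x y : ℝ} (hx : 0 < x) (hxy : x ≤ y) (w : ℂ) :
    (y : ℂ) ^ w - (x : ℂ) ^ w = ∫ v in x..y, w * (v : ℂ) ^ (w - 1) := by
  have hpos (v : ℝ) (hv : v ∈ Set.uIcc x y) : 0 < v :=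
    hx.trans_le (Set.uIcc_of_le hxy ▸ hv).1
  refine (intervalIntegral.integral_eq_sub_of_hasDerivAt (f := fun v : ℝ => (v : ℂ) ^ w)
    (fun v hv => ?_) (ContinuousOn.intervalIntegrable fun v hv => ?_)).symm
  · simpa using ((hasDerivAt_id (v : ℂ)).cpow_const (c := w)
      (Complex.ofReal_mem_slitPlane.2 (hpos v hv))).comp_ofReal
  · exact (continuousAt_const.mul
      (Complex.continuousAt_ofReal_cpow_const v _ (Or.inr (hpos v hv).ne'))).continuousWithinAt

theorem norm_cpow_sub_cpow_le_integral {x y : ℝ} (hx : 0 < x) (hxy : x ≤ y) (w : ℂ) :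
    ‖(y : ℂ) ^ w - (x : ℂ) ^ w‖ ≤ ‖w‖ * ∫ v in x..y, v ^ (w.re - 1) := by
  rw [cpow_sub_cpow_eq_integral hx hxy, ← intervalIntegral.integral_const_mul]
  refine intervalIntegral.norm_integral_le_of_norm_le hxy (ae_of_all _ fun v hv => ?_)
    ((intervalIntegrable_rpow_const hx (hx.trans_le hxy) _).const_mul _)
  rw [norm_mul, Complex.norm_cpow_eq_rpow_re_of_pos (hx.trans hv.1), Complex.sub_re,
    Complex.one_re]

theorem norm_cpow_neg_sub_cpow_neg_le {a b x y : ℝ} (ha : 0 < a) (hx : x ∈ Set.Icc a b)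
    (hy : y ∈ Set.Icc a b) (w : ℂ) :
    ‖(y : ℂ) ^ (-w) - (x : ℂ) ^ (-w)‖ ≤ ‖w‖ * ∫ v in a..b, v ^ (-w.re - 1) := by
  wlog hxy : x ≤ y generalizing x y
  · rw [norm_sub_rev]
    exact this hy hx (not_le.1 hxy).le
  refine (norm_cpow_sub_cpow_le_integral (ha.trans_le hx.1) hxy (-w)).trans ?_
  rw [norm_neg, Complex.neg_re]
  gcongr
  refine intervalIntegral.integral_mono_interval hx.1 hxy hy.2
    ((ae_restrict_mem measurableSet_Ioc).mono fun v hv => Real.rpow_nonneg (ha.trans hv.1).le _)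
    (intervalIntegrable_rpow_const ha ((ha.trans_le hx.1).trans_le (hxy.trans hy.2)) _)

theorem integral_rpow_neg_le {x y σ : ℝ} (hx : 1 ≤ x) (hxy : x ≤ y) (hσ : 0 < σ) :
    ∫ v in x..y, v ^ (-σ - 1) ≤ 1 / σ := by
  have h0 : (0 : ℝ) ∉ Set.uIcc x y := by
    rw [Set.uIcc_of_le hxy]
    exact fun h => by linarith [h.1]
  rw [integral_rpow (Or.inr ⟨by linarith, h0⟩), sub_add_cancel, div_neg, ← neg_div, neg_sub]
  gcongr
  linarith [Real.rpow_le_one_of_one_le_of_nonpos hx (neg_nonpos.2 hσ.le),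
    Real.rpow_nonneg (zero_le_one.trans (hx.trans hxy)) (-σ)]

theorem rpow_mul_integral_rpow_le {x y b : ℝ} (hx : 0 < x) (hxy : x ≤ y) (hb : 0 ≤ b) (c : ℝ) :
    x ^ b * ∫ v in x..y, v ^ c ≤ ∫ v in x..y, v ^ (b + c) := by
  have hy := hx.trans_le hxy
  rw [← intervalIntegral.integral_const_mul]
  refine intervalIntegral.integral_mono_on hxy
    ((intervalIntegrable_rpow_const hx hy _).const_mul _) (intervalIntegrable_rpow_const hx hy _)
    fun v hv => ?_
  have hv0 : 0 < v := hx.trans_le hv.1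
  rw [Real.rpow_add hv0]
  gcongr
  exact hv.1

section MonotoneSequence

variable {q : ℕ → ℝ}

theorem integral_rpow_nonneg_of_monotone (hq1 : ∀ j, 1 ≤ q j) (hq : Monotone q) (b : ℝ) (j : ℕ) :
    0 ≤ ∫ v in q j..q (j + 1), v ^ b :=
  intervalIntegral.integral_nonneg (hq j.le_succ) fun _ hv =>
    Real.rpow_nonneg (zero_le_one.trans ((hq1 j).trans hv.1)) _

theorem sum_integral_rpow_neg_le (hq1 : ∀ j, 1 ≤ q j) (hq : Monotone q) {σ : ℝ} (hσ : 0 < σ)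
    (J : ℕ) : ∑ j ∈ Finset.range J, ∫ v in q j..q (j + 1), v ^ (-σ - 1) ≤ 1 / σ := by
  have hpos (j : ℕ) : 0 < q j := one_pos.trans_le (hq1 j)
  rw [intervalIntegral.sum_integral_adjacent_intervals fun j _ =>
    intervalIntegrable_rpow_const (hpos j) (hpos (j + 1)) _]
  exact integral_rpow_neg_le (hq1 0) (hq (Nat.zero_le J)) hσ

theorem summable_integral_rpow_neg (hq1 : ∀ j, 1 ≤ q j) (hq : Monotone q) {σ : ℝ} (hσ : 0 < σ) :
    Summable fun j => ∫ v in q j..q (j + 1), v ^ (-σ - 1) :=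
  summable_of_sum_range_le (integral_rpow_nonneg_of_monotone hq1 hq _)
    (sum_integral_rpow_neg_le hq1 hq hσ)

theorem norm_sum_cpow_neg_mul_le (hq1 : ∀ j, 1 ≤ q j) (hq : Monotone q) {e : ℕ → ℂ} {B b : ℝ}
    (hB : 0 ≤ B) (hb : 0 ≤ b)
    (he : ∀ i J : ℕ, J ≤ i + 1 → ‖∑ j ∈ Finset.range J, e j‖ ≤ B * q i ^ b)
    {w : ℂ} (hw : b < w.re) (J : ℕ) :
    ‖∑ j ∈ Finset.range J, (q j : ℂ) ^ (-w) * e j‖ ≤ (1 + ‖w‖ / (w.re - b)) * B := by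
  have hpos (j : ℕ) : 0 < q j := one_pos.trans_le (hq1 j)
  have hterm (j : ℕ) : ‖((q (j + 1) : ℂ) ^ (-w) - (q j : ℂ) ^ (-w)) •
        ∑ i ∈ Finset.range (j + 1), e i‖
      ≤ ‖w‖ * B * ∫ v in q j..q (j + 1), v ^ (-(w.re - b) - 1) := by
    have hj := hq j.le_succ
    calc _ ≤ (‖w‖ * ∫ v in q j..q (j + 1), v ^ (-w.re - 1)) * (B * q j ^ b) := by
          rw [norm_smul]
          exact mul_le_mul (norm_cpow_neg_sub_cpow_neg_le (hpos j) (Set.left_mem_Icc.2 hj)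
            (Set.right_mem_Icc.2 hj) w) (he j (j + 1) le_rfl) (norm_nonneg _)
            (mul_nonneg (norm_nonneg w) (integral_rpow_nonneg_of_monotone hq1 hq _ j))
      _ = ‖w‖ * B * (q j ^ b * ∫ v in q j..q (j + 1), v ^ (-w.re - 1)) := by ring
      _ ≤ _ := by
          rw [show -(w.re - b) - 1 = b + (-w.re - 1) by ring]
          gcongr
          exact rpow_mul_integral_rpow_le (hpos j) hj hb _
  have hlast : ‖(q (J - 1) : ℂ) ^ (-w) • ∑ j ∈ Finset.range J, e j‖ ≤ B := by
    rw [norm_smul, Complex.norm_cpow_eq_rpow_re_of_pos (hpos _), Complex.neg_re]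
    calc _ ≤ q (J - 1) ^ (-w.re) * (B * q (J - 1) ^ b) := by
          have := Real.rpow_nonneg (hpos (J - 1)).le (-w.re)
          gcongr
          exact he (J - 1) J (by omega)
      _ = B * q (J - 1) ^ (b - w.re) := by
          rw [sub_eq_add_neg, Real.rpow_add (hpos _)]
          ring
      _ ≤ B := mul_le_of_le_one_right hB
          (Real.rpow_le_one_of_one_le_of_nonpos (hq1 _) (by linarith))
  simp only [← smul_eq_mul]
  rw [Finset.sum_range_by_parts]
  calc _ ≤ B + ∑ j ∈ Finset.range (J - 1),
          ‖w‖ * B * ∫ v in q j..q (j + 1), v ^ (-(w.re - b) - 1) :=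
        (norm_sub_le _ _).trans (add_le_add hlast (norm_sum_le_of_le _ fun j _ => hterm j))
    _ ≤ B + ‖w‖ * B * (1 / (w.re - b)) := by
        rw [← Finset.mul_sum]
        gcongr
        exact sum_integral_rpow_neg_le hq1 hq (by linarith) _
    _ = _ := by ring

end MonotoneSequence

theorem differentiable_mellin_indicator {g : ℝ → ℂ} {x y : ℝ} (hx : 0 < x)
    (hg : IntegrableOn g (Set.Ioc x y)) :
    Differentiable ℂ (mellin ((Set.Ioc x y).indicator g)) := by
  have htop (b : ℝ) : (Set.Ioc x y).indicator g =O[atTop] fun u : ℝ => u ^ (-b) :=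
    IsBigO.of_bound 0 ((eventually_gt_atTop y).mono fun u hu => by simp [hu.not_ge])
  have hzero (b : ℝ) : (Set.Ioc x y).indicator g =O[𝓝[>] 0] fun u : ℝ => u ^ (-b) :=
    IsBigO.of_bound 0 (((eventually_lt_nhds hx).filter_mono nhdsWithin_le_nhds).mono
      fun u hu => by simp [hu.not_gt])
  exact fun s => mellin_differentiableAt_of_isBigO_rpow (a := s.re + 1) (b := s.re - 1)
    (((integrable_indicator_iff measurableSet_Ioc).2 hg).locallyIntegrable.locallyIntegrableOn _)
    (htop _) (by linarith) (hzero _) (by linarith)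

theorem differentiable_integral_mul_cpow_neg {g : ℝ → ℂ} {x y : ℝ} (hx : 0 < x) (hxy : x ≤ y)
    (hg : IntegrableOn g (Set.Ioc x y)) :
    Differentiable ℂ fun s : ℂ => ∫ u in x..y, g u * (u : ℂ) ^ (-s) := by
  have heq : (fun s : ℂ => ∫ u in x..y, g u * (u : ℂ) ^ (-s)) =
      fun s => mellin ((Set.Ioc x y).indicator g) (1 - s) := by
    funext s
    have hsub : Set.Ioc x y ⊆ Set.Ioi 0 := fun u hu => hx.trans hu.1
    calc ∫ u in x..y, g u * (u : ℂ) ^ (-s)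
        = ∫ u in Set.Ioc x y, (u : ℂ) ^ (1 - s - 1) • (Set.Ioc x y).indicator g u := by
          rw [intervalIntegral.integral_of_le hxy]
          refine setIntegral_congr_fun measurableSet_Ioc fun u hu => ?_
          simp only [Set.indicator_of_mem hu, smul_eq_mul, sub_sub_cancel_left, mul_comm]
      _ = mellin ((Set.Ioc x y).indicator g) (1 - s) :=
          (setIntegral_eq_of_subset_of_forall_sdiff_eq_zero measurableSet_Ioi hsub
            fun u hu => by rw [Set.indicator_of_notMem hu.2, smul_zero]).symm
  rw [heq]
  exact (differentiable_mellin_indicator hx hg).comp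
    ((differentiable_const _).sub differentiable_id)

theorem sqrt_mul_log_add_le {δ x y : ℝ} (hδ : 0 < δ) (hx : 0 ≤ x) (hy : 0 ≤ y) :
    √(x * Real.log (y + 1 + x)) ≤
      √(1 + 1 / (2 * δ)) * (x + 1) ^ (1 / 2 + δ) * √(Real.log (y + 3)) := by
  have hlog_one : 1 ≤ Real.log (y + 3) := by
    rw [Real.le_log_iff_exp_le (by linarith)]
    linarith [Real.exp_one_lt_d9]
  have hlog_add : Real.log (y + 1 + x) ≤ Real.log (y + 3) + Real.log (x + 1) := by
    rw [← Real.log_mul (by linarith) (by linarith)]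
    exact Real.log_le_log (by linarith) (by nlinarith)
  have hlog_nonneg : 0 ≤ Real.log (x + 1) := Real.log_nonneg (by linarith)
  have hlog_le : Real.log (x + 1) ≤ (x + 1) ^ (2 * δ) / (2 * δ) :=
    Real.log_le_rpow_div (by linarith) (by linarith)
  have hone_le : 1 ≤ (x + 1) ^ (2 * δ) := Real.one_le_rpow (by linarith) (by linarith)
  have hpow : (x + 1) ^ (1 / 2 + δ) = √((x + 1) * (x + 1) ^ (2 * δ)) := by
    rw [Real.sqrt_eq_rpow, ← Real.rpow_one_add' (by linarith) (by linarith),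
      ← Real.rpow_mul (by linarith)]
    ring_nf
  rw [hpow, ← Real.sqrt_mul (by positivity), ← Real.sqrt_mul (by positivity)]
  refine Real.sqrt_le_sqrt ?_
  calc x * Real.log (y + 1 + x)
      ≤ (x + 1) * (Real.log (y + 3) * (1 + Real.log (x + 1))) := by
        refine mul_le_mul (by linarith) ?_ (Real.log_nonneg (by linarith)) (by linarith)
        nlinarith
    _ ≤ (x + 1) * (Real.log (y + 3) * ((x + 1) ^ (2 * δ) + (x + 1) ^ (2 * δ) / (2 * δ))) := by
        gcongr
    _ = (1 + 1 / (2 * δ)) * ((x + 1) * (x + 1) ^ (2 * δ)) * Real.log (y + 3) := by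
        field_simp

theorem exists_eq_add_intCast_mul_I {s : ℂ} (hs : 0 ≤ s.re) :
    ∃ (w : ℂ) (n : ℤ), s = w + n * Complex.I ∧ w.re = s.re ∧ ‖w‖ ≤ w.re + 1 ∧
      |(n : ℝ)| ≤ |s.im| + 1 := by
  have hn : |s.im - round s.im| ≤ 1 / 2 := abs_sub_round s.im
  have hre : (s - round s.im * Complex.I).re = s.re := by simp
  have him : (s - round s.im * Complex.I).im = s.im - round s.im := by simp
  refine ⟨s - round s.im * Complex.I, round s.im, by ring, hre, ?_, ?_⟩
  · refine (Complex.norm_le_abs_re_add_abs_im _).trans ?_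
    rw [him, hre, abs_of_nonneg hs]
    linarith
  · linarith [abs_sub_abs_le_abs_sub (round s.im : ℝ) s.im, abs_sub_comm (round s.im : ℝ) s.im]

namespace DensitySampling

variable {f : ℝ → ℝ} {a M : ℝ} (X : DensitySampling f a M)

theorem le_q (j : ℕ) : a ≤ X.q j := X.q_zero.symm.trans_le (X.q_mono (Nat.zero_le j))

theorem two_le_q (j : ℕ) : 2 ≤ X.q j := X.two_le.trans (X.le_q j)

theorem one_le_q (j : ℕ) : 1 ≤ X.q j := one_le_two.trans (X.two_le_q j)

theorem q_pos (j : ℕ) : 0 < X.q j := two_pos.trans_le (X.two_le_q j)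

theorem q_le_succ (j : ℕ) : X.q j ≤ X.q (j + 1) := X.q_mono (Nat.le_succ j)

theorem two_le_p (j : ℕ) : 2 ≤ X.p j := (X.two_le_q j).trans (X.p_mem j).1

theorem p_pos (j : ℕ) : 0 < X.p j := two_pos.trans_le (X.two_le_p j)

theorem M_pos (X : DensitySampling f a M) : 0 < M := (X.pos a le_rfl).trans_le (X.le a le_rfl)

theorem continuousOn_Icc (j : ℕ) : ContinuousOn f (Set.Icc (X.q j) (X.q (j + 1))) :=
  X.continuousOn.mono fun _ hu => (X.le_q j).trans hu.1

theorem intervalIntegrable (j : ℕ) : IntervalIntegrable f volume (X.q j) (X.q (j + 1)) :=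
  (X.continuousOn_Icc j).intervalIntegrable_of_Icc (X.q_le_succ j)

theorem natCast_le_mul_q_sub (j : ℕ) : (j : ℝ) ≤ M * (X.q j - a) := by
  have hstep (i : ℕ) : 1 ≤ M * (X.q (i + 1) - X.q i) := by
    rw [← X.integral_q i, mul_comm, ← smul_eq_mul, ← intervalIntegral.integral_const]
    exact intervalIntegral.integral_mono_on (X.q_le_succ i) (X.intervalIntegrable i)
      intervalIntegrable_const fun u hu => X.le u ((X.le_q i).trans hu.1)
  induction j with
  | zero => simp [X.q_zero]
  | succ j ih =>
    push_cast
    linarith [hstep j]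

theorem natCast_add_two_le (j : ℕ) : (j : ℝ) + 2 ≤ (M + 1) * X.q j := by
  nlinarith [X.natCast_le_mul_q_sub j, X.two_le_q j, X.M_pos, X.two_le]

theorem intervalIntegrable_mul (j : ℕ) {g : ℝ → ℂ}
    (hg : ContinuousOn g (Set.Icc (X.q j) (X.q (j + 1)))) :
    IntervalIntegrable (fun u => (f u : ℂ) * g u) volume (X.q j) (X.q (j + 1)) :=
  ((Complex.continuous_ofReal.comp_continuousOn (X.continuousOn_Icc j)).mul
    hg).intervalIntegrable_of_Icc (X.q_le_succ j)

theorem continuousOn_cpow (j : ℕ) (s : ℂ) :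
    ContinuousOn (fun u : ℝ => (u : ℂ) ^ s) (Set.Icc (X.q j) (X.q (j + 1))) := fun u hu =>
  (Complex.continuousAt_ofReal_cpow_const u s
    (Or.inr ((X.q_pos j).trans_le hu.1).ne')).continuousWithinAt

theorem norm_integral_mul_le (j : ℕ) {g : ℝ → ℂ} {B : ℝ}
    (hB : ∀ u ∈ Set.Icc (X.q j) (X.q (j + 1)), ‖g u‖ ≤ B) :
    ‖∫ u in X.q j..X.q (j + 1), (f u : ℂ) * g u‖ ≤ B := by
  refine (intervalIntegral.norm_integral_le_of_norm_le (X.q_le_succ j) (g := fun u => f u * B)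
    (ae_of_all _ fun u hu => ?_) ((X.intervalIntegrable j).mul_const B)).trans_eq ?_
  · have hfu : 0 < f u := X.pos u ((X.le_q j).trans hu.1.le)
    rw [norm_mul, Complex.norm_real, Real.norm_of_nonneg hfu.le]
    gcongr
    exact hB u (Set.Ioc_subset_Icc_self hu)
  · rw [intervalIntegral.integral_mul_const, X.integral_q, one_mul]

/-- The contribution `p_j⁻ˢ - ∫ u⁻ˢ f(u) du`, over `[q_j, q_{j+1}]`, of one sample point to the
discrepancy. -/
def discrepancyTerm (s : ℂ) (j : ℕ) : ℂ :=
  (X.p j : ℂ) ^ (-s) - ∫ u in X.q j..X.q (j + 1), (f u : ℂ) * (u : ℂ) ^ (-s)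

/-- The discrepancy `∑ p_j⁻ˢ - ∫ u⁻ˢ f(u) du` between the sample and its density; the difference
converges for `Re s > 0`, although sum and integral separately need `Re s > 1`. -/
def discrepancy (s : ℂ) : ℂ := ∑' j, X.discrepancyTerm s j

theorem norm_cpow_neg_sub_cpow_neg_le (j : ℕ) {x y : ℝ} (hx : x ∈ Set.Icc (X.q j) (X.q (j + 1)))
    (hy : y ∈ Set.Icc (X.q j) (X.q (j + 1))) (w : ℂ) :
    ‖(y : ℂ) ^ (-w) - (x : ℂ) ^ (-w)‖ ≤
      ‖w‖ * ∫ v in X.q j..X.q (j + 1), v ^ (-w.re - 1) :=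
  _root_.norm_cpow_neg_sub_cpow_neg_le (X.q_pos j) hx hy w

theorem norm_discrepancyTerm_le (s : ℂ) (j : ℕ) :
    ‖X.discrepancyTerm s j‖ ≤ ‖s‖ * ∫ v in X.q j..X.q (j + 1), v ^ (-s.re - 1) := by
  have heq : X.discrepancyTerm s j =
      ∫ u in X.q j..X.q (j + 1), (f u : ℂ) * ((X.p j : ℂ) ^ (-s) - (u : ℂ) ^ (-s)) := by
    simp_rw [mul_sub]
    rw [intervalIntegral.integral_sub (X.intervalIntegrable_mul j continuousOn_const)
      (X.intervalIntegrable_mul j (X.continuousOn_cpow j _)), intervalIntegral.integral_mul_const,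
      intervalIntegral.integral_ofReal, X.integral_q, Complex.ofReal_one, one_mul,
      discrepancyTerm]
  rw [heq]
  exact X.norm_integral_mul_le j fun u hu => X.norm_cpow_neg_sub_cpow_neg_le j hu (X.p_mem j) s

theorem summable_discrepancyTerm {s : ℂ} (hs : 0 < s.re) : Summable (X.discrepancyTerm s) :=
  .of_norm_bounded ((summable_integral_rpow_neg X.one_le_q X.q_mono hs).mul_left ‖s‖)
    (X.norm_discrepancyTerm_le s)

theorem differentiable_discrepancyTerm (j : ℕ) :
    Differentiable ℂ fun s => X.discrepancyTerm s j := by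
  have hp : (X.p j : ℂ) ≠ 0 := mod_cast (X.p_pos j).ne'
  refine .sub (fun s => differentiableAt_id.neg.const_cpow (Or.inl hp))
    (differentiable_integral_mul_cpow_neg (X.q_pos j) (X.q_le_succ j) ?_)
  exact ((intervalIntegrable_iff_integrableOn_Ioc_of_le (X.q_le_succ j)).1
    (X.intervalIntegrable j)).ofReal

theorem differentiableAt_discrepancy {s : ℂ} (hs : 0 < s.re) :
    DifferentiableAt ℂ X.discrepancy s := by
  set U : Set ℂ := {z | s.re / 2 < z.re} ∩ Metric.ball 0 (‖s‖ + 1)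
  have hU : IsOpen U := (isOpen_lt continuous_const Complex.continuous_re).inter Metric.isOpen_ball
  have hsU : s ∈ U := ⟨show s.re / 2 < s.re by linarith, by simp⟩
  refine (Complex.differentiableOn_tsum_of_summable_norm
    (u := fun j => (‖s‖ + 1) * ∫ v in X.q j..X.q (j + 1), v ^ (-(s.re / 2) - 1))
    ((summable_integral_rpow_neg X.one_le_q X.q_mono (half_pos hs)).mul_left _)
    (fun j => (X.differentiable_discrepancyTerm j).differentiableOn) hU
    (fun j z hz => (X.norm_discrepancyTerm_le z j).trans ?_)).differentiableAt (hU.mem_nhds hsU)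
  have hz1 : s.re / 2 < z.re := hz.1
  refine mul_le_mul (mem_ball_zero_iff.1 hz.2).le ?_
    (integral_rpow_nonneg_of_monotone X.one_le_q X.q_mono _ j) (by positivity)
  refine intervalIntegral.integral_mono_on (X.q_le_succ j)
    (intervalIntegrable_rpow_const (X.q_pos j) (X.q_pos _) _)
    (intervalIntegrable_rpow_const (X.q_pos j) (X.q_pos _) _) fun v hv => ?_
  exact Real.rpow_le_rpow_of_exponent_le ((X.one_le_q j).trans hv.1) (by linarith)

theorem discrepancyTerm_add_sub_mul (w z : ℂ) (j : ℕ) :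
    X.discrepancyTerm (w + z) j - (X.q j : ℂ) ^ (-w) * X.discrepancyTerm z j =
      ((X.p j : ℂ) ^ (-w) - (X.q j : ℂ) ^ (-w)) * (X.p j : ℂ) ^ (-z) -
      ∫ u in X.q j..X.q (j + 1), (f u : ℂ) *
        (((u : ℂ) ^ (-w) - (X.q j : ℂ) ^ (-w)) * (u : ℂ) ^ (-z)) := by
  have hsplit (u : ℝ) (hu : u ∈ Set.Icc (X.q j) (X.q (j + 1))) :
      (u : ℂ) ^ (-(w + z)) = (u : ℂ) ^ (-w) * (u : ℂ) ^ (-z) := by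
    rw [neg_add, Complex.cpow_add _ _ (by exact_mod_cast ((X.q_pos j).trans_le hu.1).ne')]
  have hint : ∫ u in X.q j..X.q (j + 1), (f u : ℂ) *
      (((u : ℂ) ^ (-w) - (X.q j : ℂ) ^ (-w)) * (u : ℂ) ^ (-z)) =
      (∫ u in X.q j..X.q (j + 1), (f u : ℂ) * (u : ℂ) ^ (-(w + z))) -
      (X.q j : ℂ) ^ (-w) * ∫ u in X.q j..X.q (j + 1), (f u : ℂ) * (u : ℂ) ^ (-z) := by
    rw [← intervalIntegral.integral_const_mul, ← intervalIntegral.integral_sub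
      (X.intervalIntegrable_mul j (X.continuousOn_cpow j _))
      ((X.intervalIntegrable_mul j (X.continuousOn_cpow j _)).const_mul _)]
    refine intervalIntegral.integral_congr fun u hu => ?_
    rw [Set.uIcc_of_le (X.q_le_succ j)] at hu
    simp only [hsplit u hu]
    ring
  rw [hint]
  simp only [discrepancyTerm, hsplit _ (X.p_mem j)]
  ring

theorem norm_discrepancyTerm_add_sub_mul_le (w : ℂ) (n : ℤ) (j : ℕ) :
    ‖X.discrepancyTerm (w + n * Complex.I) j -
      (X.q j : ℂ) ^ (-w) * X.discrepancyTerm (n * Complex.I) j‖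
      ≤ 2 * ‖w‖ * ∫ v in X.q j..X.q (j + 1), v ^ (-w.re - 1) := by
  have hnorm (u : ℝ) (hu : u ∈ Set.Icc (X.q j) (X.q (j + 1))) :
      ‖((u : ℂ) ^ (-w) - (X.q j : ℂ) ^ (-w)) * (u : ℂ) ^ (-(n * Complex.I))‖ ≤
      ‖w‖ * ∫ v in X.q j..X.q (j + 1), v ^ (-w.re - 1) := by
    rw [norm_mul, Complex.norm_cpow_eq_rpow_re_of_pos ((X.q_pos j).trans_le hu.1)]
    simpa using X.norm_cpow_neg_sub_cpow_neg_le j (Set.left_mem_Icc.2 (X.q_le_succ j)) hu w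
  rw [discrepancyTerm_add_sub_mul, mul_assoc, two_mul]
  exact (norm_sub_le _ _).trans (add_le_add (hnorm _ (X.p_mem j)) (X.norm_integral_mul_le j hnorm))

theorem exists_norm_sum_discrepancyTerm_le {δ : ℝ} (hδ : 0 < δ) :
    ∃ K : ℝ, 0 ≤ K ∧ ∀ (n : ℤ) (J i : ℕ), J ≤ i + 1 →
      ‖∑ j ∈ Finset.range J, X.discrepancyTerm (n * Complex.I) j‖ ≤
        K * √(Real.log (|(n : ℝ)| + 3)) * X.q i ^ (1 / 2 + δ) := by
  have hM := X.M_pos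
  have hC := X.C_nonneg
  refine ⟨X.C * (√(1 + 1 / (2 * δ)) * (M + 1) ^ (1 / 2 + δ)), by positivity, fun n J i hJ => ?_⟩
  have hJq : ((J : ℝ) + 1) ^ (1 / 2 + δ) ≤ (M + 1) ^ (1 / 2 + δ) * X.q i ^ (1 / 2 + δ) := by
    rw [← Real.mul_rpow (by linarith) (X.q_pos i).le]
    refine Real.rpow_le_rpow (by positivity) ?_ (by linarith)
    have : (J : ℝ) ≤ i + 1 := mod_cast hJ
    linarith [X.natCast_add_two_le i]
  calc _ ≤ X.C * √(J * Real.log (|(n : ℝ)| + 1 + J)) := X.norm_sum_le n J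
    _ ≤ X.C * (√(1 + 1 / (2 * δ)) * (J + 1) ^ (1 / 2 + δ) * √(Real.log (|(n : ℝ)| + 3))) := by
        gcongr
        exact sqrt_mul_log_add_le hδ J.cast_nonneg (abs_nonneg _)
    _ ≤ X.C * (√(1 + 1 / (2 * δ)) * ((M + 1) ^ (1 / 2 + δ) * X.q i ^ (1 / 2 + δ)) *
        √(Real.log (|(n : ℝ)| + 3))) := by gcongr
    _ = _ := by ring

theorem norm_sum_discrepancyTerm_le {B b : ℝ} {n : ℤ} {w : ℂ} (hB : 0 ≤ B) (hb : 0 ≤ b)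
    (hw : b < w.re)
    (hsum : ∀ i J : ℕ, J ≤ i + 1 →
      ‖∑ j ∈ Finset.range J, X.discrepancyTerm (n * Complex.I) j‖ ≤ B * X.q i ^ b) (J : ℕ) :
    ‖∑ j ∈ Finset.range J, X.discrepancyTerm (w + n * Complex.I) j‖ ≤
      2 * ‖w‖ / w.re + (1 + ‖w‖ / (w.re - b)) * B := by
  have herr : ‖∑ j ∈ Finset.range J, (X.discrepancyTerm (w + n * Complex.I) j -
      (X.q j : ℂ) ^ (-w) * X.discrepancyTerm (n * Complex.I) j)‖ ≤ 2 * ‖w‖ / w.re :=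
    calc _ ≤ ∑ j ∈ Finset.range J, 2 * ‖w‖ * ∫ v in X.q j..X.q (j + 1), v ^ (-w.re - 1) :=
          norm_sum_le_of_le _ fun j _ => X.norm_discrepancyTerm_add_sub_mul_le w n j
      _ ≤ 2 * ‖w‖ * (1 / w.re) := by
          rw [← Finset.mul_sum]
          gcongr
          exact sum_integral_rpow_neg_le X.one_le_q X.q_mono (hb.trans_lt hw) J
      _ = _ := mul_one_div _ _
  rw [← sub_add_cancel (∑ j ∈ Finset.range J, X.discrepancyTerm (w + n * Complex.I) j)
    (∑ j ∈ Finset.range J, (X.q j : ℂ) ^ (-w) * X.discrepancyTerm (n * Complex.I) j),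
    ← Finset.sum_sub_distrib]
  exact (norm_add_le _ _).trans (add_le_add herr
    (norm_sum_cpow_neg_mul_le X.one_le_q X.q_mono hB hb hsum hw J))

theorem exists_norm_discrepancy_le {σ₀ : ℝ} (hσ₀ : 1 / 2 < σ₀) :
    ∃ K : ℝ, ∀ s : ℂ, σ₀ ≤ s.re → ‖X.discrepancy s‖ ≤ K * √(Real.log (|s.im| + 4)) := by
  set δ := (σ₀ - 1 / 2) / 2 with hδ
  have hδ0 : 0 < δ := by linarith
  obtain ⟨K, hK, hKb⟩ := X.exists_norm_sum_discrepancyTerm_le hδ0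
  set R := (1 + σ₀) / δ
  have hR0 : 0 ≤ R := by positivity
  refine ⟨2 * R + (1 + R) * K, fun s hs => ?_⟩
  obtain ⟨w, n, hsw, hwre, hw, hn⟩ := exists_eq_add_intCast_mul_I (by linarith : 0 ≤ s.re)
  have hwR : ‖w‖ / (w.re - (1 / 2 + δ)) ≤ R := by
    rw [div_le_div_iff₀ (by linarith) hδ0]
    nlinarith
  have hwR' : ‖w‖ / w.re ≤ R := by
    refine le_trans ?_ hwR
    gcongr <;> linarith
  set ℓ := √(Real.log (|s.im| + 4))
  have hℓ1 : 1 ≤ ℓ := by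
    rw [Real.one_le_sqrt, Real.le_log_iff_exp_le (by positivity)]
    linarith [Real.exp_one_lt_d9, abs_nonneg s.im]
  have hℓn : √(Real.log (|(n : ℝ)| + 3)) ≤ ℓ :=
    Real.sqrt_le_sqrt (Real.log_le_log (by positivity) (by linarith))
  refine le_of_tendsto
    (X.summable_discrepancyTerm (by linarith : 0 < s.re)).hasSum.tendsto_sum_nat.norm
    (Eventually.of_forall fun J => ?_)
  rw [hsw]
  calc _ ≤ 2 * ‖w‖ / w.re + (1 + ‖w‖ / (w.re - (1 / 2 + δ))) * (K * ℓ) :=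
        X.norm_sum_discrepancyTerm_le (by positivity) (by positivity) (by linarith)
          (fun i J hJ => (hKb n J i hJ).trans (by
            have := Real.rpow_nonneg (X.q_pos i).le (1 / 2 + δ)
            gcongr)) J
    _ ≤ 2 * R * ℓ + (1 + R) * (K * ℓ) := by
        gcongr
        rw [mul_div_assoc]
        nlinarith
    _ = (2 * R + (1 + R) * K) * ℓ := by ring

end DensitySampling

/-! ### Euler products -/

section EulerProduct

variable {ι : Type*}

theorem sum_finsupp_prod_pow {R : Type*} [CommSemiring R] (z : ι → R) (s : Finset ι)
    (T : Finset ℕ) :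
    ∑ g ∈ s.finsupp (fun _ => T), (g.prod fun j k => z j ^ k) = ∏ j ∈ s, ∑ k ∈ T, z j ^ k := by
  classical
  rw [Finset.prod_sum, Finset.finsupp, Finset.sum_map]
  refine Finset.sum_congr (by congr!) fun g _ => ?_
  simp only [Function.Embedding.coeFn_mk]
  rw [Finsupp.prod_of_support_subset _ (Finsupp.support_indicator_subset s g) _ (by simp),
    ← Finset.prod_attach s]
  refine Finset.prod_congr rfl fun j _ => ?_
  rw [Finsupp.indicator_of_mem j.2]

theorem tendsto_finset_finsupp_range :
    Tendsto (fun b : Finset ι × ℕ => b.1.finsupp fun _ => Finset.range (b.2 + 1))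
      (atTop ×ˢ atTop) atTop := by
  rw [prod_atTop_atTop_eq]
  refine tendsto_atTop_finset_of_monotone (fun b c hbc g hg => ?_)
    fun g => ⟨(g.support, g.support.sup g), ?_⟩
  · rw [Finset.mem_finsupp_iff] at hg ⊢
    refine ⟨hg.1.trans hbc.1, fun i _ => ?_⟩
    by_cases hi : i ∈ b.1
    · exact Finset.range_subset_range.2 (Nat.succ_le_succ hbc.2) (hg.2 i hi)
    · simp [Finsupp.notMem_support_iff.1 fun h => hi (hg.1 h)]
  · exact Finset.mem_finsupp_iff.2 ⟨subset_rfl, fun i hi =>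
      Finset.mem_range.2 (Nat.lt_succ_of_le (Finset.le_sup (f := g) hi))⟩

theorem summable_finsupp_prod_pow_of_nonneg {x : ι → ℝ} (hx0 : ∀ j, 0 ≤ x j) (hx1 : ∀ j, x j < 1)
    (hs : Summable x) : Summable fun g : ι →₀ ℕ => g.prod fun j k => x j ^ k := by
  have hlog : Summable fun j => Real.log (1 - x j)⁻¹ := by
    simpa only [Real.log_inv, ← sub_eq_add_neg] using
      (Real.summable_log_one_add_of_summable hs.neg).neg
  refine summable_of_sum_le (c := Real.exp (∑' j, Real.log (1 - x j)⁻¹))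
    (fun g => Finset.prod_nonneg fun j _ => pow_nonneg (hx0 j) _) fun A => ?_
  obtain ⟨⟨s, K⟩, hA⟩ := (tendsto_finset_finsupp_range.eventually_ge_atTop A).exists
  calc _ ≤ ∑ g ∈ s.finsupp (fun _ => Finset.range (K + 1)), g.prod fun j k => x j ^ k :=
        Finset.sum_le_sum_of_subset_of_nonneg hA
          fun g _ _ => Finset.prod_nonneg fun j _ => pow_nonneg (hx0 j) _
    _ = ∏ j ∈ s, ∑ k ∈ Finset.range (K + 1), x j ^ k := sum_finsupp_prod_pow _ _ _
    _ ≤ ∏ j ∈ s, (1 - x j)⁻¹ := Finset.prod_le_prod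
        (fun j _ => Finset.sum_nonneg fun k _ => pow_nonneg (hx0 j) _) fun j _ =>
          sum_le_hasSum _ (fun k _ => pow_nonneg (hx0 j) _)
            (hasSum_geometric_of_lt_one (hx0 j) (hx1 j))
    _ = Real.exp (∑ j ∈ s, Real.log (1 - x j)⁻¹) := by
        rw [Real.exp_sum]
        exact Finset.prod_congr rfl fun j _ =>
          (Real.exp_log (inv_pos.2 (sub_pos.2 (hx1 j)))).symm
    _ ≤ Real.exp (∑' j, Real.log (1 - x j)⁻¹) :=
        Real.exp_le_exp.2 <| hlog.sum_le_tsum _ fun j _ =>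
          Real.log_nonneg (one_le_inv_iff₀.2 ⟨sub_pos.2 (hx1 j), sub_le_self _ (hx0 j)⟩)

theorem hasProd_inv_one_sub {z : ι → ℂ} (hz : ∀ j, ‖z j‖ < 1) (hs : Summable z) :
    HasProd (fun j => (1 - z j)⁻¹) (Complex.exp (∑' j, -Complex.log (1 - z j))) := by
  have hlog : Summable fun j => -Complex.log (1 - z j) := by
    simpa only [← sub_eq_add_neg] using (Complex.summable_log_one_add_of_summable hs.neg).neg
  refine hlog.hasSum.cexp.congr_fun fun j => ?_
  have hne : 1 - z j ≠ 0 := fun h => by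
    simpa [← sub_eq_zero.1 h] using hz j
  rw [Function.comp_apply, Complex.exp_neg, Complex.exp_log hne]

theorem hasSum_finsupp_prod_pow {z : ι → ℂ} (hz : ∀ j, ‖z j‖ < 1) (hs : Summable z) :
    HasSum (fun g : ι →₀ ℕ => g.prod fun j k => z j ^ k)
      (Complex.exp (∑' j, -Complex.log (1 - z j))) := by
  have hsum : Summable fun g : ι →₀ ℕ => g.prod fun j k => z j ^ k :=
    .of_norm ((summable_finsupp_prod_pow_of_nonneg (fun j => norm_nonneg (z j)) hz hs.norm).congr
      fun g => by simp [Finsupp.prod, norm_prod])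
  have hbox : Tendsto (fun b : Finset ι × ℕ => ∏ j ∈ b.1, ∑ k ∈ Finset.range (b.2 + 1), z j ^ k)
      (atTop ×ˢ atTop) (𝓝 (∑' g : ι →₀ ℕ, g.prod fun j k => z j ^ k)) :=
    (hsum.hasSum.comp tendsto_finset_finsupp_range).congr fun b => sum_finsupp_prod_pow _ _ _
  have hgeom (s : Finset ι) :
      Tendsto (fun K => ∏ j ∈ s, ∑ k ∈ Finset.range (K + 1), z j ^ k) atTop
        (𝓝 (∏ j ∈ s, (1 - z j)⁻¹)) :=
    tendsto_finsetProd _ fun j _ =>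
      (hasSum_geometric_of_norm_lt_one (hz j)).tendsto_sum_nat.comp (tendsto_add_atTop_nat 1)
  have hprod : HasProd (fun j => (1 - z j)⁻¹) (∑' g : ι →₀ ℕ, g.prod fun j k => z j ^ k) :=
    Metric.tendsto_nhds.2 fun ε hε =>
      (Metric.tendsto_nhds.1 hbox _ (half_pos hε)).curry.mono fun s hK =>
        (le_of_tendsto ((hgeom s).dist tendsto_const_nhds) (hK.mono fun _ h => h.le)).trans_lt
          (half_lt_self hε)
  rw [(hasProd_inv_one_sub hz hs).unique hprod]
  exact hsum.hasSum

end EulerProduct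

theorem norm_neg_log_one_sub_sub_self_le {z : ℂ} (hz : ‖z‖ ≤ 3 / 4) :
    ‖-Complex.log (1 - z) - z‖ ≤ 2 * ‖z‖ ^ 2 := by
  have hlog := Complex.norm_log_one_add_sub_self_le (z := -z) (by rw [norm_neg]; linarith)
  rw [norm_neg, ← sub_eq_add_neg, sub_neg_eq_add, ← norm_neg, neg_add'] at hlog
  have hinv : (1 - ‖z‖)⁻¹ ≤ 4 := by
    rw [inv_le_iff_one_le_mul₀ (by linarith)]
    linarith
  calc _ ≤ ‖z‖ ^ 2 * (1 - ‖z‖)⁻¹ / 2 := hlog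
    _ ≤ ‖z‖ ^ 2 * 4 / 2 := by gcongr
    _ = 2 * ‖z‖ ^ 2 := by ring

namespace BeurlingPrimes

variable (P : BeurlingPrimes)

theorem p_pos (j : ℕ) : 0 < P.p j := one_pos.trans (P.one_lt j)

theorem norm_pos (g : P.Integers) : 0 < P.norm g :=
  Finset.prod_pos fun j _ => pow_pos (P.p_pos j) _

theorem one_le_norm (g : P.Integers) : 1 ≤ P.norm g :=
  (one_le_pow₀ (P.one_lt 0).le).trans (P.pow_le_norm g 0)

theorem log_norm (g : P.Integers) :
    Real.log (P.norm g) = ∑ j ∈ g.support, g j * Real.log (P.p j) := by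
  rw [norm, Finsupp.prod, Real.log_prod fun j _ => (pow_pos (P.p_pos j) _).ne']
  exact Finset.sum_congr rfl fun j _ => Real.log_pow _ _

theorem ofReal_norm_cpow (g : P.Integers) (s : ℂ) :
    (P.norm g : ℂ) ^ s = g.prod fun j k => ((P.p j : ℂ) ^ s) ^ k := by
  have hexp {x : ℝ} (hx : 0 < x) : (x : ℂ) ^ s = Complex.exp (Real.log x * s) := by
    rw [Complex.cpow_def_of_ne_zero (by exact_mod_cast hx.ne'), Complex.ofReal_log hx.le]
  rw [hexp (P.norm_pos g), log_norm, Complex.ofReal_sum, Finset.sum_mul, Complex.exp_sum]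
  refine Finset.prod_congr rfl fun j _ => ?_
  simp only [hexp (P.p_pos j), ← Complex.exp_nat_mul]
  push_cast
  ring_nf

theorem norm_p_cpow_neg (j : ℕ) (s : ℂ) : ‖(P.p j : ℂ) ^ (-s)‖ = P.p j ^ (-s.re) := by
  rw [Complex.norm_cpow_eq_rpow_re_of_pos (P.p_pos j), Complex.neg_re]

theorem norm_p_cpow_neg_le {j : ℕ} (hj : 2 ≤ P.p j) {s : ℂ} (hs : 1 / 2 ≤ s.re) :
    ‖(P.p j : ℂ) ^ (-s)‖ ≤ 3 / 4 := by
  rw [P.norm_p_cpow_neg]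
  calc P.p j ^ (-s.re) ≤ P.p j ^ (-(1 / 2) : ℝ) :=
        Real.rpow_le_rpow_of_exponent_le (P.one_lt j).le (by linarith)
    _ ≤ 2 ^ (-(1 / 2) : ℝ) := Real.rpow_le_rpow_of_nonpos two_pos hj (by norm_num)
    _ ≤ 3 / 4 := by
        rw [Real.rpow_neg two_pos.le, ← Real.sqrt_eq_rpow,
          inv_le_comm₀ (by positivity) (by norm_num)]
        exact Real.le_sqrt_of_sq_le (by norm_num)

/-- The contribution `∑ⱼ ∑_{k ≥ 2} pⱼ^(-ks) / k` of the higher prime powers to `log ζ(s)`. -/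
def logZetaPowers (s : ℂ) : ℂ :=
  ∑' j, (-Complex.log (1 - (P.p j : ℂ) ^ (-s)) - (P.p j : ℂ) ^ (-s))

theorem hasSum_norm_cpow (h2 : ∀ j, 2 ≤ P.p j) {s : ℂ} (hs : 1 / 2 ≤ s.re)
    (hsum : Summable fun j => P.p j ^ (-s.re)) :
    HasSum (fun g : P.Integers => (P.norm g : ℂ) ^ (-s))
      (Complex.exp (∑' j, (P.p j : ℂ) ^ (-s) + P.logZetaPowers s)) := by
  have hp : Summable fun j => (P.p j : ℂ) ^ (-s) :=
    .of_norm (hsum.congr fun j => (P.norm_p_cpow_neg j s).symm)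
  have hlog : Summable fun j => -Complex.log (1 - (P.p j : ℂ) ^ (-s)) := by
    simpa only [← sub_eq_add_neg] using (Complex.summable_log_one_add_of_summable hp.neg).neg
  have hsub : ∑' j, -Complex.log (1 - (P.p j : ℂ) ^ (-s)) =
      ∑' j, (P.p j : ℂ) ^ (-s) + P.logZetaPowers s := by
    rw [logZetaPowers, hlog.tsum_sub hp, add_sub_cancel]
  simp_rw [P.ofReal_norm_cpow, ← hsub]
  exact hasSum_finsupp_prod_pow
    (fun j => (P.norm_p_cpow_neg_le (h2 j) hs).trans_lt (by norm_num)) hp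

theorem norm_logZetaPowers_term_le (h2 : ∀ j, 2 ≤ P.p j) {σ : ℝ} (hσ : 1 / 2 ≤ σ) {s : ℂ}
    (hs : σ ≤ s.re) (j : ℕ) :
    ‖-Complex.log (1 - (P.p j : ℂ) ^ (-s)) - (P.p j : ℂ) ^ (-s)‖ ≤ 2 * P.p j ^ (-(2 * σ)) := by
  refine (norm_neg_log_one_sub_sub_self_le (P.norm_p_cpow_neg_le (h2 j) (hσ.trans hs))).trans ?_
  rw [P.norm_p_cpow_neg, ← Real.rpow_mul_natCast (P.p_pos j).le]
  gcongr
  · exact (P.one_lt j).le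
  · push_cast
    linarith

theorem exists_norm_logZetaPowers_le (h2 : ∀ j, 2 ≤ P.p j)
    (hsum : ∀ σ : ℝ, 1 < σ → Summable fun j => P.p j ^ (-σ)) {σ : ℝ} (hσ : 1 / 2 < σ) :
    ∃ K : ℝ, ∀ s : ℂ, σ ≤ s.re → ‖P.logZetaPowers s‖ ≤ K :=
  ⟨_, fun _ hs => tsum_of_norm_bounded ((hsum (2 * σ) (by linarith)).mul_left 2).hasSum
    (P.norm_logZetaPowers_term_le h2 hσ.le hs)⟩

theorem differentiableAt_logZetaPowers (h2 : ∀ j, 2 ≤ P.p j)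
    (hsum : ∀ σ : ℝ, 1 < σ → Summable fun j => P.p j ^ (-σ)) {s : ℂ} (hs : 1 / 2 < s.re) :
    DifferentiableAt ℂ P.logZetaPowers s := by
  obtain ⟨σ, hσ, hσs⟩ := exists_between hs
  have hU : IsOpen {z : ℂ | σ < z.re} := isOpen_lt continuous_const Complex.continuous_re
  refine (Complex.differentiableOn_tsum_of_summable_norm
    ((hsum (2 * σ) (by linarith)).mul_left 2) (fun j z (hz : σ < z.re) => ?_) hU
    (fun j z hz => P.norm_logZetaPowers_term_le h2 hσ.le (le_of_lt hz) j)).differentiableAt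
    (hU.mem_nhds hσs)
  have hp : (P.p j : ℂ) ≠ 0 := mod_cast (P.p_pos j).ne'
  have hd : DifferentiableAt ℂ (fun z : ℂ => (P.p j : ℂ) ^ (-z)) z :=
    differentiableAt_id.neg.const_cpow (Or.inl hp)
  have hslit : 1 - (P.p j : ℂ) ^ (-z) ∈ Complex.slitPlane := by
    rw [sub_eq_add_neg]
    refine Complex.mem_slitPlane_of_norm_lt_one ?_
    rw [norm_neg]
    linarith [P.norm_p_cpow_neg_le (h2 j) (s := z) (by linarith)]
  exact ((((differentiableAt_const 1).sub hd).clog hslit).neg.sub hd).differentiableWithinAt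

end BeurlingPrimes

/-! ### The density with prescribed zeros -/

/-- The kernel `∫₀¹ u⁻ᵛ dv`, which equals `(1 - 1/u) / log u` for `u > 1`; the integral also has the
right value at `u = 1`. -/
def logKernel (u : ℝ) : ℝ := ∫ v in (0 : ℝ)..1, Real.exp (-(v * Real.log u))

theorem continuousOn_logKernel : ContinuousOn logKernel (Set.Ioi 0) := by
  have h : Continuous fun y : ℝ => ∫ v in (0 : ℝ)..1, Real.exp (-(v * y)) :=
    intervalIntegral.continuous_parametric_intervalIntegral_of_continuous' (by fun_prop) 0 1
  exact h.comp_continuousOn (Real.continuousOn_log.mono fun u hu => ne_of_gt hu)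

theorem continuous_exp_neg_mul (y : ℝ) : Continuous fun v : ℝ => Real.exp (-(v * y)) := by
  fun_prop

theorem inv_le_logKernel {u : ℝ} (hu : 1 ≤ u) : u⁻¹ ≤ logKernel u := by
  have h := intervalIntegral.integral_mono_on (μ := volume) zero_le_one
    (intervalIntegrable_const (c := u⁻¹))
    ((continuous_exp_neg_mul (Real.log u)).intervalIntegrable 0 1) fun v hv => by
      rw [← Real.exp_log (inv_pos.2 (one_pos.trans_le hu)), Real.log_inv, Real.exp_le_exp,
        neg_le_neg_iff]
      exact mul_le_of_le_one_left (Real.log_nonneg hu) hv.2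
  simpa [logKernel] using h

theorem logKernel_le_one {u : ℝ} (hu : 1 ≤ u) : logKernel u ≤ 1 := by
  have h := intervalIntegral.integral_mono_on (μ := volume) zero_le_one
    ((continuous_exp_neg_mul (Real.log u)).intervalIntegrable 0 1)
    (intervalIntegrable_const (c := (1 : ℝ))) fun v hv => by
      rw [Real.exp_le_one_iff, neg_nonpos]
      exact mul_nonneg hv.1 (Real.log_nonneg hu)
  simpa [logKernel] using h

theorem logKernel_mul_log {u : ℝ} (hu : 0 < u) : logKernel u * Real.log u = 1 - u⁻¹ := by
  have hderiv (v : ℝ) : HasDerivAt (fun v => -Real.exp (-(v * Real.log u)))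
      (Real.exp (-(v * Real.log u)) * Real.log u) v :=
    (((hasDerivAt_id v).mul_const (Real.log u)).neg.exp).neg.congr_deriv (by simp)
  rw [logKernel, ← intervalIntegral.integral_mul_const,
    intervalIntegral.integral_eq_sub_of_hasDerivAt (fun v _ => hderiv v)
      (((continuous_exp_neg_mul _).mul_const _).intervalIntegrable _ _)]
  simp [Real.exp_neg, Real.exp_log hu]
  ring

theorem logKernel_mul_cpow {u : ℝ} (hu : 0 < u) (w : ℂ) :
    (logKernel u : ℂ) * (u : ℂ) ^ w = ∫ v in Set.Ioc (0 : ℝ) 1, (u : ℂ) ^ (w - v) := by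
  rw [logKernel, intervalIntegral.integral_of_le zero_le_one, ← integral_complex_ofReal, mul_comm,
    ← integral_const_mul]
  refine integral_congr_ae (ae_of_all _ fun v => ?_)
  have hu' : (u : ℂ) ≠ 0 := by exact_mod_cast hu.ne'
  simp only
  rw [sub_eq_add_neg, Complex.cpow_add _ _ hu', Complex.cpow_def_of_ne_zero hu' (-(v : ℂ)),
    ← Complex.ofReal_log hu.le]
  push_cast
  ring_nf

theorem integrable_cpow_sub_prod {z : ℂ} (hz : 0 < z.re) :
    Integrable (Function.uncurry fun (u v : ℝ) => (u : ℂ) ^ (-z - 1 - v))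
      ((volume.restrict (Set.Ioi 1)).prod (volume.restrict (Set.Ioc (0 : ℝ) 1))) := by
  have hg : Integrable (fun u : ℝ => u ^ (-z.re - 1)) (volume.restrict (Set.Ioi 1)) :=
    integrableOn_Ioi_rpow_of_lt (by linarith) one_pos
  have hg2 := hg.mul_prod (integrable_const (1 : ℝ) (μ := volume.restrict (Set.Ioc (0 : ℝ) 1)))
  rw [Measure.prod_restrict] at hg2 ⊢
  refine Integrable.mono' hg2 ?_ ?_
  · refine ContinuousOn.aestronglyMeasurable (fun x hx => ContinuousAt.continuousWithinAt ?_)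
      (measurableSet_Ioi.prod measurableSet_Ioc)
    have : (x.1 : ℂ) ∈ Complex.slitPlane :=
      Complex.ofReal_mem_slitPlane.2 (one_pos.trans hx.1)
    exact ContinuousAt.cpow (by fun_prop) (by fun_prop) this
  · filter_upwards [ae_restrict_mem (measurableSet_Ioi.prod measurableSet_Ioc)] with x hx
    have hx1 : (1 : ℝ) < x.1 := hx.1
    have hx2 : 0 < x.2 := hx.2.1
    simp only [Function.uncurry, mul_one]
    rw [Complex.norm_cpow_eq_rpow_re_of_pos (by linarith)]
    refine Real.rpow_le_rpow_of_exponent_le hx1.le ?_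
    simp
    linarith

theorem integrableOn_logKernel_mul_cpow {z : ℂ} (hz : 0 < z.re) :
    IntegrableOn (fun u : ℝ => (logKernel u : ℂ) * (u : ℂ) ^ (-z - 1)) (Set.Ioi 1) := by
  refine (integrable_cpow_sub_prod hz).integral_prod_left.congr ?_
  filter_upwards [ae_restrict_mem measurableSet_Ioi] with u hu
  rw [logKernel_mul_cpow (one_pos.trans hu)]
  rfl

theorem integral_logKernel_mul_cpow {z : ℂ} (hz : 0 < z.re) :
    ∫ u in Set.Ioi (1 : ℝ), (logKernel u : ℂ) * (u : ℂ) ^ (-z - 1) =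
      ∫ v in (0 : ℝ)..1, (z + v)⁻¹ := by
  rw [setIntegral_congr_fun measurableSet_Ioi fun u hu =>
    logKernel_mul_cpow (one_pos.trans hu) (-z - 1),
    integral_integral_swap (integrable_cpow_sub_prod hz),
    intervalIntegral.integral_of_le zero_le_one]
  refine setIntegral_congr_fun measurableSet_Ioc fun v hv => ?_
  have hre : (-z - 1 - v).re < -1 := by
    simp only [Complex.sub_re, Complex.neg_re, Complex.one_re, Complex.ofReal_re]
    linarith [hv.1]
  have hexp : -z - 1 - (v : ℂ) + 1 = -(z + v) := by ring
  rw [integral_Ioi_cpow_of_lt hre one_pos, hexp, Complex.ofReal_one, Complex.one_cpow,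
    neg_div_neg_eq, one_div]

theorem integral_inv_add_ofReal {z : ℂ} (hz : 0 < z.re) :
    ∫ v in (0 : ℝ)..1, (z + v)⁻¹ = Complex.log (z + 1) - Complex.log z := by
  have hslit {v : ℝ} (hv : v ∈ Set.uIcc (0 : ℝ) 1) : z + v ∈ Complex.slitPlane := by
    rw [Set.uIcc_of_le zero_le_one] at hv
    exact Or.inl (by simpa using add_pos_of_pos_of_nonneg hz hv.1)
  have hderiv : ∀ v ∈ Set.uIcc (0 : ℝ) 1,
      HasDerivAt (fun v : ℝ => Complex.log (z + v)) (z + v)⁻¹ v := fun v hv => by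
    simpa using (((hasDerivAt_id (v : ℂ)).const_add z).clog (hslit hv)).comp_ofReal
  rw [intervalIntegral.integral_eq_sub_of_hasDerivAt hderiv
    (ContinuousOn.intervalIntegrable fun v hv => ContinuousAt.continuousWithinAt ?_)]
  · simp
  · have hne := Complex.slitPlane_ne_zero (hslit hv)
    fun_prop (disch := assumption)

theorem exp_integral_logKernel_mul_cpow {z : ℂ} (hz : 0 < z.re) :
    Complex.exp (∫ u in Set.Ioi (1 : ℝ), (logKernel u : ℂ) * (u : ℂ) ^ (-z - 1)) =
      (z + 1) / z := by
  have hz0 : z ≠ 0 := fun h => by simp [h] at hz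
  have hz1 : z + 1 ≠ 0 := Complex.slitPlane_ne_zero (Or.inl (by simp; linarith))
  rw [integral_logKernel_mul_cpow hz, integral_inv_add_ofReal hz, Complex.exp_sub,
    Complex.exp_log hz1, Complex.exp_log hz0]

/-- The product `∏ (s - ρ) / (s - ρ + 1)` over `S`, a rational function with the zeros `S` whose
value at infinity is `1`. -/
def zeroProd (S : Multiset ℂ) (s : ℂ) : ℂ := (S.map fun ρ => (s - ρ) / (s - ρ + 1)).prod

theorem zeroProd_cons (ρ : ℂ) (S : Multiset ℂ) (s : ℂ) :
    zeroProd (ρ ::ₘ S) s = (s - ρ) / (s - ρ + 1) * zeroProd S s := by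
  simp [zeroProd]

/-- The power sum `∑ u^(ρ-1)` over `S`. -/
def powerSum (S : Multiset ℂ) (u : ℝ) : ℂ := (S.map fun ρ => (u : ℂ) ^ (ρ - 1)).sum

theorem powerSum_cons (ρ : ℂ) (S : Multiset ℂ) (u : ℝ) :
    powerSum (ρ ::ₘ S) u = (u : ℂ) ^ (ρ - 1) + powerSum S u := by
  simp [powerSum]

theorem continuousOn_powerSum (S : Multiset ℂ) : ContinuousOn (powerSum S) (Set.Ioi 0) :=
  fun u hu => tendsto_multiset_sum S fun _ _ =>
    (Complex.continuousAt_ofReal_cpow_const u _ (Or.inr (ne_of_gt hu))).continuousWithinAt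

theorem tendsto_ofReal_cpow_atTop_zero {w : ℂ} (hw : w.re < 0) :
    Tendsto (fun u : ℝ => (u : ℂ) ^ w) atTop (𝓝 0) := by
  rw [tendsto_zero_iff_norm_tendsto_zero]
  have h := tendsto_rpow_neg_atTop (neg_pos.2 hw)
  rw [neg_neg] at h
  exact h.congr' ((eventually_gt_atTop 0).mono fun u hu =>
    (Complex.norm_cpow_eq_rpow_re_of_pos hu _).symm)

theorem tendsto_powerSum {S : Multiset ℂ} (hS : ∀ ρ ∈ S, ρ.re < 1) :
    Tendsto (powerSum S) atTop (𝓝 0) := by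
  have h := tendsto_multiset_sum (f := fun ρ (u : ℝ) => (u : ℂ) ^ (ρ - 1)) (a := fun _ => 0) S
    fun ρ hρ => tendsto_ofReal_cpow_atTop_zero (by simpa using hS ρ hρ)
  rwa [Multiset.map_const', Multiset.sum_replicate, smul_zero] at h

theorem ofReal_re_powerSum {S : Multiset ℂ} (hsymm : S.map (starRingEnd ℂ) = S) {u : ℝ}
    (hu : 0 < u) : ((powerSum S u).re : ℂ) = powerSum S u := by
  have harg : (u : ℂ).arg ≠ Real.pi := by
    rw [Complex.arg_ofReal_of_nonneg hu.le]
    exact Real.pi_pos.ne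
  rw [← Complex.conj_eq_iff_re, powerSum, map_multiset_sum, Multiset.map_map]
  conv_rhs => rw [← hsymm, Multiset.map_map]
  refine congrArg _ (Multiset.map_congr rfl fun ρ _ => ?_)
  have hexp : (starRingEnd ℂ) ρ - 1 = (starRingEnd ℂ) (ρ - 1) := by simp
  rw [Function.comp_apply, Function.comp_apply, hexp, Complex.cpow_conj _ _ harg,
    Complex.conj_ofReal]

theorem logKernel_powerSum_transform {S : Multiset ℂ} {s : ℂ} (hS : ∀ ρ ∈ S, ρ.re < s.re) :
    IntegrableOn (fun u : ℝ => (logKernel u : ℂ) * (powerSum S u * (u : ℂ) ^ (-s))) (Set.Ioi 1) ∧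
    Complex.exp (∫ u in Set.Ioi (1 : ℝ), (logKernel u : ℂ) * (powerSum S u * (u : ℂ) ^ (-s))) =
      (zeroProd S s)⁻¹ := by
  induction S using Multiset.induction with
  | empty => simp [powerSum, zeroProd]
  | cons ρ S ih =>
    obtain ⟨hint, hexp⟩ := ih fun ρ' h' => hS ρ' (Multiset.mem_cons_of_mem h')
    have hz : 0 < (s - ρ).re := by
      rw [Complex.sub_re]
      exact sub_pos.2 (hS ρ (Multiset.mem_cons_self _ _))
    have hintρ := integrableOn_logKernel_mul_cpow hz
    have hcons : ∀ u ∈ Set.Ioi (1 : ℝ),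
        (logKernel u : ℂ) * (powerSum (ρ ::ₘ S) u * (u : ℂ) ^ (-s)) =
          (logKernel u : ℂ) * (u : ℂ) ^ (-(s - ρ) - 1) +
            (logKernel u : ℂ) * (powerSum S u * (u : ℂ) ^ (-s)) := fun u hu => by
      have hu0 : (u : ℂ) ≠ 0 := mod_cast (one_pos.trans hu).ne'
      rw [powerSum_cons, add_mul, ← Complex.cpow_add _ _ hu0, mul_add]
      ring_nf
    refine ⟨(hintρ.add hint).congr_fun (fun u hu => (hcons u hu).symm) measurableSet_Ioi, ?_⟩
    rw [setIntegral_congr_fun measurableSet_Ioi hcons, integral_add hintρ hint, Complex.exp_add,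
      hexp, exp_integral_logKernel_mul_cpow hz, zeroProd_cons, mul_inv, inv_div]

/-- The weight `1 + u^(r-1) - ∑ u^(ρ-1)`, the derivative of the main term of `ψ`. -/
def zeroWeight (r : ℝ) (S : Multiset ℂ) (u : ℝ) : ℂ := powerSum {1, (r : ℂ)} u - powerSum S u

theorem zeroWeight_eq (r : ℝ) (S : Multiset ℂ) (u : ℝ) :
    zeroWeight r S u = 1 + (u : ℂ) ^ ((r : ℂ) - 1) - powerSum S u := by
  simp [zeroWeight, powerSum]

/-- The density of primes that produces the zeros `S` and the poles `1` and `r`. -/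
def zeroDensity (r : ℝ) (S : Multiset ℂ) (u : ℝ) : ℝ := logKernel u * (zeroWeight r S u).re

theorem ofReal_re_zeroWeight (r : ℝ) {S : Multiset ℂ} (hsymm : S.map (starRingEnd ℂ) = S)
    {u : ℝ} (hu : 0 < u) : ((zeroWeight r S u).re : ℂ) = zeroWeight r S u := by
  rw [zeroWeight, Complex.sub_re, Complex.ofReal_sub, ofReal_re_powerSum (by simp) hu,
    ofReal_re_powerSum hsymm hu]

theorem continuousOn_zeroWeight (r : ℝ) (S : Multiset ℂ) :
    ContinuousOn (zeroWeight r S) (Set.Ioi 0) :=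
  (continuousOn_powerSum _).sub (continuousOn_powerSum S)

theorem continuousOn_zeroDensity (r : ℝ) (S : Multiset ℂ) :
    ContinuousOn (zeroDensity r S) (Set.Ioi 0) :=
  continuousOn_logKernel.mul
    (Complex.continuous_re.comp_continuousOn (continuousOn_zeroWeight r S))

theorem tendsto_zeroWeight {r : ℝ} (hr : r < 1) {S : Multiset ℂ} (hS : ∀ ρ ∈ S, ρ.re < 1) :
    Tendsto (zeroWeight r S) atTop (𝓝 1) := by
  have hpow : Tendsto (fun u : ℝ => (u : ℂ) ^ ((r : ℂ) - 1)) atTop (𝓝 0) :=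
    tendsto_ofReal_cpow_atTop_zero (by simpa using hr)
  simpa [← funext (zeroWeight_eq r S)] using (hpow.const_add 1).sub (tendsto_powerSum hS)

theorem tendsto_integral_atTop_of_mul_inv_le {f : ℝ → ℝ} {a c : ℝ} (ha : 0 < a) (hc : 0 < c)
    (hf : ContinuousOn f (Set.Ici a)) (hle : ∀ u, a ≤ u → c * u⁻¹ ≤ f u) :
    Tendsto (fun x => ∫ u in a..x, f u) atTop atTop := by
  refine tendsto_atTop_mono' _ (f₁ := fun x => c * (Real.log x - Real.log a)) ?_
    ((tendsto_atTop_add_const_right _ (-Real.log a) Real.tendsto_log_atTop).const_mul_atTop hc)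
  filter_upwards [eventually_ge_atTop a] with x hx
  have h0 : (0 : ℝ) ∉ Set.uIcc a x := by
    rw [Set.uIcc_of_le hx]
    exact fun h => ha.not_ge h.1
  rw [← Real.log_div (ha.trans_le hx).ne' ha.ne', ← integral_inv h0,
    ← intervalIntegral.integral_const_mul]
  refine intervalIntegral.integral_mono_on hx
    ((intervalIntegral.intervalIntegrable_inv (fun u hu h => h0 (h ▸ hu))
      continuousOn_id).const_mul _)
    (hf.mono fun u hu => ?_).intervalIntegrable fun u hu => hle u hu.1
  rw [Set.uIcc_of_le hx] at hu
  exact hu.1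

theorem exists_sampling_zeroDensity {r : ℝ} (hr : r < 1) {S : Multiset ℂ}
    (hS : ∀ ρ ∈ S, ρ.re < 1) : ∃ a : ℝ, Nonempty (DensitySampling (zeroDensity r S) a 2) := by
  have hre := (Complex.continuous_re.tendsto _).comp (tendsto_zeroWeight hr hS)
  obtain ⟨a, ha⟩ := ((hre.eventually_const_lt (show (1 / 2 : ℝ) < (1 : ℂ).re by norm_num)).and
    ((hre.eventually_lt_const (show (1 : ℂ).re < 2 by norm_num)).and
      (eventually_ge_atTop 2))).exists_forall_of_atTop
  have ha2 : 2 ≤ a := (ha a le_rfl).2.2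
  have ha0 : 0 < a := two_pos.trans_le ha2
  have hlow : ∀ u, a ≤ u → 1 / 2 * u⁻¹ ≤ zeroDensity r S u := fun u hu => by
    have hu1 : 1 ≤ u := by linarith
    rw [zeroDensity, mul_comm]
    exact mul_le_mul (inv_le_logKernel hu1) (ha u hu).1.le (by norm_num)
      ((inv_nonneg.2 (by linarith)).trans (inv_le_logKernel hu1))
  have hcont : ContinuousOn (zeroDensity r S) (Set.Ici a) :=
    (continuousOn_zeroDensity r S).mono fun u hu => ha0.trans_le hu
  refine ⟨a, nonempty_densitySampling ha2 hcont (fun u hu => ?_) (fun u hu => ?_)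
    (tendsto_integral_atTop_of_mul_inv_le ha0 one_half_pos hcont hlow)⟩
  · exact (mul_pos one_half_pos (inv_pos.2 (ha0.trans_le hu))).trans_le (hlow u hu)
  · calc zeroDensity r S u ≤ 1 * (zeroWeight r S u).re :=
          mul_le_mul_of_nonneg_right (logKernel_le_one (by linarith))
            (one_half_pos.trans (ha u hu).1).le
      _ ≤ 2 := by linarith [show (zeroWeight r S u).re < 2 from (ha u hu).2.1]

theorem zeroDensity_transform {r : ℝ} (hr : r < 1) {S : Multiset ℂ} (hS : ∀ ρ ∈ S, ρ.re < 1)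
    (hsymm : S.map (starRingEnd ℂ) = S) {s : ℂ} (hs : 1 < s.re) :
    IntegrableOn (fun u : ℝ => (zeroDensity r S u : ℂ) * (u : ℂ) ^ (-s)) (Set.Ioi 1) ∧
    Complex.exp (∫ u in Set.Ioi (1 : ℝ), (zeroDensity r S u : ℂ) * (u : ℂ) ^ (-s)) =
      zeroProd S s / zeroProd {1, (r : ℂ)} s := by
  have hpole : ∀ ρ ∈ ({1, (r : ℂ)} : Multiset ℂ), ρ.re < s.re := by
    simpa using ⟨hs, hr.trans hs⟩
  obtain ⟨hint₁, hexp₁⟩ := logKernel_powerSum_transform hpole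
  obtain ⟨hint₂, hexp₂⟩ := logKernel_powerSum_transform fun ρ hρ => (hS ρ hρ).trans hs
  have hsplit : ∀ u ∈ Set.Ioi (1 : ℝ), (zeroDensity r S u : ℂ) * (u : ℂ) ^ (-s) =
      (logKernel u : ℂ) * (powerSum {1, (r : ℂ)} u * (u : ℂ) ^ (-s)) -
        (logKernel u : ℂ) * (powerSum S u * (u : ℂ) ^ (-s)) := fun u hu => by
    rw [zeroDensity, Complex.ofReal_mul, ofReal_re_zeroWeight r hsymm (one_pos.trans hu),
      zeroWeight]
    ring
  refine ⟨(hint₁.sub hint₂).congr_fun (fun u hu => (hsplit u hu).symm) measurableSet_Ioi, ?_⟩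
  rw [setIntegral_congr_fun measurableSet_Ioi hsplit, integral_sub hint₁ hint₂, Complex.exp_sub,
    hexp₁, hexp₂, inv_div_inv]

/-- The function with the zeros `S` and simple poles at `1` and `r`, twisted by the factor
`exp ∘ G`. -/
def twistedZeta (r : ℝ) (S : Multiset ℂ) (G : ℂ → ℂ) (s : ℂ) : ℂ :=
  zeroProd S s / zeroProd {1, (r : ℂ)} s * Complex.exp (G s)

theorem norm_integral_mul_cpow_neg_le {f : ℝ → ℝ} {a : ℝ} (ha : 1 ≤ a)
    (hf : ContinuousOn f (Set.Icc 1 a)) {s : ℂ} (hs : 0 ≤ s.re) :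
    ‖∫ u in (1 : ℝ)..a, (f u : ℂ) * (u : ℂ) ^ (-s)‖ ≤ ∫ u in (1 : ℝ)..a, |f u| := by
  refine intervalIntegral.norm_integral_le_of_norm_le ha (ae_of_all _ fun u hu => ?_)
    (hf.abs.intervalIntegrable_of_Icc ha)
  rw [norm_mul, Complex.norm_real, Real.norm_eq_abs,
    Complex.norm_cpow_eq_rpow_re_of_pos (one_pos.trans hu.1), Complex.neg_re]
  exact mul_le_of_le_one_right (abs_nonneg _)
    (Real.rpow_le_one_of_one_le_of_nonpos hu.1.le (neg_nonpos.2 hs))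

theorem one_le_sqrt_log_abs_add_four (t : ℝ) : 1 ≤ √(Real.log (|t| + 4)) := by
  rw [Real.one_le_sqrt, Real.le_log_iff_exp_le (by positivity)]
  linarith [Real.exp_one_lt_d9, abs_nonneg t]

namespace DensitySampling

variable {f : ℝ → ℝ} {a M : ℝ} (X : DensitySampling f a M)

theorem one_le_a (X : DensitySampling f a M) : 1 ≤ a := one_le_two.trans X.two_le

theorem tendsto_q : Tendsto X.q atTop atTop := by
  have hM := X.M_pos
  refine tendsto_atTop_mono (f := fun j : ℕ => (j : ℝ) * (M + 1)⁻¹) (fun j => ?_)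
    (tendsto_natCast_atTop_atTop.atTop_mul_const (by positivity))
  rw [mul_inv_le_iff₀ (by positivity)]
  linarith [X.natCast_add_two_le j]

/-- The sample points as a sequence of Beurling primes. -/
def toBeurlingPrimes : BeurlingPrimes where
  p := X.p
  one_lt j := one_lt_two.trans_le (X.two_le_p j)
  mono := monotone_nat_of_le_succ fun j => (X.p_mem j).2.trans (X.p_mem (j + 1)).1
  tendsto := tendsto_atTop_mono (fun j => (X.p_mem j).1) X.tendsto_q

theorem summable_rpow_neg {σ : ℝ} (hσ : 1 < σ) : Summable fun j => X.p j ^ (-σ) := by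
  have hM := X.M_pos
  have hsum : Summable fun j : ℕ => (M + 1) ^ σ * ((j : ℝ) + 2) ^ (-σ) := by
    simpa using ((summable_nat_add_iff 2).2
      (Real.summable_nat_rpow.2 (neg_lt_neg hσ))).mul_left ((M + 1) ^ σ)
  refine Summable.of_nonneg_of_le (fun j => Real.rpow_nonneg (X.p_pos j).le _) (fun j => ?_) hsum
  have hp : ((j : ℝ) + 2) / (M + 1) ≤ X.p j := by
    rw [div_le_iff₀ (by positivity), mul_comm]
    exact (X.natCast_add_two_le j).trans
      (mul_le_mul_of_nonneg_left (X.p_mem j).1 (by positivity))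
  refine (Real.rpow_le_rpow_of_nonpos (by positivity) hp (by linarith)).trans_eq ?_
  rw [Real.div_rpow (by positivity) (by positivity), Real.rpow_neg (by positivity : 0 ≤ M + 1),
    div_inv_eq_mul, mul_comm]

theorem exists_mem_Ioc {u : ℝ} (hu : a < u) : ∃ j, u ∈ Set.Ioc (X.q j) (X.q (j + 1)) := by
  have hex : ∃ n, u ≤ X.q n := (X.tendsto_q.eventually_ge_atTop u).exists
  obtain ⟨j, hj⟩ := Nat.exists_eq_succ_of_ne_zero (n := Nat.find hex) fun h0 =>
    (X.q_zero ▸ h0 ▸ Nat.find_spec hex : u ≤ a).not_gt hu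
  exact ⟨j, not_le.1 (Nat.find_min hex (hj ▸ Nat.lt_succ_self j)),
    by simpa only [hj, Nat.succ_eq_add_one] using Nat.find_spec hex⟩

theorem hasSum_integral {s : ℂ}
    (hint : IntegrableOn (fun u : ℝ => (f u : ℂ) * (u : ℂ) ^ (-s)) (Set.Ioi a)) :
    HasSum (fun j => ∫ u in X.q j..X.q (j + 1), (f u : ℂ) * (u : ℂ) ^ (-s))
      (∫ u in Set.Ioi a, (f u : ℂ) * (u : ℂ) ^ (-s)) := by
  have hU : ⋃ j, Set.Ioc (X.q j) (X.q (j + 1)) = Set.Ioi a := by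
    ext u
    simp only [Set.mem_iUnion, Set.mem_Ioi]
    refine ⟨fun ⟨j, hj⟩ => (X.le_q j).trans_lt hj.1, X.exists_mem_Ioc⟩
  have h := hasSum_integral_iUnion (μ := volume) (fun j => measurableSet_Ioc)
    (X.q_mono.pairwise_disjoint_on_Ioc_succ) (f := fun u : ℝ => (f u : ℂ) * (u : ℂ) ^ (-s))
    (by simpa only [Nat.succ_eq_succ, Nat.succ_eq_add_one, hU] using hint)
  simp only [Nat.succ_eq_succ, Nat.succ_eq_add_one, hU] at h
  simpa only [intervalIntegral.integral_of_le (X.q_le_succ _)] using h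

theorem tsum_p_cpow {s : ℂ} (hs : 1 < s.re)
    (hint : IntegrableOn (fun u : ℝ => (f u : ℂ) * (u : ℂ) ^ (-s)) (Set.Ioi a)) :
    ∑' j, (X.p j : ℂ) ^ (-s) =
      X.discrepancy s + ∫ u in Set.Ioi a, (f u : ℂ) * (u : ℂ) ^ (-s) := by
  have h := (X.summable_discrepancyTerm (zero_lt_one.trans hs)).hasSum.add (X.hasSum_integral hint)
  rw [show X.discrepancy s = ∑' j, X.discrepancyTerm s j from rfl, ← h.tsum_eq]
  exact tsum_congr fun j => by simp [discrepancyTerm]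

/-- The logarithm of the regular factor of the zeta function; the integral is the part of
`∫ u⁻ˢ f(u) du` that the sampling, which starts at `a`, does not see. -/
def logRegular (s : ℂ) : ℂ :=
  X.discrepancy s - (∫ u in (1 : ℝ)..a, (f u : ℂ) * (u : ℂ) ^ (-s)) +
    X.toBeurlingPrimes.logZetaPowers s

theorem differentiableAt_logRegular (hf : ContinuousOn f (Set.Icc 1 a)) {s : ℂ}
    (hs : 1 / 2 < s.re) : DifferentiableAt ℂ X.logRegular s := by
  have hint : IntegrableOn (fun u => (f u : ℂ)) (Set.Ioc 1 a) :=
    (Complex.continuous_ofReal.comp_continuousOn hf).integrableOn_Icc.mono_set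
      Set.Ioc_subset_Icc_self
  exact ((X.differentiableAt_discrepancy (by linarith)).sub
    (differentiable_integral_mul_cpow_neg one_pos X.one_le_a hint s)).add
    (X.toBeurlingPrimes.differentiableAt_logZetaPowers X.two_le_p
      (fun σ hσ => X.summable_rpow_neg hσ) hs)

theorem exists_norm_logRegular_le (hf : ContinuousOn f (Set.Icc 1 a)) {σ₀ : ℝ}
    (hσ₀ : 1 / 2 < σ₀) :
    ∃ K : ℝ, ∀ s : ℂ, σ₀ ≤ s.re → ‖X.logRegular s‖ ≤ K * √(Real.log (|s.im| + 4)) := by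
  obtain ⟨K₁, hdisc⟩ := X.exists_norm_discrepancy_le hσ₀
  obtain ⟨K₂, hpowers⟩ := X.toBeurlingPrimes.exists_norm_logZetaPowers_le X.two_le_p
    (fun σ hσ => X.summable_rpow_neg hσ) hσ₀
  set I := ∫ u in (1 : ℝ)..a, |f u|
  have hI : 0 ≤ I := intervalIntegral.integral_nonneg X.one_le_a fun _ _ => abs_nonneg _
  refine ⟨K₁ + I + |K₂|, fun s hs => ?_⟩
  have hlog := one_le_sqrt_log_abs_add_four s.im
  calc ‖X.logRegular s‖ ≤ ‖X.discrepancy s‖ + ‖∫ u in (1 : ℝ)..a, (f u : ℂ) * (u : ℂ) ^ (-s)‖ +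
        ‖X.toBeurlingPrimes.logZetaPowers s‖ :=
        (norm_add_le _ _).trans (add_le_add_left (norm_sub_le _ _) _)
    _ ≤ K₁ * √(Real.log (|s.im| + 4)) + I + |K₂| := by
        gcongr
        · exact hdisc s hs
        · exact norm_integral_mul_cpow_neg_le X.one_le_a hf (by linarith)
        · exact (hpowers s hs).trans (le_abs_self _)
    _ ≤ (K₁ + I + |K₂|) * √(Real.log (|s.im| + 4)) := by
        linarith [le_mul_of_one_le_right hI hlog, le_mul_of_one_le_right (abs_nonneg K₂) hlog]

theorem hasSum_norm_cpow {r : ℝ} (hr : r < 1) {S : Multiset ℂ} (hS : ∀ ρ ∈ S, ρ.re < 1)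
    (hsymm : S.map (starRingEnd ℂ) = S) (X : DensitySampling (zeroDensity r S) a M)
    {s : ℂ} (hs : 1 < s.re) :
    HasSum (fun g : X.toBeurlingPrimes.Integers => (X.toBeurlingPrimes.norm g : ℂ) ^ (-s))
      (twistedZeta r S X.logRegular s) := by
  obtain ⟨hint, hexp⟩ := zeroDensity_transform hr hS hsymm hs
  have hint' : IntegrableOn (fun u : ℝ => (zeroDensity r S u : ℂ) * (u : ℂ) ^ (-s)) (Set.Ioi a) :=
    hint.mono_set (Set.Ioi_subset_Ioi X.one_le_a)
  have hlog : ∑' j, (X.p j : ℂ) ^ (-s) + X.toBeurlingPrimes.logZetaPowers s =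
      (∫ u in Set.Ioi (1 : ℝ), (zeroDensity r S u : ℂ) * (u : ℂ) ^ (-s)) + X.logRegular s := by
    rw [X.tsum_p_cpow hs hint', logRegular,
      ← intervalIntegral.integral_interval_add_Ioi hint hint']
    ring
  rw [twistedZeta, ← hexp, ← Complex.exp_add, ← hlog]
  exact X.toBeurlingPrimes.hasSum_norm_cpow X.two_le_p (by linarith) (X.summable_rpow_neg hs)

end DensitySampling

/-! ### Counting primes -/

namespace BeurlingPrimes

variable (P : BeurlingPrimes)

open Classical in
/-- The prime counting function `π(x) = #{j : pⱼ ≤ x}`, encoded as the least index `n` with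
`x < pₙ`. -/
def primeCount (x : ℝ) : ℕ := Nat.find (P.tendsto.eventually_gt_atTop x).exists

/-- Chebyshev's function `θ(x) = ∑_{pⱼ ≤ x} log pⱼ`. -/
def theta (x : ℝ) : ℝ := ∑ j ∈ Finset.range (P.primeCount x), Real.log (P.p j)

theorem p_le_iff {x : ℝ} {j : ℕ} : P.p j ≤ x ↔ j < P.primeCount x := by
  classical
  refine ⟨fun hj => ?_, fun hj => not_lt.1 (Nat.find_min _ hj)⟩
  by_contra! h
  exact (Nat.find_spec (P.tendsto.eventually_gt_atTop x).exists).not_ge ((P.mono h).trans hj)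

theorem log_p_pos (j : ℕ) : 0 < Real.log (P.p j) := Real.log_pos (P.one_lt j)

theorem norm_single (j k : ℕ) : P.norm (Finsupp.single j k) = P.p j ^ k :=
  Finsupp.prod_single_index (pow_zero _)

theorem exists_eq_single_of_Lambda_ne_zero {g : P.Integers} (h : P.Lambda g ≠ 0) :
    ∃ j k : ℕ, 0 < k ∧ g = Finsupp.single j k := by
  by_contra hne
  exact h (dif_neg hne)

theorem pow_p_le_iff {x : ℝ} (hx : 0 < x) {j k : ℕ} (hk : k ≠ 0) :
    P.p j ^ k ≤ x ↔ k ≤ ⌊Real.log x / Real.log (P.p j)⌋₊ := by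
  rw [Nat.le_floor_iff' hk, le_div_iff₀ (P.log_p_pos j), Real.pow_le_iff_le_log (P.p_pos j) hx]

theorem psi_eq_sum_floor {x : ℝ} (hx : 0 < x) :
    P.psi x = ∑ j ∈ Finset.range (P.primeCount x),
      ⌊Real.log x / Real.log (P.p j)⌋₊ * Real.log (P.p j) := by
  classical
  set A : Finset (Σ _ : ℕ, ℕ) := (Finset.range (P.primeCount x)).sigma fun j =>
    Finset.Icc 1 ⌊Real.log x / Real.log (P.p j)⌋₊ with hA
  have hpos : ∀ i ∈ A, 0 < i.2 := fun i hi =>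
    (Finset.mem_Icc.1 (Finset.mem_sigma.1 hi).2).1
  have hinj : Set.InjOn (fun i : Σ _ : ℕ, ℕ => (Finsupp.single i.1 i.2 : P.Integers)) A := by
    rintro ⟨j, k⟩ hi ⟨j', k'⟩ - h
    obtain ⟨rfl, rfl⟩ := ((Finsupp.single_eq_single_iff _ _ _ _).1 h).resolve_right
      fun h => (hpos _ hi).ne' h.1
    rfl
  have hmem (j k : ℕ) (hk : 0 < k) : P.norm (Finsupp.single j k) ≤ x ↔ ⟨j, k⟩ ∈ A := by
    rw [hA, Finset.mem_sigma, Finset.mem_range, ← P.p_le_iff, Finset.mem_Icc, norm_single,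
      ← P.pow_p_le_iff hx hk.ne']
    exact ⟨fun h => ⟨(le_self_pow₀ (P.one_lt j).le hk.ne').trans h, hk, h⟩, fun h => h.2.2⟩
  have hset : {g : P.Integers | P.norm g ≤ x} ∩ Function.support P.Lambda =
      ↑(A.image fun i => (Finsupp.single i.1 i.2 : P.Integers)) ∩ Function.support P.Lambda := by
    ext g
    simp only [Set.mem_inter_iff, Function.mem_support, and_congr_left_iff, Set.mem_ofPred_eq,
      Finset.mem_coe, Finset.mem_image]
    intro hg
    obtain ⟨j, k, hk, rfl⟩ := P.exists_eq_single_of_Lambda_ne_zero hg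
    refine (hmem j k hk).trans ⟨fun h => ⟨_, h, rfl⟩, ?_⟩
    rintro ⟨⟨j', k'⟩, hi, h⟩
    rw [← hmem j k hk, ← h]
    exact (hmem j' k' (hpos _ hi)).2 hi
  rw [psi, finsum_mem_eq_sum_of_inter_support_eq _ hset, Finset.sum_image hinj, hA,
    Finset.sum_sigma]
  refine Finset.sum_congr rfl fun j _ => ?_
  rw [Finset.sum_congr rfl fun k hk => P.Lambda_single j k (Finset.mem_Icc.1 hk).1,
    Finset.sum_const, Nat.card_Icc, Nat.add_sub_cancel, nsmul_eq_mul]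

theorem theta_le_psi {x : ℝ} (hx : 0 < x) : P.theta x ≤ P.psi x := by
  rw [P.psi_eq_sum_floor hx]
  refine Finset.sum_le_sum fun j hj => le_mul_of_one_le_left (P.log_p_pos j).le ?_
  rw [Nat.one_le_cast, ← P.pow_p_le_iff hx one_ne_zero, pow_one, P.p_le_iff]
  exact Finset.mem_range.1 hj

theorem floor_mul_log_p_le {x : ℝ} (hx : 1 ≤ x) (j : ℕ) :
    ⌊Real.log x / Real.log (P.p j)⌋₊ * Real.log (P.p j) ≤ Real.log (P.p j) +
      (if j ∈ Finset.range (P.primeCount √x) then Real.log (P.p j) else 0) +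
      if j ∈ Finset.range (P.primeCount (x ^ (1 / 3 : ℝ))) then Real.log x else 0 := by
  have hx0 : 0 < x := one_pos.trans_le hx
  have hlog := P.log_p_pos j
  have floor_le {k : ℕ} (h : x < P.p j ^ (k + 1)) :
      (⌊Real.log x / Real.log (P.p j)⌋₊ : ℝ) ≤ k := by
    rw [Nat.cast_le, ← Nat.lt_succ_iff, ← not_le, ← P.pow_p_le_iff hx0 k.succ_ne_zero]
    exact h.not_ge
  simp only [Finset.mem_range, ← P.p_le_iff]
  by_cases hcube : P.p j ≤ x ^ (1 / 3 : ℝ)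
  · have hfloor := (le_div_iff₀ hlog).1
      (Nat.floor_le (div_nonneg (Real.log_nonneg hx) hlog.le))
    rw [if_pos hcube]
    split_ifs <;> linarith
  rw [if_neg hcube, add_zero]
  by_cases hsq : P.p j ≤ √x
  · have h := floor_le (k := 2) <| by
      have := Real.rpow_lt_rpow (by positivity) (not_le.1 hcube) (by norm_num : (0 : ℝ) < 3)
      rw [← Real.rpow_mul hx0.le] at this
      norm_num at this ⊢
      exact_mod_cast this
    rw [if_pos hsq, ← two_mul]
    exact mul_le_mul_of_nonneg_right (mod_cast h) hlog.le
  · have h := floor_le (k := 1) ((Real.sqrt_lt' (P.p_pos j)).1 (not_le.1 hsq))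
    rw [if_neg hsq, add_zero]
    exact mul_le_of_le_one_left hlog.le (mod_cast h)

theorem psi_le {x : ℝ} (hx : 1 ≤ x) :
    P.psi x ≤ P.theta x + P.theta √x + P.primeCount (x ^ (1 / 3 : ℝ)) * Real.log x := by
  have hrestrict {n m : ℕ} {c : ℕ → ℝ} (hc : ∀ j, 0 ≤ c j) :
      ∑ j ∈ Finset.range n, (if j ∈ Finset.range m then c j else 0) ≤
        ∑ j ∈ Finset.range m, c j := by
    rw [Finset.sum_ite_mem]
    exact Finset.sum_le_sum_of_subset_of_nonneg Finset.inter_subset_right fun j _ _ => hc j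
  rw [P.psi_eq_sum_floor (one_pos.trans_le hx)]
  refine (Finset.sum_le_sum fun j _ => P.floor_mul_log_p_le hx j).trans ?_
  rw [Finset.sum_add_distrib, Finset.sum_add_distrib]
  refine add_le_add (add_le_add_right (hrestrict fun j => (P.log_p_pos j).le) _)
    ((hrestrict fun _ => Real.log_nonneg hx).trans_eq ?_)
  rw [Finset.sum_const, Finset.card_range, nsmul_eq_mul]

end BeurlingPrimes

theorem norm_powerSum_le {T : Multiset ℂ} (hT : ∀ ρ ∈ T, ρ.re ≤ 1) {u : ℝ} (hu : 1 ≤ u) :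
    ‖powerSum T u‖ ≤ Multiset.card T := by
  refine (norm_multiset_sum_le _).trans ((Multiset.sum_le_card_nsmul _ 1 fun y hy => ?_).trans_eq
    (by simp))
  obtain ⟨_, hz, rfl⟩ := Multiset.mem_map.1 hy
  obtain ⟨ρ, hρ, rfl⟩ := Multiset.mem_map.1 hz
  rw [Complex.norm_cpow_eq_rpow_re_of_pos (one_pos.trans_le hu)]
  exact Real.rpow_le_one_of_one_le_of_nonpos hu (by simpa using hT ρ hρ)

theorem norm_zeroWeight_le {r : ℝ} (hr : r ≤ 1) {S : Multiset ℂ} (hS : ∀ ρ ∈ S, ρ.re ≤ 1)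
    {u : ℝ} (hu : 1 ≤ u) : ‖zeroWeight r S u‖ ≤ 2 + Multiset.card S := by
  have h := norm_powerSum_le (T := {1, (r : ℂ)}) (by simpa using hr) hu
  exact (norm_sub_le _ _).trans (add_le_add (by simpa using h) (norm_powerSum_le hS hu))

/-- The sum `∑ x^ρ / ρ` over a multiset, a primitive of `powerSum`. -/
def powerSumPrimitive (T : Multiset ℂ) (x : ℝ) : ℂ := (T.map fun ρ => (x : ℂ) ^ ρ / ρ).sum

theorem powerSumPrimitive_cons (ρ : ℂ) (T : Multiset ℂ) :
    powerSumPrimitive (ρ ::ₘ T) = (fun x : ℝ => (x : ℂ) ^ ρ / ρ) + powerSumPrimitive T := by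
  ext x
  simp [powerSumPrimitive]

theorem hasDerivAt_powerSumPrimitive {T : Multiset ℂ} (hT : ∀ ρ ∈ T, ρ ≠ 0) {x : ℝ}
    (hx : x ≠ 0) : HasDerivAt (powerSumPrimitive T) (powerSum T x) x := by
  induction T using Multiset.induction with
  | empty => exact (hasDerivAt_const x (0 : ℂ)).congr_deriv (by simp [powerSum])
  | cons ρ T ih =>
    have hρ : HasDerivAt (fun u : ℝ => (u : ℂ) ^ ρ / ρ) ((x : ℂ) ^ (ρ - 1)) x := by
      have hne : ρ - 1 ≠ -1 := fun h => hT ρ (Multiset.mem_cons_self _ _) (by linear_combination h)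
      simpa only [sub_add_cancel] using hasDerivAt_ofReal_cpow_const' hx hne
    rw [powerSumPrimitive_cons, powerSum_cons]
    exact hρ.add (ih fun ρ' h => hT ρ' (Multiset.mem_cons_of_mem h))

theorem norm_powerSumPrimitive_le {T : Multiset ℂ} (hT : ∀ ρ ∈ T, ρ.re ≤ 1) {x : ℝ} (hx : 1 ≤ x) :
    ‖powerSumPrimitive T x‖ ≤ (T.map fun ρ => 1 / ‖ρ‖).sum * x := by
  rw [← Multiset.sum_map_mul_right]
  refine (norm_multiset_sum_le _).trans ?_
  rw [Multiset.map_map]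
  refine Multiset.sum_map_le_sum_map _ _ fun ρ hρ => ?_
  rw [Function.comp_apply, norm_div, one_div_mul_eq_div,
    Complex.norm_cpow_eq_rpow_re_of_pos (one_pos.trans_le hx)]
  exact div_le_div_of_nonneg_right
    ((Real.rpow_le_rpow_of_exponent_le hx (hT ρ hρ)).trans_eq (Real.rpow_one x)) (norm_nonneg _)

/-- The main term `x + x^r / r - ∑ x^ρ / ρ` of `ψ(x)`. -/
def psiMain (r : ℝ) (S : Multiset ℂ) (x : ℝ) : ℂ :=
  powerSumPrimitive {1, (r : ℂ)} x - powerSumPrimitive S x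

theorem psiMain_eq (r : ℝ) (S : Multiset ℂ) (x : ℝ) :
    psiMain r S x = x + (x : ℂ) ^ (r : ℂ) / r - (S.map fun ρ => (x : ℂ) ^ ρ / ρ).sum := by
  simp [psiMain, powerSumPrimitive]

theorem hasDerivAt_psiMain {r : ℝ} (hr : r ≠ 0) {S : Multiset ℂ} (hS : ∀ ρ ∈ S, ρ ≠ 0)
    {x : ℝ} (hx : x ≠ 0) : HasDerivAt (psiMain r S) (zeroWeight r S x) x :=
  (hasDerivAt_powerSumPrimitive (by simpa using hr) hx).sub (hasDerivAt_powerSumPrimitive hS hx)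

theorem exists_norm_psiMain_le {r : ℝ} (hr : r ≤ 1) {S : Multiset ℂ} (hS : ∀ ρ ∈ S, ρ.re ≤ 1) :
    ∃ C : ℝ, 0 ≤ C ∧ ∀ x : ℝ, 1 ≤ x → ‖psiMain r S x‖ ≤ C * x := by
  have hnonneg (T : Multiset ℂ) : 0 ≤ (T.map fun ρ => 1 / ‖ρ‖).sum :=
    Multiset.sum_nonneg fun y hy => by
      obtain ⟨ρ, -, rfl⟩ := Multiset.mem_map.1 hy
      positivity
  refine ⟨_, add_nonneg (hnonneg {1, (r : ℂ)}) (hnonneg S), fun x hx => ?_⟩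
  rw [add_mul]
  exact (norm_sub_le _ _).trans (add_le_add (norm_powerSumPrimitive_le (by simpa using hr) hx)
    (norm_powerSumPrimitive_le hS hx))

section Integral

variable {r : ℝ} {S : Multiset ℂ} {b x : ℝ}

theorem zeroDensity_mul_log (hsymm : S.map (starRingEnd ℂ) = S) (hx : 0 < x) :
    ((zeroDensity r S x * Real.log x : ℝ) : ℂ) =
      zeroWeight r S x - (x : ℂ)⁻¹ * zeroWeight r S x := by
  rw [zeroDensity, mul_right_comm, logKernel_mul_log hx, Complex.ofReal_mul,
    ofReal_re_zeroWeight r hsymm hx]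
  push_cast
  ring

theorem norm_integral_inv_mul_zeroWeight_le (hr : r ≤ 1) (hS : ∀ ρ ∈ S, ρ.re ≤ 1) (hb : 1 ≤ b)
    (hbx : b ≤ x) :
    ‖∫ u in b..x, (u : ℂ)⁻¹ * zeroWeight r S u‖ ≤ (2 + Multiset.card S) * Real.log x := by
  have hb0 : 0 < b := one_pos.trans_le hb
  have h0 : (0 : ℝ) ∉ Set.uIcc b x := fun h => hb0.not_ge ((Set.uIcc_of_le hbx ▸ h).1)
  calc ‖∫ u in b..x, (u : ℂ)⁻¹ * zeroWeight r S u‖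
      ≤ ∫ u in b..x, (2 + Multiset.card S : ℝ) * u⁻¹ := by
        refine intervalIntegral.norm_integral_le_of_norm_le hbx (ae_of_all _ fun u hu => ?_)
          ((intervalIntegral.intervalIntegrable_inv (fun u hu h => h0 (h ▸ hu))
            continuousOn_id).const_mul _)
        have hu0 : 0 < u := hb0.trans hu.1
        rw [norm_mul, norm_inv, Complex.norm_real, Real.norm_of_nonneg hu0.le, mul_comm]
        exact mul_le_mul_of_nonneg_right (norm_zeroWeight_le hr hS (hb.trans hu.1.le))
          (inv_nonneg.2 hu0.le)
    _ = (2 + Multiset.card S) * (Real.log x - Real.log b) := by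
        rw [intervalIntegral.integral_const_mul, integral_inv h0,
          Real.log_div (hb0.trans_le hbx).ne' hb0.ne']
    _ ≤ _ := by
        gcongr
        exact sub_le_self _ (Real.log_nonneg hb)

theorem integral_zeroDensity_mul_log (hr : r ≠ 0) (hS : ∀ ρ ∈ S, ρ ≠ 0)
    (hsymm : S.map (starRingEnd ℂ) = S) (hb : 0 < b) (hbx : b ≤ x) :
    ((∫ u in b..x, zeroDensity r S u * Real.log u : ℝ) : ℂ) =
      psiMain r S x - psiMain r S b - ∫ u in b..x, (u : ℂ)⁻¹ * zeroWeight r S u := by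
  have hpos : Set.uIcc b x ⊆ Set.Ioi 0 := fun u hu => hb.trans_le (Set.uIcc_of_le hbx ▸ hu).1
  have hcont : ContinuousOn (zeroWeight r S) (Set.uIcc b x) :=
    (continuousOn_zeroWeight r S).mono hpos
  have hinv : ContinuousOn (fun u : ℝ => (u : ℂ)⁻¹) (Set.uIcc b x) :=
    Complex.continuous_ofReal.continuousOn.inv₀ fun u hu => by exact_mod_cast (hpos hu).ne'
  rw [← intervalIntegral.integral_eq_sub_of_hasDerivAt
      (fun u hu => hasDerivAt_psiMain hr hS (hpos hu).ne') hcont.intervalIntegrable,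
    ← intervalIntegral.integral_ofReal,
    intervalIntegral.integral_congr fun u hu => zeroDensity_mul_log hsymm (hpos hu)]
  exact intervalIntegral.integral_sub hcont.intervalIntegrable
    (hinv.mul hcont).intervalIntegrable

end Integral

theorem log_le_two_mul_sqrt {x : ℝ} (hx : 0 ≤ x) : Real.log x ≤ 2 * √x := by
  have h := Real.log_le_rpow_div hx (show (0 : ℝ) < 1 / 2 by norm_num)
  rw [← Real.sqrt_eq_rpow] at h
  linarith

theorem cbrt_mul_log_le {x : ℝ} (hx : 0 < x) : x ^ (1 / 3 : ℝ) * Real.log x ≤ 6 * √x := by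
  calc x ^ (1 / 3 : ℝ) * Real.log x ≤ x ^ (1 / 3 : ℝ) * (x ^ (1 / 6 : ℝ) / (1 / 6)) := by
        gcongr
        exact Real.log_le_rpow_div hx.le (by norm_num)
    _ = 6 * (x ^ (1 / 3 : ℝ) * x ^ (1 / 6 : ℝ)) := by ring
    _ = 6 * √x := by
        rw [← Real.rpow_add hx, Real.sqrt_eq_rpow]
        norm_num

namespace DensitySampling

variable {f : ℝ → ℝ} {a M : ℝ} (X : DensitySampling f a M)

theorem log_nonneg_of_le (X : DensitySampling f a M) {u : ℝ} (hu : a ≤ u) : 0 ≤ Real.log u :=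
  Real.log_nonneg (X.one_le_a.trans hu)

theorem intervalIntegrable_of_le (X : DensitySampling f a M) {x y : ℝ} (hx : a ≤ x) (hy : a ≤ y) :
    IntervalIntegrable f volume x y :=
  (X.continuousOn.mono fun _ hz => (le_min hx hy).trans hz.1).intervalIntegrable

theorem intervalIntegrable_mul_log (X : DensitySampling f a M) {x y : ℝ} (hx : a ≤ x) (hy : a ≤ y) :
    IntervalIntegrable (fun u => f u * Real.log u) volume x y := by
  have hle : ∀ u ∈ Set.uIcc x y, a ≤ u := fun u hu => (le_min hx hy).trans hu.1
  refine ((X.continuousOn.mono hle).mul (Real.continuousOn_log.mono fun u hu => ?_))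
    |>.intervalIntegrable
  exact (one_pos.trans_le (X.one_le_a.trans (hle u hu))).ne'

theorem integral_mul_log_mem_Icc (X : DensitySampling f a M) {x y : ℝ} (hx : a ≤ x) (hxy : x ≤ y) :
    ∫ u in x..y, f u * Real.log u ∈
      Set.Icc ((∫ u in x..y, f u) * Real.log x) ((∫ u in x..y, f u) * Real.log y) := by
  have hpos : 0 < x := one_pos.trans_le (X.one_le_a.trans hx)
  have hi := X.intervalIntegrable_of_le hx (hx.trans hxy)
  have hil := X.intervalIntegrable_mul_log hx (hx.trans hxy)
  rw [← intervalIntegral.integral_mul_const, ← intervalIntegral.integral_mul_const]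
  exact ⟨intervalIntegral.integral_mono_on hxy (hi.mul_const _) hil fun u hu =>
      mul_le_mul_of_nonneg_left (Real.log_le_log hpos hu.1) (X.pos u (hx.trans hu.1)).le,
    intervalIntegral.integral_mono_on hxy hil (hi.mul_const _) fun u hu =>
      mul_le_mul_of_nonneg_left (Real.log_le_log (hpos.trans_le hu.1) hu.2)
        (X.pos u (hx.trans hu.1)).le⟩

theorem abs_log_sub_integral_le (j : ℕ) :
    |Real.log (X.p j) - ∫ u in X.q j..X.q (j + 1), f u * Real.log u| ≤
      Real.log (X.q (j + 1)) - Real.log (X.q j) := by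
  have h := X.integral_mul_log_mem_Icc (X.le_q j) (X.q_le_succ j)
  rw [X.integral_q, one_mul, one_mul] at h
  exact Real.dist_le_of_mem_Icc ⟨Real.log_le_log (X.q_pos j) (X.p_mem j).1,
    Real.log_le_log (X.p_pos j) (X.p_mem j).2⟩ h

theorem abs_sum_log_sub_integral_le (J : ℕ) :
    |∑ j ∈ Finset.range J, Real.log (X.p j) - ∫ u in a..X.q J, f u * Real.log u| ≤
      Real.log (X.q J) := by
  have hsum : ∑ j ∈ Finset.range J, ∫ u in X.q j..X.q (j + 1), f u * Real.log u =
      ∫ u in X.q 0..X.q J, f u * Real.log u :=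
    intervalIntegral.sum_integral_adjacent_intervals fun j _ =>
      X.intervalIntegrable_mul_log (X.le_q j) (X.le_q (j + 1))
  rw [X.q_zero] at hsum
  rw [← hsum, ← Finset.sum_sub_distrib]
  calc _ ≤ ∑ j ∈ Finset.range J, (Real.log (X.q (j + 1)) - Real.log (X.q j)) :=
        (Finset.abs_sum_le_sum_abs _ _).trans
          (Finset.sum_le_sum fun j _ => X.abs_log_sub_integral_le j)
    _ = Real.log (X.q J) - Real.log (X.q 0) :=
        Finset.sum_range_sub (fun j => Real.log (X.q j)) J
    _ ≤ Real.log (X.q J) := sub_le_self _ (Real.log_nonneg (X.one_le_q 0))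

theorem integral_le_two {i : ℕ} {x : ℝ} (h₁ : X.q i ≤ x) (h₂ : x ≤ X.q (i + 2)) :
    ∫ u in X.q i..x, f u ≤ 2 := by
  calc ∫ u in X.q i..x, f u ≤ ∫ u in X.q i..X.q (i + 2), f u :=
        intervalIntegral.integral_mono_interval le_rfl h₁ h₂
          ((ae_restrict_mem measurableSet_Ioc).mono fun u hu =>
            (X.pos u ((X.le_q i).trans hu.1.le)).le)
          (X.intervalIntegrable_of_le (X.le_q i) (X.le_q _))
    _ = 2 := by
        rw [← intervalIntegral.integral_add_adjacent_intervals (X.intervalIntegrable i)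
          (X.intervalIntegrable (i + 1)), X.integral_q, X.integral_q]
        norm_num

theorem integral_mul_log_mem_Icc_of_le {i : ℕ} {x : ℝ} (h₁ : X.q i ≤ x) (h₂ : x ≤ X.q (i + 2)) :
    ∫ u in X.q i..x, f u * Real.log u ∈ Set.Icc 0 (2 * Real.log x) := by
  refine ⟨intervalIntegral.integral_nonneg h₁ fun u hu => ?_,
    (X.integral_mul_log_mem_Icc (X.le_q i) h₁).2.trans
      (mul_le_mul_of_nonneg_right (X.integral_le_two h₁ h₂)
        (X.log_nonneg_of_le ((X.le_q i).trans h₁)))⟩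
  have hu' := (X.le_q i).trans hu.1
  exact mul_nonneg (X.pos u hu').le (X.log_nonneg_of_le hu')

theorem toBeurlingPrimes_p_le_iff {x : ℝ} {j : ℕ} :
    X.p j ≤ x ↔ j < X.toBeurlingPrimes.primeCount x :=
  X.toBeurlingPrimes.p_le_iff

theorem primeCount_le {x : ℝ} (hx : 0 ≤ x) :
    (X.toBeurlingPrimes.primeCount x : ℝ) ≤ (M + 1) * x := by
  have hM := X.M_pos
  rcases h : X.toBeurlingPrimes.primeCount x with _ | k
  · simpa only [Nat.cast_zero] using (by positivity : 0 ≤ (M + 1) * x)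
  · have hqk : X.q k ≤ x := (X.p_mem k).1.trans (X.toBeurlingPrimes_p_le_iff.2 (by omega))
    push_cast
    linarith [X.natCast_add_two_le k, mul_le_mul_of_nonneg_left hqk (by linarith : 0 ≤ M + 1)]

theorem theta_eq_zero_of_lt {x : ℝ} (hx : x < a) : X.toBeurlingPrimes.theta x = 0 := by
  have h : X.toBeurlingPrimes.primeCount x = 0 := by
    by_contra h
    have := X.toBeurlingPrimes_p_le_iff.2 (Nat.pos_of_ne_zero h)
    linarith [(X.p_mem 0).1, X.le_q 0]
  rw [BeurlingPrimes.theta, h, Finset.range_zero, Finset.sum_empty]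

theorem abs_theta_sub_integral_le {x : ℝ} (hx : a ≤ x) :
    |X.toBeurlingPrimes.theta x - ∫ u in a..x, f u * Real.log u| ≤ 3 * Real.log x := by
  have hlog := X.log_nonneg_of_le hx
  change |∑ j ∈ Finset.range (X.toBeurlingPrimes.primeCount x), Real.log (X.p j) - _| ≤ _
  rcases hn : X.toBeurlingPrimes.primeCount x with _ | k
  · have hx0 : x < X.p 0 := not_le.1 fun h => by simpa [hn] using X.toBeurlingPrimes_p_le_iff.1 h
    have hmem := X.integral_mul_log_mem_Icc_of_le (i := 0) (X.q_zero.trans_le hx)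
      ((hx0.le.trans (X.p_mem 0).2).trans (X.q_le_succ 1))
    rw [X.q_zero] at hmem
    rw [Finset.range_zero, Finset.sum_empty, zero_sub, abs_neg, abs_of_nonneg hmem.1]
    linarith [hmem.2]
  · have hpk : X.p k ≤ x := X.toBeurlingPrimes_p_le_iff.2 (by omega)
    have hxk : x < X.p (k + 1) := not_le.1 fun h => by
      have := X.toBeurlingPrimes_p_le_iff.1 h
      omega
    have hqk : X.q k ≤ x := (X.p_mem k).1.trans hpk
    have hmem := X.integral_mul_log_mem_Icc_of_le hqk (hxk.le.trans (X.p_mem (k + 1)).2)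
    have hsum := abs_le.1 (X.abs_sum_log_sub_integral_le k)
    have hqlog := Real.log_le_log (X.q_pos k) hqk
    have hplog := Real.log_le_log (X.p_pos k) hpk
    have hp0 : 0 < Real.log (X.p k) := X.toBeurlingPrimes.log_p_pos k
    rw [← intervalIntegral.integral_add_adjacent_intervals
      (X.intervalIntegrable_mul_log le_rfl (X.le_q k))
      (X.intervalIntegrable_mul_log (X.le_q k) hx), Finset.sum_range_succ, abs_le]
    constructor <;> linarith [hmem.1, hmem.2]

section ZeroDensity

variable {r : ℝ} {S : Multiset ℂ} (X : DensitySampling (zeroDensity r S) a M)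

theorem norm_theta_sub_psiMain_le (hr0 : r ≠ 0) (hr : r ≤ 1) (hS0 : ∀ ρ ∈ S, ρ ≠ 0)
    (hS : ∀ ρ ∈ S, ρ.re ≤ 1) (hsymm : S.map (starRingEnd ℂ) = S) {x : ℝ} (hx : a ≤ x) :
    ‖(X.toBeurlingPrimes.theta x : ℂ) - psiMain r S x‖ ≤
      ‖psiMain r S a‖ + (5 + Multiset.card S) * Real.log x := by
  have ha := X.one_le_a
  have hθ := X.abs_theta_sub_integral_le hx
  rw [← Real.norm_eq_abs, ← Complex.norm_real, Complex.ofReal_sub,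
    integral_zeroDensity_mul_log hr0 hS0 hsymm (one_pos.trans_le ha) hx] at hθ
  have hinv := norm_integral_inv_mul_zeroWeight_le hr hS ha hx
  set I := ∫ u in a..x, (u : ℂ)⁻¹ * zeroWeight r S u
  set θ : ℂ := (X.toBeurlingPrimes.theta x : ℂ)
  calc ‖θ - psiMain r S x‖
      = ‖θ - (psiMain r S x - psiMain r S a - I) - psiMain r S a - I‖ := by congr 1; ring
    _ ≤ 3 * Real.log x + ‖psiMain r S a‖ + (2 + Multiset.card S) * Real.log x :=
        (norm_sub_le _ _).trans (add_le_add ((norm_sub_le _ _).trans (by gcongr)) hinv)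
    _ = _ := by ring

theorem exists_norm_theta_sub_psiMain_le (hr0 : r ≠ 0) (hr : r ≤ 1) (hS0 : ∀ ρ ∈ S, ρ ≠ 0)
    (hS : ∀ ρ ∈ S, ρ.re ≤ 1) (hsymm : S.map (starRingEnd ℂ) = S) :
    ∃ C : ℝ, 0 ≤ C ∧ ∀ x : ℝ, 1 ≤ x →
      ‖(X.toBeurlingPrimes.theta x : ℂ) - psiMain r S x‖ ≤ C * √x := by
  obtain ⟨C, hC, hmain⟩ := exists_norm_psiMain_le hr hS
  refine ⟨C * √a + (‖psiMain r S a‖ + (5 + Multiset.card S) * 2), by positivity, fun x hx => ?_⟩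
  rw [add_mul]
  rcases lt_or_ge x a with hxa | hxa
  · rw [X.theta_eq_zero_of_lt hxa, Complex.ofReal_zero, zero_sub, norm_neg]
    calc ‖psiMain r S x‖ ≤ C * (√x * √x) := by
          rw [Real.mul_self_sqrt (zero_le_one.trans hx)]
          exact hmain x hx
      _ ≤ C * √a * √x := by
          rw [← mul_assoc]
          gcongr
      _ ≤ _ := le_add_of_nonneg_right (by positivity)
  · calc _ ≤ ‖psiMain r S a‖ + (5 + Multiset.card S) * Real.log x :=
          X.norm_theta_sub_psiMain_le hr0 hr hS0 hS hsymm hxa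
      _ ≤ ‖psiMain r S a‖ * √x + (5 + Multiset.card S) * (2 * √x) := by
          gcongr
          · exact le_mul_of_one_le_right (norm_nonneg _) (Real.one_le_sqrt.2 hx)
          · exact log_le_two_mul_sqrt (zero_le_one.trans hx)
      _ = (‖psiMain r S a‖ + (5 + Multiset.card S) * 2) * √x := by ring
      _ ≤ _ := le_add_of_nonneg_left (by positivity)

theorem exists_psi_sub_theta_le (hr0 : r ≠ 0) (hr : r ≤ 1) (hS0 : ∀ ρ ∈ S, ρ ≠ 0)
    (hS : ∀ ρ ∈ S, ρ.re ≤ 1) (hsymm : S.map (starRingEnd ℂ) = S) :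
    ∃ C : ℝ, ∀ x : ℝ, 1 ≤ x → X.toBeurlingPrimes.psi x - X.toBeurlingPrimes.theta x ≤ C * √x := by
  obtain ⟨C₁, -, hmain⟩ := exists_norm_psiMain_le hr hS
  obtain ⟨C₂, hC₂, hθ⟩ := X.exists_norm_theta_sub_psiMain_le hr0 hr hS0 hS hsymm
  refine ⟨C₂ + C₁ + (M + 1) * 6, fun x hx => ?_⟩
  have hx0 : 0 < x := one_pos.trans_le hx
  have hsqrt : 1 ≤ √x := Real.one_le_sqrt.2 hx
  have hθ' : X.toBeurlingPrimes.theta √x ≤ (C₂ + C₁) * √x :=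
    calc X.toBeurlingPrimes.theta √x ≤ ‖(X.toBeurlingPrimes.theta √x : ℂ)‖ := by
          rw [Complex.norm_real]
          exact Real.le_norm_self _
      _ ≤ C₂ * √√x + C₁ * √x :=
          (norm_le_norm_sub_add _ (psiMain r S √x)).trans (add_le_add (hθ _ hsqrt) (hmain _ hsqrt))
      _ ≤ C₂ * √x + C₁ * √x := by
          gcongr
          exact Real.sqrt_le_self_iff.2 (Or.inr hx)
      _ = _ := (add_mul ..).symm
  have hcube : X.toBeurlingPrimes.primeCount (x ^ (1 / 3 : ℝ)) * Real.log x ≤ (M + 1) * 6 * √x := by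
    have hM := X.M_pos
    calc _ ≤ (M + 1) * x ^ (1 / 3 : ℝ) * Real.log x :=
          mul_le_mul_of_nonneg_right (X.primeCount_le (by positivity)) (Real.log_nonneg hx)
      _ ≤ (M + 1) * (6 * √x) := by
          rw [mul_assoc]
          exact mul_le_mul_of_nonneg_left (cbrt_mul_log_le hx0) (by positivity)
      _ = _ := (mul_assoc ..).symm
  linarith [X.toBeurlingPrimes.psi_le hx]

theorem exists_norm_psi_sub_psiMain_le (hr0 : r ≠ 0) (hr : r ≤ 1) (hS0 : ∀ ρ ∈ S, ρ ≠ 0)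
    (hS : ∀ ρ ∈ S, ρ.re ≤ 1) (hsymm : S.map (starRingEnd ℂ) = S) :
    ∃ C : ℝ, ∀ x : ℝ, 1 ≤ x →
      ‖(X.toBeurlingPrimes.psi x : ℂ) - psiMain r S x‖ ≤ C * √x := by
  obtain ⟨C₁, hψ⟩ := X.exists_psi_sub_theta_le hr0 hr hS0 hS hsymm
  obtain ⟨C₂, -, hθ⟩ := X.exists_norm_theta_sub_psiMain_le hr0 hr hS0 hS hsymm
  refine ⟨C₁ + C₂, fun x hx => ?_⟩
  rw [add_mul]
  refine (norm_sub_le_norm_sub_add_norm_sub _ _ _).trans (add_le_add ?_ (hθ x hx))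
  rw [← Complex.ofReal_sub, Complex.norm_real, Real.norm_of_nonneg
    (sub_nonneg.2 (X.toBeurlingPrimes.theta_le_psi (one_pos.trans_le hx)))]
  exact hψ x hx

end ZeroDensity

end DensitySampling

/-! ### The integrated counting function -/

theorem hasMellin_indicator_Ioi_cpow {c : ℝ} (hc : 0 < c) {b s : ℂ} (hs : s.re + b.re < 0) :
    HasMellin ((Set.Ioi c).indicator fun t : ℝ => (t : ℂ) ^ b) s
      (-(c : ℂ) ^ (s + b) / (s + b)) := by
  have hsub : Set.Ioi c ⊆ Set.Ioi 0 := Set.Ioi_subset_Ioi hc.le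
  have heq : ∀ t : ℝ, (t : ℂ) ^ (s - 1) • (Set.Ioi c).indicator (fun t : ℝ => (t : ℂ) ^ b) t =
      (Set.Ioi c).indicator (fun t : ℝ => (t : ℂ) ^ (s + b - 1)) t := fun t => by
    by_cases ht : t ∈ Set.Ioi c
    · rw [Set.indicator_of_mem ht, Set.indicator_of_mem ht, smul_eq_mul,
        ← Complex.cpow_add _ _ (by exact_mod_cast (hsub ht).ne')]
      congr 1
      ring
    · rw [Set.indicator_of_notMem ht, Set.indicator_of_notMem ht, smul_zero]
  have hre : (s + b - 1).re < -1 := by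
    simp only [Complex.sub_re, Complex.add_re, Complex.one_re]
    linarith
  constructor
  · unfold MellinConvergent
    simp_rw [heq]
    rw [IntegrableOn, integrable_indicator_iff measurableSet_Ioi]
    exact (integrableOn_Ioi_cpow_of_lt hre hc).mono_measure Measure.restrict_le_self
  · unfold mellin
    simp_rw [heq]
    rw [setIntegral_indicator measurableSet_Ioi, Set.inter_eq_self_of_subset_right hsub,
      integral_Ioi_cpow_of_lt hre hc, sub_add_cancel]

theorem ofReal_max_sub_zero (c t : ℝ) : ((max (t - c) 0 : ℝ) : ℂ) =
    (Set.Ioi c).indicator (fun t : ℝ => (t : ℂ) ^ (1 : ℂ)) t -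
      (c : ℂ) • (Set.Ioi c).indicator (fun t : ℝ => (t : ℂ) ^ (0 : ℂ)) t := by
  by_cases ht : t ∈ Set.Ioi c
  · have : c < t := ht
    rw [Set.indicator_of_mem ht, Set.indicator_of_mem ht, max_eq_left (by linarith)]
    simp
  · have : t ≤ c := not_lt.1 ht
    rw [Set.indicator_of_notMem ht, Set.indicator_of_notMem ht, max_eq_right (by linarith)]
    simp

theorem hasMellin_max_sub_zero {c : ℝ} (hc : 0 < c) {w : ℂ} (hw : 0 < w.re) :
    HasMellin (fun t : ℝ => ((max (t - c) 0 : ℝ) : ℂ)) (-(w + 1))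
      ((c : ℂ) ^ (-w) / (w * (w + 1))) := by
  have hlin := hasMellin_indicator_Ioi_cpow hc (b := 1) (s := -(w + 1)) (by simpa using hw)
  have hcutoff := hasMellin_indicator_Ioi_cpow hc (b := 0) (s := -(w + 1))
    (by simpa only [Complex.neg_re, Complex.add_re, Complex.one_re, Complex.zero_re, add_zero,
      Left.neg_neg_iff] using add_pos hw one_pos)
  have hconst := hasMellin_const_smul hcutoff.1 (c : ℂ)
  have hsub := hasMellin_sub hlin.1 hconst.1
  have hw0 : w ≠ 0 := fun h => by simp [h] at hw
  have hw1 : w + 1 ≠ 0 := fun h => by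
    have hre := congrArg Complex.re h
    rw [Complex.add_re, Complex.one_re, Complex.zero_re] at hre
    linarith
  have hc0 : (c : ℂ) ≠ 0 := by exact_mod_cast hc.ne'
  simp_rw [ofReal_max_sub_zero c]
  refine ⟨hsub.1, hsub.2.trans ?_⟩
  rw [hlin.2, hconst.2, hcutoff.2]
  have hneg : -(w + 1) + 1 = -w := by ring
  have hpow : (c : ℂ) ^ (-(w + 1) + 0) = (c : ℂ) ^ (-w) / c := by
    rw [show -(w + 1) + 0 = -w - 1 by ring, Complex.cpow_sub _ _ hc0, Complex.cpow_one]
  rw [hneg, hpow, smul_eq_mul, add_zero, neg_div_neg_eq, neg_div_neg_eq]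
  field_simp
  ring

theorem integral_norm_cpow_smul_max_sub_zero_le {c : ℝ} (hc : 0 < c) {w : ℂ} (hw : 0 < w.re) :
    ∫ t in Set.Ioi (0 : ℝ), ‖(t : ℂ) ^ (-(w + 1) - 1) • ((max (t - c) 0 : ℝ) : ℂ)‖ ≤
      c ^ (-w.re) / w.re := by
  have hint : IntegrableOn (fun t : ℝ => t ^ (-w.re - 1)) (Set.Ioi c) :=
    integrableOn_Ioi_rpow_of_lt (by linarith) hc
  have hle : ∀ t ∈ Set.Ioi (0 : ℝ), ‖(t : ℂ) ^ (-(w + 1) - 1) • ((max (t - c) 0 : ℝ) : ℂ)‖ ≤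
      (Set.Ioi c).indicator (fun t : ℝ => t ^ (-w.re - 1)) t := by
    intro t ht
    rw [norm_smul, Complex.norm_cpow_eq_rpow_re_of_pos ht, Complex.norm_real,
      Real.norm_of_nonneg (le_max_right _ _)]
    by_cases htc : t ∈ Set.Ioi c
    · have hpow : t ^ (-w.re - 1) = t ^ (-(w + 1) - 1).re * t := by
        rw [← Real.rpow_add_one (ne_of_gt ht)]
        congr 1
        simp only [Complex.sub_re, Complex.neg_re, Complex.add_re, Complex.one_re]
        ring
      rw [Set.indicator_of_mem htc, max_eq_left (sub_nonneg.2 (le_of_lt htc)), hpow]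
      exact mul_le_mul_of_nonneg_left (by linarith) (Real.rpow_nonneg (le_of_lt ht) _)
    · rw [Set.indicator_of_notMem htc, max_eq_right (sub_nonpos.2 (not_lt.1 htc)), mul_zero]
  calc _ ≤ ∫ t in Set.Ioi (0 : ℝ), (Set.Ioi c).indicator (fun t : ℝ => t ^ (-w.re - 1)) t :=
        setIntegral_mono_on (hasMellin_max_sub_zero hc hw).1.norm
          ((integrable_indicator_iff measurableSet_Ioi).2 hint).integrableOn measurableSet_Ioi hle
    _ = c ^ (-w.re) / w.re := by
        rw [setIntegral_indicator measurableSet_Ioi,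
          Set.inter_eq_self_of_subset_right (Set.Ioi_subset_Ioi hc.le),
          integral_Ioi_rpow_of_lt (by linarith) hc, sub_add_cancel, neg_div_neg_eq]

namespace BeurlingPrimes

variable (P : BeurlingPrimes)

/-- The integrated counting function `∫₀ˣ N = ∑ (x - |g|)₊`. -/
def NInt (x : ℝ) : ℝ := ∑' g : P.Integers, max (x - P.norm g) 0

theorem NInt_eq_sum {x y : ℝ} (hxy : x ≤ y) :
    P.NInt x = ∑ g ∈ (P.finite_norm_le y).toFinset, max (x - P.norm g) 0 := by
  refine tsum_eq_sum fun g hg => max_eq_right ?_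
  rw [Set.Finite.mem_toFinset] at hg
  have : y < P.norm g := not_le.1 hg
  linarith

theorem N_eq_card (x : ℝ) : P.N x = (P.finite_norm_le x).toFinset.card :=
  Set.ncard_eq_toFinset_card _ _

theorem continuous_NInt : Continuous P.NInt := by
  refine continuous_iff_continuousAt.2 fun x => ?_
  have h : ContinuousAt (fun t => ∑ g ∈ (P.finite_norm_le (x + 1)).toFinset,
      max (t - P.norm g) 0) x := by fun_prop
  refine h.congr ?_
  filter_upwards [eventually_le_nhds (lt_add_one x)] with t ht using (P.NInt_eq_sum ht).symm

theorem NInt_of_le_one {x : ℝ} (hx : x ≤ 1) : P.NInt x = 0 := by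
  unfold NInt
  have h (g : P.Integers) : max (x - P.norm g) 0 = 0 :=
    max_eq_right (by linarith [P.one_le_norm g])
  simp_rw [h, tsum_zero]

theorem mul_N_le_NInt_sub (x : ℝ) {h : ℝ} (hh : 0 ≤ h) :
    h * P.N x ≤ P.NInt (x + h) - P.NInt x := by
  rw [P.NInt_eq_sum le_rfl, P.NInt_eq_sum (show x ≤ x + h by linarith), ← Finset.sum_sub_distrib,
    N_eq_card]
  calc h * ((P.finite_norm_le x).toFinset.card : ℝ) =
        ∑ _g ∈ (P.finite_norm_le x).toFinset, h := by simp [mul_comm]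
    _ ≤ ∑ g ∈ (P.finite_norm_le x).toFinset,
        (max (x + h - P.norm g) 0 - max (x - P.norm g) 0) := by
        refine Finset.sum_le_sum fun g hg => ?_
        have hg' : P.norm g ≤ x := by simpa using hg
        rw [max_eq_left (by linarith), max_eq_left (by linarith)]
        linarith
    _ ≤ _ := by
        refine Finset.sum_le_sum_of_subset_of_nonneg (fun g hg => ?_) fun g _ _ => ?_
        · have hg' : P.norm g ≤ x := by simpa using hg
          simpa using hg'.trans (by linarith)
        · exact sub_nonneg.2 (max_le_max (by linarith) le_rfl)

theorem NInt_sub_le_mul_N (x : ℝ) {h : ℝ} (hh : 0 ≤ h) :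
    P.NInt (x + h) - P.NInt x ≤ h * P.N (x + h) := by
  rw [P.NInt_eq_sum le_rfl, P.NInt_eq_sum (show x ≤ x + h by linarith), ← Finset.sum_sub_distrib,
    N_eq_card]
  calc _ ≤ ∑ _g ∈ (P.finite_norm_le (x + h)).toFinset, h := by
        refine Finset.sum_le_sum fun g _ => ?_
        rw [sub_le_iff_le_add]
        refine max_le ?_ (add_nonneg hh (le_max_right _ _))
        linarith [le_max_left (x - P.norm g) 0]
    _ = _ := by simp [mul_comm]

theorem summable_norm_rpow {σ : ℝ}
    (h : Summable fun g : P.Integers => (P.norm g : ℂ) ^ (-(σ : ℂ))) :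
    Summable fun g : P.Integers => P.norm g ^ (-σ) :=
  (summable_norm_iff.2 h).congr fun g => by
    rw [Complex.norm_cpow_eq_rpow_re_of_pos (P.norm_pos g)]
    simp

theorem NInt_le {σ x : ℝ} (hσ : 0 ≤ σ) (hx : 0 < x)
    (h : Summable fun g : P.Integers => P.norm g ^ (-σ)) :
    P.NInt x ≤ (∑' g : P.Integers, P.norm g ^ (-σ)) * x ^ (1 + σ) := by
  rw [← tsum_mul_right]
  refine Summable.tsum_le_tsum (fun g => ?_) ?_ (h.mul_right _)
  · have hg := P.norm_pos g
    rcases le_or_gt x (P.norm g) with hxg | hxg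
    · rw [max_eq_right (by linarith)]
      positivity
    · rw [max_eq_left (by linarith), Real.rpow_add hx, Real.rpow_one, Real.rpow_neg hg.le]
      have h1 : 1 ≤ (P.norm g ^ σ)⁻¹ * x ^ σ := by
        rw [inv_mul_eq_div, one_le_div (by positivity)]
        exact Real.rpow_le_rpow hg.le hxg.le hσ
      nlinarith
  · refine summable_of_ne_finset_zero (s := (P.finite_norm_le x).toFinset) fun g hg =>
      max_eq_right ?_
    rw [Set.Finite.mem_toFinset] at hg
    have : x < P.norm g := not_le.1 hg
    linarith

theorem mellinConvergent_NInt {s : ℂ} {σ : ℝ} (hσ : 0 ≤ σ)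
    (h : Summable fun g : P.Integers => P.norm g ^ (-σ)) (hs : s.re < -(1 + σ)) :
    MellinConvergent (fun x => (P.NInt x : ℂ)) s := by
  have hzero : (fun x => (P.NInt x : ℂ)) =ᶠ[𝓝[>] 0] 0 :=
    ((eventually_le_nhds zero_lt_one).filter_mono nhdsWithin_le_nhds).mono fun x hx => by
      simp [P.NInt_of_le_one hx]
  refine mellinConvergent_of_isBigO_rpow (a := -(1 + σ)) (b := s.re - 1)
    ((Complex.continuous_ofReal.comp P.continuous_NInt).locallyIntegrable.locallyIntegrableOn _)
    (IsBigO.of_bound (∑' g : P.Integers, P.norm g ^ (-σ)) ?_) hs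
    (hzero.trans_isBigO (isBigO_zero _ _)) (sub_one_lt _)
  filter_upwards [eventually_gt_atTop 0] with x hx
  have h0 : 0 ≤ P.NInt x := tsum_nonneg fun g => le_max_right _ _
  rw [Complex.norm_real, Real.norm_of_nonneg h0, neg_neg,
    Real.norm_of_nonneg (Real.rpow_nonneg hx.le _)]
  exact P.NInt_le hσ hx h

theorem hasMellin_NInt {Z w : ℂ}
    (hsum : HasSum (fun g : P.Integers => (P.norm g : ℂ) ^ (-w)) Z)
    (hconv : MellinConvergent (fun x => (P.NInt x : ℂ)) (-(w + 1))) (hw : 0 < w.re) :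
    HasMellin (fun x => (P.NInt x : ℂ)) (-(w + 1)) (Z / (w * (w + 1))) := by
  refine ⟨hconv, ?_⟩
  have hm := fun g => hasMellin_max_sub_zero (P.norm_pos g) hw
  have hS : Summable fun g : P.Integers => ∫ t in Set.Ioi (0 : ℝ),
      ‖(t : ℂ) ^ (-(w + 1) - 1) • ((max (t - P.norm g) 0 : ℝ) : ℂ)‖ := by
    refine Summable.of_nonneg_of_le (fun g => integral_nonneg fun _ => norm_nonneg _)
      (fun g => integral_norm_cpow_smul_max_sub_zero_le (P.norm_pos g) hw)
      (Summable.div_const ?_ w.re)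
    exact hsum.summable.norm.congr fun g => by
      rw [Complex.norm_cpow_eq_rpow_re_of_pos (P.norm_pos g), Complex.neg_re]
  have hvalue : HasSum (fun g : P.Integers => mellin
      (fun t : ℝ => ((max (t - P.norm g) 0 : ℝ) : ℂ)) (-(w + 1))) (Z / (w * (w + 1))) := by
    simp_rw [fun g => (hm g).2]
    exact hsum.div_const _
  rw [← (hasSum_integral_of_summable_integral_norm (fun g => (hm g).1) hS).unique hvalue]
  refine setIntegral_congr_fun measurableSet_Ioi fun t _ => ?_
  simp only [NInt, tsum_const_smul'', Complex.ofReal_tsum]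

end BeurlingPrimes

section VerticalIntegral

variable {E : Type*} [NormedAddCommGroup E] [NormedSpace ℂ E] {g : ℂ → E} {C b σ σ₁ σ₂ : ℝ}

theorem integrable_vertical (hb : 1 < b)
    (hd : ∀ s : ℂ, s.re = σ → DifferentiableAt ℂ g s)
    (hg : ∀ s : ℂ, s.re = σ → ‖g s‖ ≤ C * (1 + |s.im|) ^ (-b)) :
    Integrable fun t : ℝ => g (σ + t * Complex.I) := by
  have hcont : Continuous fun t : ℝ => g (σ + t * Complex.I) :=
    continuous_iff_continuousAt.2 fun t =>
      ContinuousAt.comp (f := fun t : ℝ => (σ : ℂ) + t * Complex.I)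
        (hd _ (by simp)).continuousAt (by fun_prop)
  have hdom : Integrable fun t : ℝ => C * (1 + |t|) ^ (-b) := by
    simpa using (integrable_one_add_norm (E := ℝ) (μ := volume) (r := b) (by simpa)).const_mul C
  exact hdom.mono' hcont.aestronglyMeasurable
    (ae_of_all _ fun t => by simpa using hg (σ + t * Complex.I) (by simp))

theorem tendsto_integral_horizontal_cocompact (hσ : σ₁ ≤ σ₂) (hb : 0 < b)
    (hg : ∀ s : ℂ, σ₁ ≤ s.re → s.re ≤ σ₂ → ‖g s‖ ≤ C * (1 + |s.im|) ^ (-b)) :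
    Tendsto (fun T : ℝ => ∫ x in σ₁..σ₂, g (x + T * Complex.I)) (cocompact ℝ) (𝓝 0) := by
  have hdecay : Tendsto (fun T : ℝ => C * (1 + ‖T‖) ^ (-b) * |σ₂ - σ₁|) (cocompact ℝ) (𝓝 0) := by
    have h := (tendsto_rpow_neg_atTop hb).comp
      (tendsto_atTop_add_const_left _ 1 (tendsto_norm_cocompact_atTop (E := ℝ)))
    simpa using (h.const_mul C).mul_const |σ₂ - σ₁|
  refine squeeze_zero_norm (fun T => ?_) hdecay
  refine intervalIntegral.norm_integral_le_of_norm_le_const fun x hx => ?_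
  rw [Set.uIoc_of_le hσ] at hx
  simpa using hg (x + T * Complex.I) (by simpa using hx.1.le) (by simpa using hx.2)

theorem integral_vertical_eq (hσ : σ₁ ≤ σ₂) (hb : 1 < b)
    (hd : ∀ s : ℂ, σ₁ ≤ s.re → s.re ≤ σ₂ → DifferentiableAt ℂ g s)
    (hg : ∀ s : ℂ, σ₁ ≤ s.re → s.re ≤ σ₂ → ‖g s‖ ≤ C * (1 + |s.im|) ^ (-b)) :
    ∫ t : ℝ, g (σ₁ + t * Complex.I) = ∫ t : ℝ, g (σ₂ + t * Complex.I) := by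
  have hvert (σ : ℝ) (h₁ : σ₁ ≤ σ) (h₂ : σ ≤ σ₂) :
      Tendsto (fun T : ℝ => ∫ t in (-T)..T, g (σ + t * Complex.I)) atTop
        (𝓝 (∫ t : ℝ, g (σ + t * Complex.I))) :=
    intervalIntegral_tendsto_integral
      (integrable_vertical hb (fun s hs => hd s (by rwa [hs]) (by rwa [hs]))
        fun s hs => hg s (by rwa [hs]) (by rwa [hs])) tendsto_neg_atTop_atBot tendsto_id
  have hhor := tendsto_integral_horizontal_cocompact hσ (one_pos.trans hb) hg
  have hrect (T : ℝ) : (∫ x in σ₁..σ₂, g (x + (-T : ℝ) * Complex.I)) -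
      (∫ x in σ₁..σ₂, g (x + T * Complex.I)) +
      Complex.I • (∫ t in (-T)..T, g (σ₂ + t * Complex.I)) -
      Complex.I • (∫ t in (-T)..T, g (σ₁ + t * Complex.I)) = 0 :=
    Complex.integral_boundary_rect_eq_zero_of_differentiableOn g (⟨σ₁, -T⟩ : ℂ) (⟨σ₂, T⟩ : ℂ)
      fun s hs => by
        have hre : s.re ∈ Set.uIcc σ₁ σ₂ := hs.1
        rw [Set.uIcc_of_le hσ] at hre
        exact (hd s hre.1 hre.2).differentiableWithinAt
  have hlim := ((((hhor.mono_left atBot_le_cocompact).comp tendsto_neg_atTop_atBot).sub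
    (hhor.mono_left atTop_le_cocompact)).add ((hvert σ₂ hσ le_rfl).const_smul Complex.I)).sub
    ((hvert σ₁ le_rfl hσ).const_smul Complex.I)
  simp only [Function.comp_apply, hrect] at hlim
  have h := tendsto_nhds_unique hlim tendsto_const_nhds
  rw [sub_zero, zero_add, sub_eq_zero, smul_right_inj Complex.I_ne_zero] at h
  exact h.symm

end VerticalIntegral

section ShiftedInversion

variable {F : ℝ → ℂ} {G : ℂ → ℂ} {C b σ₁ σ₂ x : ℝ}

theorem eq_integral_of_hasMellin (hb : 1 < b)
    (hd : ∀ s : ℂ, s.re = σ₂ → DifferentiableAt ℂ G s)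
    (hG : ∀ s : ℂ, s.re = σ₂ → ‖G s‖ ≤ C * (1 + |s.im|) ^ (-b))
    (hF : ∀ s : ℂ, s.re = σ₂ → HasMellin F (-s) (G s)) (hx : 0 < x) (hcont : ContinuousAt F x) :
    F x = (1 / (2 * Real.pi) : ℝ) •
      ∫ t : ℝ, G (σ₂ + t * Complex.I) * (x : ℂ) ^ (σ₂ + t * Complex.I) := by
  have hval (t : ℝ) : mellin F ((-σ₂ : ℝ) + (-t : ℝ) * Complex.I) = G (σ₂ + t * Complex.I) := by
    rw [← (hF (σ₂ + t * Complex.I) (by simp)).2]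
    congr 1
    push_cast
    ring
  have hconv : MellinConvergent F ((-σ₂ : ℝ) : ℂ) := by
    simpa using (hF σ₂ (by simp)).1
  have hvert : Complex.VerticalIntegrable (mellin F) (-σ₂) := by
    have h := integrable_vertical hb hd hG
    simp only [← hval] at h
    simpa only [Complex.VerticalIntegrable, neg_neg] using h.comp_neg
  rw [← mellinInv_mellin_eq (-σ₂) F hx hconv hvert hcont, mellinInv]
  congr 1
  rw [← integral_neg_eq_self]
  refine integral_congr_ae (ae_of_all _ fun t => ?_)
  simp only [hval, smul_eq_mul, mul_comm (G _)]
  congr 2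
  push_cast
  ring

theorem norm_mul_cpow_le (hx : 1 ≤ x) {s : ℂ} (hs : s.re ≤ σ₂)
    (hG : ‖G s‖ ≤ C * (1 + |s.im|) ^ (-b)) :
    ‖G s * (x : ℂ) ^ s‖ ≤ C * x ^ σ₂ * (1 + |s.im|) ^ (-b) := by
  rw [norm_mul, Complex.norm_cpow_eq_rpow_re_of_pos (one_pos.trans_le hx)]
  calc ‖G s‖ * x ^ s.re ≤ C * (1 + |s.im|) ^ (-b) * x ^ σ₂ :=
        mul_le_mul hG (Real.rpow_le_rpow_of_exponent_le hx hs) (by positivity)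
          ((norm_nonneg _).trans hG)
    _ = _ := by ring

theorem differentiableAt_mul_cpow (hx : 1 ≤ x) {s : ℂ} (hd : DifferentiableAt ℂ G s) :
    DifferentiableAt ℂ (fun s => G s * (x : ℂ) ^ s) s :=
  hd.mul (differentiableAt_id.const_cpow
    (Or.inl (Complex.ofReal_ne_zero.2 (one_pos.trans_le hx).ne')))

theorem integrable_vertical_mul_cpow (hb : 1 < b) {σ : ℝ}
    (hd : ∀ s : ℂ, s.re = σ → DifferentiableAt ℂ G s)
    (hG : ∀ s : ℂ, s.re = σ → ‖G s‖ ≤ C * (1 + |s.im|) ^ (-b)) (hx : 1 ≤ x) :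
    Integrable fun t : ℝ => G (σ + t * Complex.I) * (x : ℂ) ^ (σ + t * Complex.I) :=
  integrable_vertical hb (fun s hs => differentiableAt_mul_cpow hx (hd s hs))
    fun s hs => norm_mul_cpow_le hx hs.le (hG s hs)

theorem eq_integral_of_hasMellin_of_le (hσ : σ₁ ≤ σ₂) (hb : 1 < b)
    (hd : ∀ s : ℂ, σ₁ ≤ s.re → s.re ≤ σ₂ → DifferentiableAt ℂ G s)
    (hG : ∀ s : ℂ, σ₁ ≤ s.re → s.re ≤ σ₂ → ‖G s‖ ≤ C * (1 + |s.im|) ^ (-b))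
    (hF : ∀ s : ℂ, s.re = σ₂ → HasMellin F (-s) (G s)) (hx : 1 ≤ x) (hcont : ContinuousAt F x) :
    F x = (1 / (2 * Real.pi) : ℝ) •
      ∫ t : ℝ, G (σ₁ + t * Complex.I) * (x : ℂ) ^ (σ₁ + t * Complex.I) := by
  rw [eq_integral_of_hasMellin hb (fun s hs => hd s (hs ▸ hσ) hs.le)
      (fun s hs => hG s (hs ▸ hσ) hs.le) hF (one_pos.trans_le hx) hcont,
    ← integral_vertical_eq hσ hb (fun s h₁ h₂ => differentiableAt_mul_cpow hx (hd s h₁ h₂))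
      fun s h₁ h₂ => norm_mul_cpow_le hx h₂ (hG s h₁ h₂)]

end ShiftedInversion

/-- The function `x ^ (a + 1) - 1` on `x > 1`, extended by `0`: the contribution to `∫₀ˣ N` of a
pole of the zeta function at `a`, up to a constant factor. -/
def truncPow (a : ℂ) (x : ℝ) : ℂ :=
  (Set.Ioi 1).indicator (fun t : ℝ => (t : ℂ) ^ (a + 1)) x -
    (Set.Ioi 1).indicator (fun t : ℝ => (t : ℂ) ^ (0 : ℂ)) x

theorem truncPow_of_one_lt (a : ℂ) {x : ℝ} (hx : 1 < x) : truncPow a x = (x : ℂ) ^ (a + 1) - 1 := by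
  simp [truncPow, Set.indicator_of_mem (Set.mem_Ioi.2 hx)]

theorem continuousAt_truncPow (a : ℂ) {x : ℝ} (hx : 1 < x) : ContinuousAt (truncPow a) x := by
  have hs : (x : ℂ) ∈ Complex.slitPlane := Complex.ofReal_mem_slitPlane.2 (one_pos.trans hx)
  have h : ContinuousAt (fun t : ℝ => (t : ℂ) ^ (a + 1) - 1) x := by
    fun_prop (disch := assumption)
  refine h.congr ?_
  filter_upwards [eventually_gt_nhds hx] with t ht using (truncPow_of_one_lt a ht).symm

theorem hasMellin_truncPow {a w : ℂ} (h0 : -1 < w.re) (ha : a.re < w.re) :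
    HasMellin (truncPow a) (-(w + 1)) (1 / (w - a) - 1 / (w + 1)) := by
  have hpow := hasMellin_indicator_Ioi_cpow one_pos (b := a + 1) (s := -(w + 1))
    (by simp only [Complex.neg_re, Complex.add_re]; linarith)
  have hone := hasMellin_indicator_Ioi_cpow one_pos (b := 0) (s := -(w + 1))
    (by simp only [Complex.neg_re, Complex.add_re, Complex.one_re, Complex.zero_re]; linarith)
  have hsub := hasMellin_sub hpow.1 hone.1
  refine ⟨hsub.1, hsub.2.trans ?_⟩
  rw [hpow.2, hone.2, Complex.ofReal_one, Complex.one_cpow, Complex.one_cpow,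
    show -(w + 1) + (a + 1) = -(w - a) by ring, add_zero, neg_div_neg_eq, neg_div_neg_eq]

theorem one_add_abs_im_le {w : ℂ} (hw : 0 ≤ w.re) : 1 + |w.im| ≤ 2 * ‖w + 1‖ := by
  have him := Complex.abs_im_le_norm (w + 1)
  have hre := (le_abs_self _).trans (Complex.abs_re_le_norm (w + 1))
  simp only [Complex.add_im, Complex.one_im, add_zero, Complex.add_re, Complex.one_re] at him hre
  linarith

section CpowIncrement

variable {y h e : ℝ} {w : ℂ}

theorem norm_cpow_sub_cpow_le_mul (hy : 0 < y) (hh : 0 ≤ h) (hw : 0 ≤ w.re) :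
    ‖((y + h : ℝ) : ℂ) ^ (w + 1) - (y : ℂ) ^ (w + 1)‖ ≤ ‖w + 1‖ * (h * (y + h) ^ w.re) := by
  refine (norm_cpow_sub_cpow_le_integral hy (le_add_of_nonneg_right hh) (w + 1)).trans
    (mul_le_mul_of_nonneg_left ?_ (norm_nonneg _))
  have hexp : (w + 1).re - 1 = w.re := by simp
  rw [hexp]
  simpa using intervalIntegral.integral_mono_on (μ := volume) (le_add_of_nonneg_right hh)
    (intervalIntegrable_rpow_const hy (by linarith) w.re)
    (intervalIntegrable_const (c := (y + h) ^ w.re))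
    fun v hv => Real.rpow_le_rpow (hy.le.trans hv.1) hv.2 hw

theorem norm_cpow_sub_cpow_div_le (hy : 0 < y) (hh : 0 ≤ h) (hhy : h ≤ y) (hw : 0 ≤ w.re) :
    ‖((y + h : ℝ) : ℂ) ^ (w + 1) - (y : ℂ) ^ (w + 1)‖ / ‖w + 1‖ ≤ h * (2 * y) ^ w.re := by
  have hw1 : 0 < ‖w + 1‖ := by linarith [one_add_abs_im_le hw, abs_nonneg w.im]
  rw [div_le_iff₀' hw1]
  refine (norm_cpow_sub_cpow_le_mul hy hh hw).trans ?_
  gcongr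
  linarith

theorem norm_cpow_sub_cpow_div_le_div (hy : 0 < y) (hh : 0 ≤ h) (hhy : h ≤ y) (hw : 0 ≤ w.re) :
    ‖((y + h : ℝ) : ℂ) ^ (w + 1) - (y : ℂ) ^ (w + 1)‖ / ‖w + 1‖ ≤
      (2 * y) ^ w.re * (8 * y) / (1 + |w.im|) := by
  have hw1 := one_add_abs_im_le hw
  have him : 0 < 1 + |w.im| := by positivity
  have hpow {x : ℝ} (hx : 0 < x) (hxy : x ≤ 2 * y) :
      ‖(x : ℂ) ^ (w + 1)‖ ≤ (2 * y) ^ w.re * (2 * y) := by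
    rw [Complex.norm_cpow_eq_rpow_re_of_pos hx, Complex.add_re, Complex.one_re,
      ← Real.rpow_add_one (by positivity)]
    exact Real.rpow_le_rpow hx.le hxy (by linarith)
  rw [div_le_div_iff₀ (by linarith) him]
  calc _ ≤ ((2 * y) ^ w.re * (2 * y) + (2 * y) ^ w.re * (2 * y)) * (2 * ‖w + 1‖) :=
        mul_le_mul ((norm_sub_le _ _).trans
          (add_le_add (hpow (by linarith) (by linarith)) (hpow hy (by linarith))))
          hw1 him.le (by positivity)
    _ = _ := by ring

theorem min_one_le_rpow {x e : ℝ} (hx : 0 < x) (he0 : 0 ≤ e) (he1 : e ≤ 1) : min 1 x ≤ x ^ e := by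
  rcases le_total x 1 with h | h
  · exact (min_le_right _ _).trans
      ((Real.rpow_one x).symm.le.trans (Real.rpow_le_rpow_of_exponent_ge hx h he1))
  · exact (min_le_left _ _).trans (Real.one_le_rpow h he0)

/-- Geometric interpolation between the trivial bound and the bound by the derivative. -/
theorem norm_cpow_sub_cpow_div_le_rpow (he0 : 0 ≤ e) (he1 : e ≤ 1) (hy : 0 < y) (hh : 0 < h)
    (hhy : h ≤ y) (hw : 0 ≤ w.re) :
    ‖((y + h : ℝ) : ℂ) ^ (w + 1) - (y : ℂ) ^ (w + 1)‖ / ‖w + 1‖ ≤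
      h * (2 * y) ^ w.re * ((8 * (y / h)) ^ e * (1 + |w.im|) ^ (-e)) := by
  have him : 0 < 1 + |w.im| := by positivity
  set B := 8 * (y / h) / (1 + |w.im|) with hB
  have hBe : B ^ e = (8 * (y / h)) ^ e * (1 + |w.im|) ^ (-e) := by
    rw [hB, Real.div_rpow (by positivity) him.le, Real.rpow_neg him.le, div_eq_mul_inv]
  have hmin : ‖((y + h : ℝ) : ℂ) ^ (w + 1) - (y : ℂ) ^ (w + 1)‖ / ‖w + 1‖ ≤
      h * (2 * y) ^ w.re * min 1 B := by
    rw [mul_min_of_nonneg _ _ (by positivity), mul_one, le_min_iff]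
    refine ⟨norm_cpow_sub_cpow_div_le hy hh.le hhy hw,
      (norm_cpow_sub_cpow_div_le_div hy hh.le hhy hw).trans_eq ?_⟩
    rw [hB]
    field_simp
  rw [← hBe]
  exact hmin.trans (mul_le_mul_of_nonneg_left (min_one_le_rpow (by positivity) he0 he1)
    (by positivity))

end CpowIncrement

/-! ### Axiom A from the growth of the zeta function -/

namespace BeurlingPrimes

/-- `∫₀ˣ N` minus the contributions of the poles of `ζ` at `1` and `r`, with residues `κ` and
`r c`. -/
def NIntError (P : BeurlingPrimes) (κ : ℝ) (c : ℂ) (r x : ℝ) : ℂ :=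
  P.NInt x - (κ / 2 : ℂ) • truncPow 1 x - (c / (r + 1)) • truncPow r x

theorem continuousAt_NIntError (P : BeurlingPrimes) (κ : ℝ) (c : ℂ) (r : ℝ) {x : ℝ} (hx : 1 < x) :
    ContinuousAt (P.NIntError κ c r) x :=
  ((Complex.continuous_ofReal.comp P.continuous_NInt).continuousAt.sub
    (continuousAt_const.fun_smul (continuousAt_truncPow 1 hx))).sub
    (continuousAt_const.fun_smul (continuousAt_truncPow r hx))

theorem hasMellin_NIntError (P : BeurlingPrimes) {E : ℂ → ℂ} {κ r : ℝ} {c : ℂ}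
    (hE : ∀ s : ℂ, 1 < s.re → HasSum (fun g : P.Integers => (P.norm g : ℂ) ^ (-s))
      (s * (E s + κ / (s - 1) + c / (s - r))))
    (hr : r ∈ Set.Ioo (-1) 1) {w : ℂ} (hw : 1 < w.re) :
    HasMellin (P.NIntError κ c r) (-(w + 1)) (E w / (w + 1)) := by
  obtain ⟨σ, hσ, hσw⟩ := exists_between hw
  have hconv : MellinConvergent (fun x => (P.NInt x : ℂ)) (-(w + 1)) :=
    P.mellinConvergent_NInt (by linarith)
      (P.summable_norm_rpow (hE σ (by simpa using hσ)).summable)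
      (by simp only [Complex.neg_re, Complex.add_re, Complex.one_re]; linarith)
  have hN := P.hasMellin_NInt (hE w hw) hconv (by linarith)
  have h1 := hasMellin_const_smul
    (hasMellin_truncPow (a := 1) (w := w) (by linarith) (by simpa using hw)).1 (κ / 2 : ℂ)
  have hc := hasMellin_const_smul
    (hasMellin_truncPow (a := r) (w := w) (by linarith) (by simpa using hr.2.trans hw)).1
    (c / (r + 1))
  have hN1 := hasMellin_sub hN.1 h1.1
  have hNc := hasMellin_sub hN1.1 hc.1
  refine ⟨hNc.1, hNc.2.trans ?_⟩
  rw [hN1.2, hN.2, h1.2, hc.2, (hasMellin_truncPow (by linarith) (by simpa using hw)).2,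
    (hasMellin_truncPow (by linarith) (by simpa using hr.2.trans hw)).2]
  have hne (a : ℝ) (ha : a < w.re) : w - a ≠ 0 := fun h => by
    rw [sub_eq_zero.1 h, Complex.ofReal_re] at ha
    exact ha.false
  have hw0 : w ≠ 0 := by simpa using hne 0 (by linarith)
  have hw1 : w - 1 ≠ 0 := by simpa using hne 1 hw
  have hwr : w - r ≠ 0 := hne r (by linarith [hr.2])
  have hw1' : w + 1 ≠ 0 := by simpa using hne (-1) (by linarith)
  have hr1 : (r : ℂ) + 1 ≠ 0 := by
    exact_mod_cast (by linarith [hr.1] : 0 < r + 1).ne'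
  simp only [smul_eq_mul]
  field_simp
  ring

/-- `E` is the continuation of `ζ(s) / s - κ / (s - 1) - c / (s - r)` to the half-plane
`Re s ≥ σ₀`, and it is bounded by `C (1 + |t|) ^ (ε - 1)` in the strip `σ₀ ≤ Re s ≤ 2`. The
defining relation is solved for the zeta function. -/
structure IsZetaRemainder (P : BeurlingPrimes) (κ : ℝ) (c : ℂ) (r σ₀ ε C : ℝ) (E : ℂ → ℂ) :
    Prop where
  pos : 0 < σ₀
  le_two : σ₀ ≤ 2
  hasSum : ∀ s : ℂ, 1 < s.re → HasSum (fun g : P.Integers => (P.norm g : ℂ) ^ (-s))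
    (s * (E s + κ / (s - 1) + c / (s - r)))
  differentiableAt : ∀ s : ℂ, σ₀ ≤ s.re → DifferentiableAt ℂ E s
  norm_le : ∀ s : ℂ, σ₀ ≤ s.re → s.re ≤ 2 → ‖E s‖ ≤ C * (1 + |s.im|) ^ (ε - 1)

namespace IsZetaRemainder

variable {P : BeurlingPrimes} {E : ℂ → ℂ} {κ r σ₀ ε C : ℝ} {c : ℂ}

theorem nonneg (hE : P.IsZetaRemainder κ c r σ₀ ε C E) : 0 ≤ C := by
  simpa using (norm_nonneg _).trans (hE.norm_le σ₀ (by simp) (by simpa using hE.le_two))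

theorem norm_sub_one_div_le (hE : P.IsZetaRemainder κ c r σ₀ ε C E) {s : ℂ}
    (h₁ : σ₀ + 1 ≤ s.re) (h₂ : s.re ≤ 3) :
    ‖E (s - 1) / s‖ ≤ 2 * C * (1 + |s.im|) ^ (-(2 - ε)) := by
  have hC := hE.nonneg
  have hre : (s - 1).re = s.re - 1 := by simp
  have him : (s - 1).im = s.im := by simp
  have hs := one_add_abs_im_le (w := s - 1) (by linarith [hE.pos])
  have hbound := hE.norm_le (s - 1) (by linarith) (by linarith)
  rw [him] at hs hbound
  rw [sub_add_cancel] at hs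
  have hpos : 0 < 1 + |s.im| := by positivity
  have hexp : (1 + |s.im|) ^ (ε - 1) = (1 + |s.im|) ^ (-(2 - ε)) * (1 + |s.im|) := by
    rw [← Real.rpow_add_one hpos.ne']
    congr 1
    ring
  rw [norm_div, div_le_iff₀ (by linarith)]
  calc ‖E (s - 1)‖ ≤ C * (1 + |s.im|) ^ (-(2 - ε)) * (1 + |s.im|) := by rwa [mul_assoc, ← hexp]
    _ ≤ C * (1 + |s.im|) ^ (-(2 - ε)) * (2 * ‖s‖) := mul_le_mul_of_nonneg_left hs (by positivity)
    _ = _ := by ring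

theorem differentiableAt_sub_one_div (hE : P.IsZetaRemainder κ c r σ₀ ε C E) {s : ℂ}
    (hs : σ₀ + 1 ≤ s.re) : DifferentiableAt ℂ (fun s => E (s - 1) / s) s := by
  have hs0 : s ≠ 0 := fun h => by
    rw [h, Complex.zero_re] at hs
    linarith [hE.pos]
  have hEs : DifferentiableAt ℂ E (s - 1) :=
    hE.differentiableAt _ (by rw [Complex.sub_re, Complex.one_re]; linarith)
  exact (hEs.comp s (differentiableAt_id.sub_const 1)).div differentiableAt_id hs0

theorem integrable (hE : P.IsZetaRemainder κ c r σ₀ ε C E) (hε : ε < 1) {x : ℝ} (hx : 1 ≤ x) :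
    Integrable fun t : ℝ => E (σ₀ + t * Complex.I) / (σ₀ + t * Complex.I + 1) *
      (x : ℂ) ^ (σ₀ + t * Complex.I + 1) := by
  have hshift (t : ℝ) : ((σ₀ + 1 : ℝ) : ℂ) + t * Complex.I = σ₀ + t * Complex.I + 1 := by
    push_cast
    ring
  simpa only [hshift, add_sub_cancel_right] using integrable_vertical_mul_cpow
    (by linarith : 1 < 2 - ε) (fun s hs => hE.differentiableAt_sub_one_div hs.ge)
    (fun s hs => hE.norm_sub_one_div_le hs.ge (by linarith [hE.le_two])) hx

theorem NIntError_eq_integral (hE : P.IsZetaRemainder κ c r σ₀ ε C E) (hr : r ∈ Set.Ioo (-1) 1)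
    (hε : ε < 1) {x : ℝ} (hx : 1 < x) :
    P.NIntError κ c r x = (1 / (2 * Real.pi) : ℝ) •
      ∫ t : ℝ, E (σ₀ + t * Complex.I) / (σ₀ + t * Complex.I + 1) *
        (x : ℂ) ^ (σ₀ + t * Complex.I + 1) := by
  have hshift (t : ℝ) : ((σ₀ + 1 : ℝ) : ℂ) + t * Complex.I = σ₀ + t * Complex.I + 1 := by
    push_cast
    ring
  simpa only [hshift, add_sub_cancel_right] using eq_integral_of_hasMellin_of_le
    (by linarith [hE.le_two] : σ₀ + 1 ≤ 3) (by linarith : 1 < 2 - ε)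
    (fun s h₁ _ => hE.differentiableAt_sub_one_div h₁) (fun s => hE.norm_sub_one_div_le)
    (fun s hs => by
      simpa using P.hasMellin_NIntError hE.hasSum hr (w := s - 1)
        (by rw [Complex.sub_re, Complex.one_re]; linarith))
    hx.le (P.continuousAt_NIntError κ c r hx)

end IsZetaRemainder

end BeurlingPrimes

namespace BeurlingPrimes

theorem N_mono (P : BeurlingPrimes) : Monotone P.N := fun _ y hxy =>
  Set.ncard_le_ncard (fun _ hg => le_trans hg hxy) (P.finite_norm_le y)

theorem abs_N_sub_le (P : BeurlingPrimes) {κ x h B : ℝ} (hκ : 0 ≤ κ) (hh : 0 < h)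
    (hright : |P.NInt (x + h) - P.NInt x - κ * h * x| ≤ h * B)
    (hleft : |P.NInt x - P.NInt (x - h) - κ * h * (x - h)| ≤ h * B) :
    |(P.N x : ℝ) - κ * (x - 1)| ≤ B + κ * (h + 1) := by
  have hupper : (P.N x : ℝ) ≤ κ * x + B := by
    refine le_of_mul_le_mul_left ?_ hh
    linarith [P.mul_N_le_NInt_sub x hh.le, (abs_le.1 hright).2]
  have hlower : κ * (x - h) - B ≤ P.N x := by
    have hN := P.NInt_sub_le_mul_N (x - h) hh.le
    rw [sub_add_cancel] at hN
    refine le_of_mul_le_mul_left ?_ hh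
    linarith [(abs_le.1 hleft).1]
  have hκh : 0 ≤ κ * h := by positivity
  rw [abs_le]
  constructor <;> linarith

theorem norm_div_mul_cpow_sub_cpow_le {c : ℂ} {r y h : ℝ} (hr : 0 ≤ r) (hy : 0 < y) (hh : 0 ≤ h)
    (hhy : h ≤ y) :
    ‖c / (r + 1) * (((y + h : ℝ) : ℂ) ^ ((r : ℂ) + 1) - (y : ℂ) ^ ((r : ℂ) + 1))‖ ≤
      h * (‖c‖ * (2 * y) ^ r) := by
  have hbound := norm_cpow_sub_cpow_div_le hy hh hhy (w := (r : ℂ)) (by simpa using hr)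
  rw [Complex.ofReal_re] at hbound
  rw [norm_mul, norm_div, div_mul_eq_mul_div, mul_div_assoc, mul_left_comm]
  exact mul_le_mul_of_nonneg_left hbound (norm_nonneg c)

namespace IsZetaRemainder

variable {P : BeurlingPrimes} {E : ℂ → ℂ} {κ r σ₀ ε C : ℝ} {c : ℂ}

theorem norm_mul_cpow_sub_mul_cpow_le (hE : P.IsZetaRemainder κ c r σ₀ ε C E) (hε0 : 0 ≤ ε)
    (hε : 2 * ε ≤ 1) {y h : ℝ} (hy : 0 < y) (hh : 0 < h) (hhy : h ≤ y) {w : ℂ} (hw : w.re = σ₀) :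
    ‖E w / (w + 1) * ((y + h : ℝ) : ℂ) ^ (w + 1) - E w / (w + 1) * (y : ℂ) ^ (w + 1)‖ ≤
      C * (h * (2 * y) ^ σ₀ * (8 * (y / h)) ^ (2 * ε)) * (1 + |w.im|) ^ (-(1 + ε)) := by
  have hpos : 0 < 1 + |w.im| := by positivity
  have hexp : (1 + |w.im|) ^ (ε - 1) * (1 + |w.im|) ^ (-(2 * ε)) = (1 + |w.im|) ^ (-(1 + ε)) := by
    rw [← Real.rpow_add hpos]
    congr 1
    ring
  have hpow := norm_cpow_sub_cpow_div_le_rpow (w := w) (by linarith) hε hy hh hhy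
    (hE.pos.le.trans hw.ge)
  rw [hw] at hpow
  rw [← mul_sub, norm_mul, norm_div, div_mul_eq_mul_div, mul_div_assoc]
  calc _ ≤ C * (1 + |w.im|) ^ (ε - 1) *
        (h * (2 * y) ^ σ₀ * ((8 * (y / h)) ^ (2 * ε) * (1 + |w.im|) ^ (-(2 * ε)))) :=
        mul_le_mul (hE.norm_le w hw.ge (hw.trans_le hE.le_two)) hpow (by positivity)
          (mul_nonneg hE.nonneg (by positivity))
    _ = C * (h * (2 * y) ^ σ₀ * (8 * (y / h)) ^ (2 * ε)) *
        ((1 + |w.im|) ^ (ε - 1) * (1 + |w.im|) ^ (-(2 * ε))) := by ring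
    _ = _ := by rw [hexp]

theorem exists_norm_NIntError_sub_le (hE : P.IsZetaRemainder κ c r σ₀ ε C E)
    (hr : r ∈ Set.Ioo (-1) 1) (hε0 : 0 < ε) (hε : 2 * ε ≤ 1) :
    ∃ K : ℝ, 0 ≤ K ∧ ∀ y h : ℝ, 1 < y → 0 < h → h ≤ y →
      ‖P.NIntError κ c r (y + h) - P.NIntError κ c r y‖ ≤
        K * (h * (y ^ σ₀ * (y / h) ^ (2 * ε))) := by
  set I := ∫ t : ℝ, (1 + |t|) ^ (-(1 + ε)) with hI
  have : 0 ≤ I := integral_nonneg fun t => by positivity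
  have hdom : Integrable fun t : ℝ => (1 + |t|) ^ (-(1 + ε)) := by
    simpa using integrable_one_add_norm (E := ℝ) (μ := volume) (r := 1 + ε) (by simpa)
  have hC := hE.nonneg
  refine ⟨1 / (2 * Real.pi) * (C * (2 ^ σ₀ * 8 ^ (2 * ε)) * I), by positivity,
    fun y h hy hh hhy => ?_⟩
  have hy0 : 0 < y := one_pos.trans hy
  have hyh : 1 < y + h := by linarith
  rw [hE.NIntError_eq_integral hr (by linarith) hyh, hE.NIntError_eq_integral hr (by linarith) hy,
    ← smul_sub, ← integral_sub (hE.integrable (by linarith) hyh.le)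
      (hE.integrable (by linarith) hy.le), norm_smul, Real.norm_of_nonneg (by positivity),
    mul_assoc]
  refine mul_le_mul_of_nonneg_left ?_ (by positivity)
  refine (norm_integral_le_of_norm_le
    (hdom.const_mul (C * (h * (2 * y) ^ σ₀ * (8 * (y / h)) ^ (2 * ε))))
    (ae_of_all _ fun t => ?_)).trans_eq ?_
  · simpa using hE.norm_mul_cpow_sub_mul_cpow_le hε0.le hε hy0 hh hhy (w := σ₀ + t * Complex.I)
      (by simp)
  · rw [integral_const_mul, ← hI, Real.mul_rpow (by norm_num) hy0.le,
      Real.mul_rpow (by norm_num) (by positivity)]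
    ring

theorem exists_abs_NInt_sub_le (hE : P.IsZetaRemainder κ c r σ₀ ε C E) (hκ : 0 ≤ κ)
    (hr0 : 0 ≤ r) (hr1 : r < 1) (hε0 : 0 < ε) (hε : 2 * ε ≤ 1) :
    ∃ K : ℝ, 0 ≤ K ∧ ∀ y h : ℝ, 1 < y → 0 < h → h ≤ y →
      |P.NInt (y + h) - P.NInt y - κ * h * y| ≤
        h * (κ / 2 * h + ‖c‖ * (2 * y) ^ r + K * (y ^ σ₀ * (y / h) ^ (2 * ε))) := by
  obtain ⟨K, hK, hbound⟩ := hE.exists_norm_NIntError_sub_le ⟨by linarith, hr1⟩ hε0 hε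
  refine ⟨K, hK, fun y h hy hh hhy => ?_⟩
  have hsq (x : ℝ) : (x : ℂ) ^ ((1 : ℂ) + 1) = (x : ℂ) ^ 2 := by
    rw [one_add_one_eq_two, Complex.cpow_ofNat]
  have hdecomp : ((P.NInt (y + h) - P.NInt y - κ * h * y : ℝ) : ℂ) =
      (P.NIntError κ c r (y + h) - P.NIntError κ c r y) + ((κ / 2 * h ^ 2 : ℝ) : ℂ) +
      c / (r + 1) * (((y + h : ℝ) : ℂ) ^ ((r : ℂ) + 1) - (y : ℂ) ^ ((r : ℂ) + 1)) := by
    simp only [NIntError, truncPow_of_one_lt _ hy,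
      truncPow_of_one_lt _ (by linarith : 1 < y + h), hsq, smul_eq_mul]
    push_cast
    ring
  rw [← Real.norm_eq_abs, ← Complex.norm_real, hdecomp]
  calc _ ≤ _ := norm_add₃_le
    _ ≤ K * (h * (y ^ σ₀ * (y / h) ^ (2 * ε))) + κ / 2 * h ^ 2 + h * (‖c‖ * (2 * y) ^ r) := by
      refine add_le_add (add_le_add (hbound y h hy hh hhy) ?_)
        (norm_div_mul_cpow_sub_cpow_le hr0 (by linarith) hh.le hhy)
      rw [Complex.norm_real, Real.norm_of_nonneg (by positivity)]
    _ = _ := by ring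

/-- The step `√x` balances the quadratic term `κ h ^ 2 / 2` against the gain `(x / h) ^ (2 ε)`. -/
theorem exists_abs_NInt_sub_le_sqrt (hE : P.IsZetaRemainder κ c r σ₀ ε C E) (hκ : 0 ≤ κ)
    (hr0 : 0 ≤ r) (hr1 : r < 1) (hε0 : 0 < ε) (hε : 2 * ε ≤ 1) {τ : ℝ} (hτ : 1 / 2 ≤ τ)
    (hrτ : r ≤ τ) (hστ : σ₀ + ε ≤ τ) :
    ∃ A : ℝ, 0 ≤ A ∧ ∀ x y : ℝ, 1 < y → √x ≤ y → y ≤ x →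
      |P.NInt (y + √x) - P.NInt y - κ * √x * y| ≤ √x * (A * x ^ τ) := by
  obtain ⟨K, hK, hbound⟩ := hE.exists_abs_NInt_sub_le hκ hr0 hr1 hε0 hε
  refine ⟨κ / 2 + ‖c‖ * 2 + K, by positivity, fun x y hy hxy hyx => ?_⟩
  have hx : 1 ≤ x := by linarith
  have hx0 : 0 < x := one_pos.trans_le hx
  have hsqrt : √x ≤ x ^ τ := by
    rw [Real.sqrt_eq_rpow]
    exact Real.rpow_le_rpow_of_exponent_le hx hτ
  have hpole : (2 * y) ^ r ≤ 2 * x ^ τ :=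
    calc (2 * y) ^ r = 2 ^ r * y ^ r := Real.mul_rpow zero_le_two (by linarith)
      _ ≤ 2 ^ (1 : ℝ) * x ^ r := by gcongr; exact one_le_two
      _ ≤ 2 * x ^ τ := by
        rw [Real.rpow_one]
        gcongr
  have herror : y ^ σ₀ * (y / √x) ^ (2 * ε) ≤ x ^ τ :=
    calc y ^ σ₀ * (y / √x) ^ (2 * ε) ≤ x ^ σ₀ * (x / √x) ^ (2 * ε) := by
          gcongr
          exact hE.pos.le
      _ = x ^ (σ₀ + ε) := by
        rw [Real.div_sqrt, Real.sqrt_eq_rpow, ← Real.rpow_mul hx0.le, ← Real.rpow_add hx0]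
        congr 1
        ring
      _ ≤ x ^ τ := Real.rpow_le_rpow_of_exponent_le hx hστ
  refine (hbound y √x hy (Real.sqrt_pos.2 hx0) hxy).trans
    (mul_le_mul_of_nonneg_left ?_ (Real.sqrt_nonneg x))
  calc κ / 2 * √x + ‖c‖ * (2 * y) ^ r + K * (y ^ σ₀ * (y / √x) ^ (2 * ε))
      ≤ κ / 2 * x ^ τ + ‖c‖ * (2 * x ^ τ) + K * x ^ τ := by gcongr
    _ = _ := by ring

theorem exists_abs_N_sub_le (hE : P.IsZetaRemainder κ c r σ₀ ε C E) (hκ : 0 ≤ κ)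
    (hr0 : 0 ≤ r) (hr1 : r < 1) (hε0 : 0 < ε) (hε : 2 * ε ≤ 1) {τ : ℝ} (hτ : 1 / 2 ≤ τ)
    (hrτ : r ≤ τ) (hστ : σ₀ + ε ≤ τ) :
    ∃ A : ℝ, ∀ x : ℝ, 1 ≤ x → |(P.N x : ℝ) - κ * (x - 1)| ≤ A * x ^ τ := by
  obtain ⟨A, _, hbound⟩ := hE.exists_abs_NInt_sub_le_sqrt hκ hr0 hr1 hε0 hε hτ hrτ hστ
  refine ⟨max (A + κ * 2) (P.N 4 + κ * 3), fun x hx => ?_⟩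
  have hxτ : 1 ≤ x ^ τ := Real.one_le_rpow hx (by linarith)
  rcases le_or_gt x 4 with hx4 | hx4
  · have hN : (P.N x : ℝ) ≤ P.N 4 := mod_cast P.N_mono hx4
    calc |(P.N x : ℝ) - κ * (x - 1)| ≤ |(P.N x : ℝ)| + |κ * (x - 1)| := abs_sub _ _
      _ ≤ P.N 4 + κ * 3 := by
        rw [Nat.abs_cast, abs_of_nonneg (mul_nonneg hκ (by linarith))]
        gcongr
        linarith
      _ ≤ (P.N 4 + κ * 3) * x ^ τ := le_mul_of_one_le_right (by positivity) hxτ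
      _ ≤ _ := by gcongr; exact le_max_right _ _
  · have hsq : √x * √x = x := Real.mul_self_sqrt (by linarith)
    have hsqrt2 : 2 < √x := by
      rw [Real.lt_sqrt zero_le_two]
      linarith
    have hsqrt : √x ≤ x ^ τ := by
      rw [Real.sqrt_eq_rpow]
      exact Real.rpow_le_rpow_of_exponent_le hx hτ
    have hx2 : √x * 2 ≤ x := by nlinarith
    have hleft := hbound x (x - √x) (by linarith) (by linarith) (by linarith)
    rw [sub_add_cancel] at hleft
    calc |(P.N x : ℝ) - κ * (x - 1)| ≤ A * x ^ τ + κ * (√x + 1) :=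
          P.abs_N_sub_le hκ (by linarith) (hbound x x (by linarith) (by linarith) le_rfl) hleft
      _ ≤ A * x ^ τ + κ * (x ^ τ + x ^ τ) := by gcongr
      _ = (A + κ * 2) * x ^ τ := by ring
      _ ≤ _ := by gcongr; exact le_max_left _ _

end IsZetaRemainder

end BeurlingPrimes

/-! ### Zeros and poles -/

theorem sub_add_one_ne_zero {s ρ : ℂ} (hs : 0 < s.re) (hρ : ρ.re ≤ 1) : s - ρ + 1 ≠ 0 := fun h => by
  have hre := congrArg Complex.re h
  simp only [Complex.add_re, Complex.sub_re, Complex.one_re, Complex.zero_re] at hre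
  linarith

section ZeroProd

variable {S : Multiset ℂ} {s ρ : ℂ}

theorem analyticAt_sub_div_sub_add_one (h : s - ρ + 1 ≠ 0) :
    AnalyticAt ℂ (fun z : ℂ => (z - ρ) / (z - ρ + 1)) s := by
  fun_prop (disch := assumption)

theorem analyticOrderAt_sub_div_sub_add_one (h : s - ρ + 1 ≠ 0) :
    analyticOrderAt (fun z : ℂ => (z - ρ) / (z - ρ + 1)) s = if s = ρ then 1 else 0 := by
  split_ifs with hsρ
  · refine ((analyticAt_sub_div_sub_add_one h).analyticOrderAt_eq_natCast (n := 1)).2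
      ⟨fun z => 1 / (z - ρ + 1), by fun_prop (disch := assumption), one_div_ne_zero h,
        Eventually.of_forall fun z => ?_⟩
    rw [hsρ, pow_one, smul_eq_mul, mul_one_div]
  · rw [(analyticAt_sub_div_sub_add_one h).analyticOrderAt_eq_zero]
    exact div_ne_zero (sub_ne_zero.2 hsρ) h

theorem zeroProd_cons_eq_mul (ρ : ℂ) (S : Multiset ℂ) :
    zeroProd (ρ ::ₘ S) = (fun z : ℂ => (z - ρ) / (z - ρ + 1)) * zeroProd S :=
  funext (zeroProd_cons ρ S)

theorem analyticAt_zeroProd (hS : ∀ ρ ∈ S, ρ.re ≤ 1) (hs : 0 < s.re) :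
    AnalyticAt ℂ (zeroProd S) s := by
  induction S using Multiset.induction with
  | empty => exact analyticAt_const
  | cons ρ S ih =>
    rw [Multiset.forall_mem_cons] at hS
    rw [zeroProd_cons_eq_mul]
    exact (analyticAt_sub_div_sub_add_one (sub_add_one_ne_zero hs hS.1)).mul (ih hS.2)

theorem analyticOrderAt_zeroProd (hS : ∀ ρ ∈ S, ρ.re ≤ 1) (hs : 0 < s.re) :
    analyticOrderAt (zeroProd S) s = S.count s := by
  induction S using Multiset.induction with
  | empty =>
    rw [(analyticAt_zeroProd hS hs).analyticOrderAt_eq_zero.2 (by simp [zeroProd])]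
    simp
  | cons ρ S ih =>
    rw [Multiset.forall_mem_cons] at hS
    have hne := sub_add_one_ne_zero hs hS.1
    rw [zeroProd_cons_eq_mul, analyticOrderAt_mul (analyticAt_sub_div_sub_add_one hne)
      (analyticAt_zeroProd hS.2 hs), ih hS.2, analyticOrderAt_sub_div_sub_add_one hne,
      Multiset.count_cons]
    split_ifs <;> simp [add_comm]

theorem zeroProd_ne_zero (hS : ∀ ρ ∈ S, ρ.re ≤ 1) (hs : 0 < s.re) (hsS : s ∉ S) :
    zeroProd S s ≠ 0 := by
  rw [← (analyticAt_zeroProd hS hs).analyticOrderAt_eq_zero, analyticOrderAt_zeroProd hS hs,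
    Multiset.count_eq_zero_of_notMem hsS, Nat.cast_zero]

theorem norm_zeroProd_le (hS : ∀ ρ ∈ S, ρ.re ≤ 1) (hs : 1 / 2 ≤ s.re) :
    ‖zeroProd S s‖ ≤ 3 ^ Multiset.card S := by
  induction S using Multiset.induction with
  | empty => simp [zeroProd]
  | cons ρ S ih =>
    rw [Multiset.forall_mem_cons] at hS
    have hden : 1 / 2 ≤ ‖s - ρ + 1‖ := by
      refine le_trans ?_ ((le_abs_self _).trans (Complex.abs_re_le_norm _))
      simp only [Complex.add_re, Complex.sub_re, Complex.one_re]
      linarith [hS.1]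
    have hnum : ‖s - ρ‖ ≤ ‖s - ρ + 1‖ + 1 := by
      simpa using norm_sub_le (s - ρ + 1) 1
    rw [zeroProd_cons, norm_mul, Multiset.card_cons, pow_succ', norm_div]
    refine mul_le_mul ?_ (ih hS.2) (norm_nonneg _) (by norm_num)
    rw [div_le_iff₀ (one_half_pos.trans_le hden)]
    linarith

end ZeroProd

section TwistedZeta

variable {r : ℝ} {S : Multiset ℂ} {G : ℂ → ℂ} {s : ℂ}

theorem re_le_one_of_mem_poles (hr : r ≤ 1) : ∀ ρ ∈ ({1, (r : ℂ)} : Multiset ℂ), ρ.re ≤ 1 := by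
  simpa using hr

theorem meromorphicAt_twistedZeta (hr : r ≤ 1) (hS : ∀ ρ ∈ S, ρ.re ≤ 1) (hG : AnalyticAt ℂ G s)
    (hs : 0 < s.re) : MeromorphicAt (twistedZeta r S G) s :=
  ((analyticAt_zeroProd hS hs).meromorphicAt.fun_div
    (analyticAt_zeroProd (re_le_one_of_mem_poles hr) hs).meromorphicAt).fun_mul
    hG.cexp.meromorphicAt

theorem analyticAt_twistedZeta (hr : r ≤ 1) (hS : ∀ ρ ∈ S, ρ.re ≤ 1) (hG : AnalyticAt ℂ G s)
    (hs : 0 < s.re) (hs1 : s ≠ 1) (hsr : s ≠ r) : AnalyticAt ℂ (twistedZeta r S G) s :=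
  ((analyticAt_zeroProd hS hs).fun_div (analyticAt_zeroProd (re_le_one_of_mem_poles hr) hs)
    (zeroProd_ne_zero (re_le_one_of_mem_poles hr) hs (by simp [hs1, hsr]))).fun_mul hG.cexp

theorem meromorphicOrderAt_twistedZeta (hr : r ≤ 1) (hS : ∀ ρ ∈ S, ρ.re ≤ 1)
    (hG : AnalyticAt ℂ G s) (hs : 0 < s.re) :
    meromorphicOrderAt (twistedZeta r S G) s =
      ((S.count s - Multiset.count s {1, (r : ℂ)} : ℤ) : WithTop ℤ) := by
  have hpoles := re_le_one_of_mem_poles hr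
  have hzero := (analyticAt_zeroProd hS hs).meromorphicAt
  have hpole := (analyticAt_zeroProd hpoles hs).meromorphicAt
  have hexp : meromorphicOrderAt (fun z => Complex.exp (G z)) s = 0 := by
    rw [hG.cexp'.meromorphicOrderAt_eq, hG.cexp'.analyticOrderAt_eq_zero.2 (Complex.exp_ne_zero _)]
    rfl
  change meromorphicOrderAt (zeroProd S / zeroProd {1, (r : ℂ)} * fun z => Complex.exp (G z)) s = _
  rw [meromorphicOrderAt_mul (hzero.div hpole) hG.cexp'.meromorphicAt, hexp, add_zero,
    div_eq_mul_inv, meromorphicOrderAt_mul hzero hpole.inv, meromorphicOrderAt_inv,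
    (analyticAt_zeroProd hS hs).meromorphicOrderAt_eq, analyticOrderAt_zeroProd hS hs,
    (analyticAt_zeroProd hpoles hs).meromorphicOrderAt_eq, analyticOrderAt_zeroProd hpoles hs]
  simp [sub_eq_add_neg]

theorem analyticOrderAt_twistedZeta (hr : r ≤ 1) (hS : ∀ ρ ∈ S, ρ.re ≤ 1)
    (hG : AnalyticAt ℂ G s) (hs : 0 < s.re) (hs1 : s ≠ 1) (hsr : s ≠ r) :
    analyticOrderAt (twistedZeta r S G) s = S.count s := by
  have h := meromorphicOrderAt_twistedZeta hr hS hG hs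
  rw [(analyticAt_twistedZeta hr hS hG hs hs1 hsr).meromorphicOrderAt_eq,
    Multiset.count_eq_zero_of_notMem (s := {1, (r : ℂ)}) (by simp [hs1, hsr]), Nat.cast_zero,
    sub_zero] at h
  exact ENat.map_natCast_inj.1 h

theorem twistedZeta_eq_zero_iff (hr : r ≤ 1) (hS : ∀ ρ ∈ S, ρ.re ≤ 1)
    (hG : AnalyticAt ℂ G s) (hs : 0 < s.re) (hs1 : s ≠ 1) (hsr : s ≠ r) :
    twistedZeta r S G s = 0 ↔ s ∈ S := by
  rw [← (analyticAt_twistedZeta hr hS hG hs hs1 hsr).analyticOrderAt_ne_zero,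
    analyticOrderAt_twistedZeta hr hS hG hs hs1 hsr, Nat.cast_ne_zero, Multiset.count_ne_zero]

theorem twistedZeta_eq (r : ℝ) (S : Multiset ℂ) (G : ℂ → ℂ) (s : ℂ) :
    twistedZeta r S G s =
      s * (s - r + 1) * (zeroProd S s * Complex.exp (G s)) / ((s - 1) * (s - r)) := by
  simp only [twistedZeta, zeroProd, Multiset.insert_eq_cons, Multiset.map_cons,
    Multiset.map_singleton, Multiset.prod_cons, Multiset.prod_singleton, sub_add_cancel,
    div_mul_div_comm, div_div_eq_mul_div]
  ring

/-- The residue of `twistedZeta` at `1`. -/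
def twistedResidue (r : ℝ) (S : Multiset ℂ) (G : ℂ → ℂ) : ℂ :=
  (2 - r) / (1 - r) * (zeroProd S 1 * Complex.exp (G 1))

theorem one_sub_ofReal_ne_zero (hr : r < 1) : (1 : ℂ) - r ≠ 0 :=
  sub_ne_zero.2 (by exact_mod_cast hr.ne')

theorem tendsto_sub_one_mul_twistedZeta (hr : r < 1) (hS : ∀ ρ ∈ S, ρ.re ≤ 1)
    (hG : ContinuousAt G 1) :
    Tendsto (fun s : ℂ => (s - 1) * twistedZeta r S G s) (𝓝[≠] 1) (𝓝 (twistedResidue r S G)) := by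
  have hne := one_sub_ofReal_ne_zero hr
  have hzero := (analyticAt_zeroProd (s := 1) hS (by simp)).continuousAt
  have hcont : ContinuousAt
      (fun s => s * (s - r + 1) / (s - r) * (zeroProd S s * Complex.exp (G s))) 1 := by
    fun_prop (disch := assumption)
  have hval : twistedResidue r S G =
      1 * (1 - r + 1) / (1 - r) * (zeroProd S 1 * Complex.exp (G 1)) := by
    rw [twistedResidue]
    ring
  rw [hval]
  refine (hcont.tendsto.mono_left nhdsWithin_le_nhds).congr' ?_
  filter_upwards [self_mem_nhdsWithin] with s hs
  have hs1 : s - 1 ≠ 0 := sub_ne_zero.2 hs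
  rw [twistedZeta_eq]
  field_simp

theorem twistedResidue_ne_zero (hr : r < 1) (hS : ∀ ρ ∈ S, ρ.re < 1) (G : ℂ → ℂ) :
    twistedResidue r S G ≠ 0 := by
  have hnum : (2 : ℂ) - r ≠ 0 := sub_ne_zero.2 (by exact_mod_cast (hr.trans one_lt_two).ne')
  have hone : (1 : ℂ) ∉ S := fun h => (hS 1 h).ne Complex.one_re
  exact mul_ne_zero (div_ne_zero hnum (one_sub_ofReal_ne_zero hr)) (mul_ne_zero
    (zeroProd_ne_zero (fun ρ hρ => (hS ρ hρ).le) (by simp) hone) (Complex.exp_ne_zero _))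

end TwistedZeta

theorem BeurlingPrimes.exists_nonneg_eq_residue (P : BeurlingPrimes) {Z : ℂ → ℂ} {L : ℂ}
    (hZ : ∀ s : ℂ, 1 < s.re → HasSum (fun g : P.Integers => (P.norm g : ℂ) ^ (-s)) (Z s))
    (hL : Tendsto (fun s => (s - 1) * Z s) (𝓝[≠] 1) (𝓝 L)) : ∃ κ : ℝ, 0 ≤ κ ∧ (κ : ℂ) = L := by
  have hmap : Tendsto (fun x : ℝ => (x : ℂ)) (𝓝[>] 1) (𝓝[≠] 1) := by
    have hcont := (Complex.continuous_ofReal.tendsto 1).mono_left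
      (nhdsWithin_le_nhds (s := Set.Ioi 1))
    rw [Complex.ofReal_one] at hcont
    refine tendsto_nhdsWithin_iff.2 ⟨hcont, ?_⟩
    filter_upwards [self_mem_nhdsWithin] with x hx
    exact Complex.ofReal_one ▸ Complex.ofReal_injective.ne (ne_of_gt hx)
  have hclosed : IsClosed (Complex.ofReal '' Set.Ici 0) :=
    Complex.isometry_ofReal.isClosedEmbedding.isClosedMap _ isClosed_Ici
  refine hclosed.mem_of_tendsto (hL.comp hmap) ?_
  filter_upwards [self_mem_nhdsWithin] with x hx
  have hterm (g : P.Integers) : (P.norm g : ℂ) ^ (-(x : ℂ)) = ((P.norm g ^ (-x) : ℝ) : ℂ) := by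
    rw [Complex.ofReal_cpow (P.norm_pos g).le, Complex.ofReal_neg]
  refine ⟨(x - 1) * ∑' g, P.norm g ^ (-x), mul_nonneg (sub_nonneg.2 (le_of_lt hx))
    (tsum_nonneg fun g => Real.rpow_nonneg (P.norm_pos g).le _), ?_⟩
  rw [Function.comp_apply, ← (hZ x (by simpa using hx)).tsum_eq, tsum_congr hterm]
  push_cast
  rfl

theorem isOpen_re_gt (σ : ℝ) : IsOpen {s : ℂ | σ < s.re} :=
  isOpen_lt continuous_const Complex.continuous_re

theorem exists_differentiableOn_sub_div {B : ℂ → ℂ} {σ : ℝ}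
    (hB : DifferentiableOn ℂ B {s | σ < s.re}) (a : ℂ) :
    ∃ (c : ℂ) (D : ℂ → ℂ), (σ < a.re → c = B a) ∧ DifferentiableOn ℂ D {s | σ < s.re} ∧
      ∀ s, σ < s.re → s ≠ a → D s = (B s - c) / (s - a) := by
  by_cases ha : σ < a.re
  · refine ⟨B a, dslope B a, fun _ => rfl,
      (Complex.differentiableOn_dslope ((isOpen_re_gt σ).mem_nhds ha)).2 hB, fun s _ hsa => ?_⟩
    rw [dslope_of_ne _ hsa, slope_def_field]
  · exact ⟨0, fun s => (B s - 0) / (s - a), fun h => (ha h).elim,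
      (hB.sub_const 0).fun_div (differentiableOn_id.sub_const a)
        fun s hs => sub_ne_zero.2 fun h => ha (h ▸ hs), fun _ _ _ => rfl⟩

theorem exists_norm_le_of_one_le_abs_im {D : ℂ → ℂ} {σ₀ ε C : ℝ} (hε : 0 ≤ ε)
    (hD : ContinuousOn D {s | σ₀ ≤ s.re})
    (hb : ∀ s : ℂ, σ₀ ≤ s.re → s.re ≤ 2 → 1 ≤ |s.im| → ‖D s‖ ≤ C * (1 + |s.im|) ^ (ε - 1)) :
    ∃ C', ∀ s : ℂ, σ₀ ≤ s.re → s.re ≤ 2 → ‖D s‖ ≤ C' * (1 + |s.im|) ^ (ε - 1) := by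
  obtain ⟨B, hB⟩ := (isCompact_Icc.reProdIm isCompact_Icc :
    IsCompact (Set.Icc σ₀ 2 ×ℂ Set.Icc (-1) 1)).exists_bound_of_continuousOn
      (hD.mono fun s hs => hs.1.1)
  refine ⟨max C (|B| * 2), fun s hs hs2 => ?_⟩
  rcases le_total 1 |s.im| with him | him
  · exact (hb s hs hs2 him).trans
      (mul_le_mul_of_nonneg_right (le_max_left _ _) (by positivity))
  · have hpow : 1 ≤ 2 * (1 + |s.im|) ^ (ε - 1) := by
      calc (1 : ℝ) ≤ 2 * (1 + |s.im|)⁻¹ := by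
            rw [← div_eq_mul_inv, one_le_div (by positivity)]
            linarith
        _ ≤ 2 * (1 + |s.im|) ^ (ε - 1) := by
            rw [← Real.rpow_neg_one]
            gcongr <;> linarith [abs_nonneg s.im]
    calc ‖D s‖ ≤ |B| := (hB s ⟨⟨hs, hs2⟩, abs_le.1 him⟩).trans (le_abs_self B)
      _ ≤ |B| * (2 * (1 + |s.im|) ^ (ε - 1)) := le_mul_of_one_le_right (abs_nonneg B) hpow
      _ ≤ max C (|B| * 2) * (1 + |s.im|) ^ (ε - 1) := by
        rw [← mul_assoc]
        exact mul_le_mul_of_nonneg_right (le_max_right _ _) (by positivity)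

theorem exists_norm_sub_div_le {B D : ℂ → ℂ} {c : ℂ} {a σ₀ ε C : ℝ} (hε : 0 ≤ ε)
    (hB : ∀ s : ℂ, σ₀ ≤ s.re → ‖B s‖ ≤ C * (1 + |s.im|) ^ ε)
    (hD : ContinuousOn D {s | σ₀ ≤ s.re})
    (hDB : ∀ s : ℂ, σ₀ ≤ s.re → s ≠ a → D s = (B s - c) / (s - a)) :
    ∃ C', ∀ s : ℂ, σ₀ ≤ s.re → s.re ≤ 2 → ‖D s‖ ≤ C' * (1 + |s.im|) ^ (ε - 1) := by
  refine exists_norm_le_of_one_le_abs_im (C := 2 * (C + ‖c‖)) hε hD fun s hs _ him => ?_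
  have him_le : |s.im| ≤ ‖s - a‖ := by simpa using Complex.abs_im_le_norm (s - a)
  have hone : 1 ≤ (1 + |s.im|) ^ ε := Real.one_le_rpow (by linarith) hε
  have hnum : ‖B s - c‖ ≤ (C + ‖c‖) * (1 + |s.im|) ^ ε := by
    rw [add_mul]
    exact (norm_sub_le _ _).trans
      (add_le_add (hB s hs) (le_mul_of_one_le_right (norm_nonneg c) hone))
  have hsa : s ≠ a := fun h => by simp [h] at him; linarith
  rw [hDB s hs hsa, norm_div, Real.rpow_sub_one (by positivity), mul_div_assoc',
    div_le_div_iff₀ (by linarith) (by positivity)]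
  calc ‖B s - c‖ * (1 + |s.im|) ≤ (C + ‖c‖) * (1 + |s.im|) ^ ε * (2 * ‖s - a‖) :=
        mul_le_mul hnum (by linarith) (by positivity) ((norm_nonneg _).trans hnum)
    _ = 2 * (C + ‖c‖) * (1 + |s.im|) ^ ε * ‖s - a‖ := by ring

theorem exp_mul_sqrt_log_le {K ε y : ℝ} (hε : 0 < ε) (hy : 1 ≤ y) :
    Real.exp (K * √(Real.log y)) ≤ Real.exp (K ^ 2 / (4 * ε)) * y ^ ε := by
  rw [Real.rpow_def_of_pos (by linarith), ← Real.exp_add, Real.exp_le_exp, ← sub_nonneg]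
  have hsq := Real.sq_sqrt (Real.log_nonneg hy)
  set q := √(Real.log y)
  have hcomplete : K ^ 2 / (4 * ε) + q ^ 2 * ε - K * q = (K - 2 * ε * q) ^ 2 / (4 * ε) := by
    field_simp
    ring
  rw [← hsq, hcomplete]
  positivity

section Residue

variable {r : ℝ} {S : Multiset ℂ} {G : ℂ → ℂ}

theorem exists_norm_zeroProd_mul_exp_le (hS : ∀ ρ ∈ S, ρ.re ≤ 1) {σ₀ K ε : ℝ}
    (hσ₀ : 1 / 2 ≤ σ₀) (hε : 0 < ε)
    (hG : ∀ s : ℂ, σ₀ ≤ s.re → ‖G s‖ ≤ K * √(Real.log (|s.im| + 4))) :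
    ∃ C, ∀ s : ℂ, σ₀ ≤ s.re → ‖zeroProd S s * Complex.exp (G s)‖ ≤ C * (1 + |s.im|) ^ ε := by
  refine ⟨3 ^ Multiset.card S * (Real.exp (K ^ 2 / (4 * ε)) * 4 ^ ε), fun s hs => ?_⟩
  have hexp : ‖Complex.exp (G s)‖ ≤ Real.exp (K ^ 2 / (4 * ε)) * 4 ^ ε * (1 + |s.im|) ^ ε :=
    calc ‖Complex.exp (G s)‖ ≤ Real.exp (K * √(Real.log (|s.im| + 4))) :=
          (Complex.norm_exp_le_exp_norm _).trans (Real.exp_le_exp.2 (hG s hs))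
      _ ≤ Real.exp (K ^ 2 / (4 * ε)) * (|s.im| + 4) ^ ε :=
          exp_mul_sqrt_log_le hε (by linarith [abs_nonneg s.im])
      _ ≤ Real.exp (K ^ 2 / (4 * ε)) * (4 * (1 + |s.im|)) ^ ε := by
          gcongr
          linarith [abs_nonneg s.im]
      _ = Real.exp (K ^ 2 / (4 * ε)) * 4 ^ ε * (1 + |s.im|) ^ ε := by
          rw [Real.mul_rpow (by norm_num) (by positivity), mul_assoc]
  rw [norm_mul, mul_assoc]
  exact mul_le_mul (norm_zeroProd_le hS (hσ₀.trans hs)) hexp (norm_nonneg _) (by positivity)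

theorem twistedZeta_eq_partial_fractions (hr : r < 1) {s : ℂ} (hs1 : s ≠ 1) (hsr : s ≠ r) :
    twistedZeta r S G s = s * ((2 - r) / (1 - r) * (zeroProd S s * Complex.exp (G s) / (s - 1)) -
      1 / (1 - r) * (zeroProd S s * Complex.exp (G s) / (s - r))) := by
  have h1r := one_sub_ofReal_ne_zero hr
  have hs1' := sub_ne_zero.2 hs1
  have hsr' := sub_ne_zero.2 hsr
  rw [twistedZeta_eq]
  field_simp
  ring

theorem exists_isZetaRemainder {P : BeurlingPrimes} (hr : r < 1) (hS : ∀ ρ ∈ S, ρ.re ≤ 1)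
    (hG : DifferentiableOn ℂ G {s | 1 / 2 < s.re}) {κ σ₀ ε K : ℝ} (hσ₀ : 1 / 2 < σ₀) (hσ₀2 : σ₀ ≤ 2)
    (hε : 0 < ε) (hGK : ∀ s : ℂ, σ₀ ≤ s.re → ‖G s‖ ≤ K * √(Real.log (|s.im| + 4)))
    (hζ : ∀ s : ℂ, 1 < s.re → HasSum (fun g : P.Integers => (P.norm g : ℂ) ^ (-s))
      (twistedZeta r S G s)) (hκ : (κ : ℂ) = twistedResidue r S G) :
    ∃ c C E, P.IsZetaRemainder κ c r σ₀ ε C E := by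
  have hB : DifferentiableOn ℂ (fun s => zeroProd S s * Complex.exp (G s)) {s | 1 / 2 < s.re} :=
    (DifferentiableOn.mul (fun s hs => (analyticAt_zeroProd hS
      (one_half_pos.trans hs)).differentiableAt.differentiableWithinAt) hG.cexp)
  have hsub : {s : ℂ | σ₀ ≤ s.re} ⊆ {s | 1 / 2 < s.re} := fun s hs => hσ₀.trans_le hs
  obtain ⟨C, hBC⟩ := exists_norm_zeroProd_mul_exp_le hS hσ₀.le hε hGK
  obtain ⟨b₁, D₁, hb₁, hD₁, hBD₁⟩ := exists_differentiableOn_sub_div hB 1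
  obtain ⟨b₂, D₂, -, hD₂, hBD₂⟩ := exists_differentiableOn_sub_div hB r
  obtain ⟨C₁, hC₁⟩ := exists_norm_sub_div_le (a := 1) hε.le hBC (hD₁.continuousOn.mono hsub)
    fun s hs h1 => by simpa using hBD₁ s (hsub hs) (by simpa using h1)
  obtain ⟨C₂, hC₂⟩ := exists_norm_sub_div_le hε.le hBC (hD₂.continuousOn.mono hsub)
    fun s hs => hBD₂ s (hsub hs)
  set α : ℂ := (2 - r) / (1 - r)
  set β : ℂ := 1 / (1 - r)
  refine ⟨-(β * b₂), ‖α‖ * C₁ + ‖β‖ * C₂, fun s => α * D₁ s - β * D₂ s, by linarith, hσ₀2,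
    fun s hs => ?_, fun s hs => ?_, fun s hs hs2 => ?_⟩
  · have hs1 : s ≠ 1 := fun h => by simp [h] at hs
    have hsr : s ≠ r := fun h => by simp [h] at hs; linarith
    convert hζ s hs using 1
    rw [twistedZeta_eq_partial_fractions hr hs1 hsr, hκ, twistedResidue, ← hb₁ (by norm_num),
      hBD₁ s (by linarith) hs1, hBD₂ s (by linarith) hsr]
    ring
  · have hnhds := (isOpen_re_gt (1 / 2)).mem_nhds (hsub hs)
    exact ((hD₁.differentiableAt hnhds).const_mul α).sub ((hD₂.differentiableAt hnhds).const_mul β)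
  · refine (norm_sub_le _ _).trans ?_
    rw [norm_mul, norm_mul, add_mul, mul_assoc, mul_assoc]
    gcongr
    exacts [hC₁ s hs hs2, hC₂ s hs hs2]

theorem axiomA_of_hasSum_twistedZeta {P : BeurlingPrimes} (hr0 : 0 ≤ r) (hr1 : r < 1)
    (hS : ∀ ρ ∈ S, ρ.re ≤ 1) (hG : DifferentiableOn ℂ G {s | 1 / 2 < s.re})
    (hGK : ∀ σ₀ : ℝ, 1 / 2 < σ₀ → ∃ K : ℝ, ∀ s : ℂ, σ₀ ≤ s.re →
      ‖G s‖ ≤ K * √(Real.log (|s.im| + 4)))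
    (hζ : ∀ s : ℂ, 1 < s.re → HasSum (fun g : P.Integers => (P.norm g : ℂ) ^ (-s))
      (twistedZeta r S G s)) {κ τ : ℝ} (hκ0 : 0 < κ) (hκ : (κ : ℂ) = twistedResidue r S G)
    (hτ : 1 / 2 < τ) (hrτ : r ≤ τ) (hτ1 : τ < 1) : P.AxiomA κ τ := by
  obtain ⟨K, hK⟩ := hGK (1 / 2 + (τ - 1 / 2) / 2) (by linarith)
  obtain ⟨c, C, E, hE⟩ := exists_isZetaRemainder (ε := (τ - 1 / 2) / 2) hr1 hS hG (by linarith)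
    (by linarith) (by linarith) hK hζ hκ
  exact ⟨hκ0, by linarith, hτ1, hE.exists_abs_N_sub_le hκ0.le hr0 hr1 (by linarith)
    (by linarith) hτ.le hrτ (by linarith)⟩

end Residue

/-! ### Failure of Axiom A -/

theorem eventuallyEq_nhdsNE_of_isPreconnected {𝕜 E : Type*} [NontriviallyNormedField 𝕜]
    [NormedAddCommGroup E] [NormedSpace 𝕜 E] {f g : 𝕜 → E} {U : Set 𝕜} (hf : MeromorphicOn f U)
    (hg : MeromorphicOn g U) (hU : IsPreconnected U) {x y : 𝕜} (hx : x ∈ U) (hy : y ∈ U)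
    (h : f =ᶠ[𝓝[≠] x] g) : f =ᶠ[𝓝[≠] y] g := by
  have htop (z : 𝕜) : f =ᶠ[𝓝[≠] z] g ↔ meromorphicOrderAt (f - g) z = ⊤ := by
    simp only [meromorphicOrderAt_eq_top_iff, Pi.sub_apply, sub_eq_zero, EventuallyEq]
  rw [htop] at h ⊢
  contrapose! h
  exact (hf.sub hg).meromorphicOrderAt_ne_top_of_isPreconnected hU hy hx h

theorem hasDerivWithinAt_max_sub_zero (c x : ℝ) :
    HasDerivWithinAt (fun t : ℝ => max (t - c) 0) (if c ≤ x then 1 else 0) (Set.Ici x) x := by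
  split_ifs with h
  · refine ((hasDerivAt_id x).sub_const c).hasDerivWithinAt.congr_of_mem (fun t ht => ?_)
      Set.self_mem_Ici
    have : x ≤ t := ht
    exact max_eq_left (by linarith)
  · have : (fun t : ℝ => max (t - c) 0) =ᶠ[𝓝 x] fun _ => 0 := by
      filter_upwards [eventually_lt_nhds (not_le.1 h)] with t ht
      exact max_eq_right (by linarith)
    exact ((hasDerivAt_const x (0 : ℝ)).congr_of_eventuallyEq this).hasDerivWithinAt

namespace BeurlingPrimes

variable (P : BeurlingPrimes)

theorem hasDerivWithinAt_NInt (x : ℝ) : HasDerivWithinAt P.NInt (P.N x) (Set.Ici x) x := by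
  have h := HasDerivWithinAt.fun_sum (u := (P.finite_norm_le (x + 1)).toFinset)
    fun g _ => hasDerivWithinAt_max_sub_zero (P.norm g) x
  have hN : ∑ g ∈ (P.finite_norm_le (x + 1)).toFinset, (if P.norm g ≤ x then (1 : ℝ) else 0) =
      P.N x := by
    rw [Finset.sum_boole, N_eq_card]
    congr 2
    ext g
    simp only [Finset.mem_filter, Set.Finite.mem_toFinset, Set.mem_ofPred_eq]
    exact ⟨fun h => h.2, fun h => ⟨by linarith, h⟩⟩
  rw [hN] at h
  refine h.congr_of_eventuallyEq ?_ (P.NInt_eq_sum (by linarith))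
  filter_upwards [(eventually_le_nhds (lt_add_one x)).filter_mono nhdsWithin_le_nhds] with t ht
    using P.NInt_eq_sum ht

theorem abs_NInt_sub_le {κ θ A x : ℝ} (hθ : 0 < θ)
    (hA : ∀ x : ℝ, 1 ≤ x → |(P.N x : ℝ) - κ * (x - 1)| ≤ A * x ^ θ) (hx : 1 ≤ x) :
    |P.NInt x - κ * (x - 1) ^ 2 / 2| ≤ A * x ^ (θ + 1) := by
  have hA0 : 0 ≤ A := by
    have := (abs_nonneg _).trans (hA 1 le_rfl)
    simpa using this
  have hbound : ∀ t : ℝ, HasDerivAt (fun t : ℝ => A * t ^ (θ + 1)) (A * ((θ + 1) * t ^ θ)) t :=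
    fun t => by
      have := (Real.hasDerivAt_rpow_const (x := t) (p := θ + 1) (Or.inr (by linarith))).const_mul A
      simpa using this
  have hderiv : ∀ t : ℝ, HasDerivWithinAt (fun t => P.NInt t - κ * (t - 1) ^ 2 / 2)
      (P.N t - κ * (t - 1)) (Set.Ici t) t := fun t => by
    have hsq : HasDerivAt (fun t : ℝ => κ * (t - 1) ^ 2 / 2) (κ * (t - 1)) t := by
      have := ((((hasDerivAt_id t).sub_const 1).pow 2).const_mul κ).div_const 2
      refine this.congr_deriv ?_
      simp only [id_eq, mul_one]
      ring
    exact (P.hasDerivWithinAt_NInt t).sub hsq.hasDerivWithinAt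
  have hcont : ContinuousOn (fun t => P.NInt t - κ * (t - 1) ^ 2 / 2) (Set.Icc 1 x) := by
    have := P.continuous_NInt
    fun_prop
  refine image_norm_le_of_norm_deriv_right_le_deriv_boundary hcont (fun t _ => hderiv t) ?_ hbound
    (fun t ht => ?_) (Set.right_mem_Icc.2 hx)
  · simpa [P.NInt_of_le_one le_rfl] using hA0
  · have ht0 : 0 ≤ t := by linarith [ht.1]
    refine (hA t ht.1).trans (mul_le_mul_of_nonneg_left ?_ hA0)
    nlinarith [Real.rpow_nonneg ht0 θ]

variable {P} {Z : ℂ → ℂ} {κ θ : ℝ}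

theorem NIntError_zero_eq (x : ℝ) :
    P.NIntError κ (-κ) 0 x = ((P.NInt x - κ * max (x - 1) 0 ^ 2 / 2 : ℝ) : ℂ) := by
  rcases le_or_gt x 1 with hx | hx
  · rw [max_eq_right (by linarith)]
    simp [NIntError, truncPow, hx.not_gt]
  · rw [max_eq_left (by linarith), NIntError, truncPow_of_one_lt _ hx, truncPow_of_one_lt _ hx,
      one_add_one_eq_two, show (2 : ℂ) = ((2 : ℕ) : ℂ) by norm_num, Complex.cpow_natCast]
    simp only [Complex.ofReal_zero, zero_add, Complex.cpow_one, smul_eq_mul]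
    push_cast
    ring

theorem differentiableAt_mellin_NIntError_zero (hA : P.AxiomA κ θ) {w : ℂ} (hw : θ < w.re) :
    DifferentiableAt ℂ (fun w => mellin (P.NIntError κ (-κ) 0) (-(w + 1))) w := by
  obtain ⟨-, hθ, -, A, hA⟩ := hA
  have hcont : Continuous (P.NIntError κ (-κ) 0) := by
    have := P.continuous_NInt
    rw [funext NIntError_zero_eq]
    fun_prop
  have hzero : P.NIntError κ (-κ) 0 =ᶠ[𝓝[>] 0] 0 :=
    ((eventually_le_nhds zero_lt_one).filter_mono nhdsWithin_le_nhds).mono fun x hx => by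
      rw [NIntError_zero_eq, max_eq_right (by linarith), P.NInt_of_le_one hx]
      simp
  have hmellin : DifferentiableAt ℂ (mellin (P.NIntError κ (-κ) 0)) (-(w + 1)) := by
    refine mellin_differentiableAt_of_isBigO_rpow (a := -(θ + 1)) (b := -(w.re + 2))
      (hcont.locallyIntegrable.locallyIntegrableOn _) (IsBigO.of_bound A ?_)
      (by simp only [Complex.neg_re, Complex.add_re, Complex.one_re]; linarith)
      (hzero.trans_isBigO (isBigO_zero _ _)) (by simp)
    filter_upwards [eventually_gt_atTop 1] with x hx
    rw [NIntError_zero_eq, max_eq_left (by linarith), Complex.norm_real, neg_neg,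
      Real.norm_of_nonneg (Real.rpow_nonneg (by linarith) _)]
    exact P.abs_NInt_sub_le hθ hA hx.le
  exact hmellin.comp (f := fun w => -(w + 1)) w (by fun_prop)

theorem mul_mellin_NIntError_zero_add (κ : ℝ) {w : ℂ} (hw : 1 < w.re)
    (hZ : ∀ s : ℂ, 1 < s.re → HasSum (fun g : P.Integers => (P.norm g : ℂ) ^ (-s)) (Z s)) :
    w * (w + 1) * mellin (P.NIntError κ (-κ) 0) (-(w + 1)) + κ * w / (w - 1) - κ = Z w := by
  have hne (a : ℝ) (ha : a ≤ 1) : w - a ≠ 0 := fun h => by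
    rw [sub_eq_zero.1 h, Complex.ofReal_re] at hw
    linarith
  have hw0 : w ≠ 0 := by simpa using hne 0 zero_le_one
  have hw1 : w - 1 ≠ 0 := by simpa using hne 1 le_rfl
  have hw1' : w + 1 ≠ 0 := by simpa using hne (-1) (by norm_num)
  have hM := P.hasMellin_NIntError (E := fun s => Z s / s - κ / (s - 1) + κ / s) (κ := κ)
    (c := -κ) (r := 0) (fun s hs => ?_) (by simp) hw
  · rw [hM.2]
    field_simp
    ring
  · have hs0 : s ≠ 0 := fun h => by
      rw [h, Complex.zero_re] at hs
      linarith
    have hcancel : Z s / s - κ / (s - 1) + κ / s + κ / (s - 1) + -κ / (s - (0 : ℝ)) = Z s / s := by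
      rw [Complex.ofReal_zero, sub_zero]
      ring
    simpa only [hcancel, mul_div_cancel₀ _ hs0] using hZ s hs

theorem meromorphicOrderAt_nonneg_of_axiomA {σ : ℝ} (hA : P.AxiomA κ θ)
    (hZ : P.IsZetaContinuation σ Z) {w : ℂ} (hσ : σ < w.re) (hθ : θ < w.re) (hw1 : w ≠ 1) :
    0 ≤ meromorphicOrderAt Z w := by
  -- The Mellin transform `M` of the error term of `∫ N` converges for `Re s > θ`, so that `F`
  -- continues `ζ` to this half-plane with no pole but `1`.
  set U : Set ℂ := {s | max σ θ < s.re}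
  set M : ℂ → ℂ := fun s => mellin (P.NIntError κ (-κ) 0) (-(s + 1))
  set F : ℂ → ℂ := fun s => s * (s + 1) * M s + κ * s / (s - 1) - κ
  have hM : AnalyticOnNhd ℂ M U := DifferentiableOn.analyticOnNhd
    (fun s hs => (differentiableAt_mellin_NIntError_zero hA
      ((le_max_right σ θ).trans_lt hs)).differentiableWithinAt) (isOpen_re_gt _)
  have hF : MeromorphicOn F U := fun s hs => by
    have := (hM s hs).meromorphicAt
    fun_prop
  have hZU : MeromorphicOn Z U := hZ.1.mono_set fun s hs => (le_max_left σ θ).trans_lt hs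
  have hwU : w ∈ U := max_lt hσ hθ
  obtain ⟨x, hxU, hx1⟩ : ∃ x ∈ U, 1 < x.re :=
    let ⟨a, ha⟩ := exists_gt (max (max σ θ) 1)
    ⟨a, (le_max_left _ _).trans_lt ha, (le_max_right _ _).trans_lt ha⟩
  have hZF : Z =ᶠ[𝓝[≠] x] F := by
    filter_upwards [nhdsWithin_le_nhds ((isOpen_re_gt 1).mem_nhds hx1)] with s hs
      using (mul_mellin_NIntError_zero_add κ hs hZ.2).symm
  rw [meromorphicOrderAt_congr (eventuallyEq_nhdsNE_of_isPreconnected hZU hF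
    (convex_halfSpace_re_gt _).isPreconnected hxU hwU hZF)]
  have hMw := hM w hwU
  have hw1' := sub_ne_zero.2 hw1
  exact AnalyticAt.meromorphicOrderAt_nonneg (by fun_prop (disch := assumption))

end BeurlingPrimes

/-! ### Properties of the sampled primes -/

theorem isLittleO_rpow_id {a : ℝ} (ha : a < 1) :
    (fun x : ℝ => x ^ a) =o[atTop] fun x : ℝ => x := by
  rw [isLittleO_iff_tendsto' ((eventually_gt_atTop 0).mono fun x hx h => absurd h hx.ne')]
  refine (tendsto_rpow_neg_atTop (sub_pos.2 ha)).congr' ?_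
  filter_upwards [eventually_gt_atTop 0] with x hx
  rw [neg_sub, Real.rpow_sub_one hx.ne']

theorem isLittleO_cpow_id {ρ : ℂ} (hρ : ρ.re < 1) :
    (fun x : ℝ => (x : ℂ) ^ ρ) =o[atTop] fun x : ℝ => x := by
  refine IsBigO.trans_isLittleO (IsBigO.of_bound 1 ?_) (isLittleO_rpow_id hρ)
  filter_upwards [eventually_gt_atTop 0] with x hx
  rw [Complex.norm_cpow_eq_rpow_re_of_pos hx, one_mul]
  exact le_abs_self _

theorem isLittleO_powerSumPrimitive_id {T : Multiset ℂ} (hT : ∀ ρ ∈ T, ρ.re < 1) :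
    powerSumPrimitive T =o[atTop] fun x : ℝ => x := by
  induction T using Multiset.induction with
  | empty => exact (isLittleO_zero _ _).congr_left fun _ => by simp [powerSumPrimitive]
  | cons ρ T ih =>
    rw [Multiset.forall_mem_cons] at hT
    rw [powerSumPrimitive_cons]
    exact IsLittleO.add (((isLittleO_cpow_id hT.1).const_mul_left ρ⁻¹).congr_left
      fun x => inv_mul_eq_div _ _) (ih hT.2)

theorem isEquivalent_of_norm_sub_psiMain_le {f : ℝ → ℝ} {r C : ℝ} (hr : r < 1) {S : Multiset ℂ}
    (hS : ∀ ρ ∈ S, ρ.re < 1) (hf : ∀ x : ℝ, 1 ≤ x → ‖(f x : ℂ) - psiMain r S x‖ ≤ C * √x) :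
    f ~[atTop] fun x : ℝ => x := by
  have hsqrt : (fun x : ℝ => √x) =o[atTop] fun x : ℝ => x := by
    simpa only [Real.sqrt_eq_rpow] using isLittleO_rpow_id one_half_lt_one
  have herror : (fun x : ℝ => (f x : ℂ) - psiMain r S x) =o[atTop] fun x : ℝ => x := by
    refine IsBigO.trans_isLittleO (IsBigO.of_bound C ?_) hsqrt
    filter_upwards [eventually_ge_atTop 1] with x hx
    rw [Real.norm_of_nonneg (Real.sqrt_nonneg x)]
    exact hf x hx
  have hmain := (isLittleO_powerSumPrimitive_id (T := {(r : ℂ)}) (by simpa using hr)).sub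
    (isLittleO_powerSumPrimitive_id hS)
  refine IsLittleO.of_norm_left ((herror.add hmain).norm_left.congr_left fun x => ?_)
  rw [Pi.sub_apply, ← Complex.norm_real]
  congr 1
  simp only [psiMain, powerSumPrimitive, Multiset.insert_eq_cons, Multiset.map_cons,
    Multiset.map_singleton, Multiset.sum_cons, Multiset.sum_singleton, Complex.cpow_one, div_one]
  push_cast
  ring

section TwistedZeta

variable {r : ℝ} {S : Multiset ℂ} {G : ℂ → ℂ}

theorem meromorphicOrderAt_twistedZeta_one (hr : r < 1) (hS : ∀ ρ ∈ S, ρ.re < 1)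
    (hG : AnalyticAt ℂ G 1) : meromorphicOrderAt (twistedZeta r S G) 1 = -1 := by
  have hone : (1 : ℂ) ∉ S := fun h => (hS 1 h).ne Complex.one_re
  have hne : (1 : ℂ) ≠ r := sub_ne_zero.1 (one_sub_ofReal_ne_zero hr)
  rw [meromorphicOrderAt_twistedZeta hr.le (fun ρ hρ => (hS ρ hρ).le) hG (by simp)]
  simp [hone, hne]

theorem meromorphicOrderAt_twistedZeta_ofReal (hr0 : 0 < r) (hr : r < 1) (hS : ∀ ρ ∈ S, ρ.re ≤ 1)
    (hrS : (r : ℂ) ∉ S) (hG : AnalyticAt ℂ G r) :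
    meromorphicOrderAt (twistedZeta r S G) r = -1 := by
  have hne : (r : ℂ) ≠ 1 := (sub_ne_zero.1 (one_sub_ofReal_ne_zero hr)).symm
  rw [meromorphicOrderAt_twistedZeta hr.le hS hG (by simpa using hr0)]
  simp [hrS, hne]

end TwistedZeta

namespace DensitySampling

variable {r a M : ℝ} {S : Multiset ℂ} (X : DensitySampling (zeroDensity r S) a M)

theorem continuousOn_zeroDensity_Icc : ContinuousOn (zeroDensity r S) (Set.Icc 1 a) :=
  (continuousOn_zeroDensity r S).mono fun _ hu => zero_lt_one.trans_le hu.1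

theorem differentiableOn_logRegular : DifferentiableOn ℂ X.logRegular {s | 1 / 2 < s.re} :=
  fun _ hs => (X.differentiableAt_logRegular
    continuousOn_zeroDensity_Icc hs).differentiableWithinAt

theorem analyticAt_logRegular {s : ℂ} (hs : 1 / 2 < s.re) : AnalyticAt ℂ X.logRegular s :=
  X.differentiableOn_logRegular.analyticAt ((isOpen_re_gt _).mem_nhds hs)

theorem isZetaContinuation (hr : r < 1) (hS : ∀ ρ ∈ S, ρ.re < 1)
    (hsymm : S.map (starRingEnd ℂ) = S) :
    X.toBeurlingPrimes.IsZetaContinuation (1 / 2) (twistedZeta r S X.logRegular) :=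
  ⟨fun _ hs => meromorphicAt_twistedZeta hr.le (fun ρ hρ => (hS ρ hρ).le)
    (X.analyticAt_logRegular hs) (one_half_pos.trans hs), fun _ => hasSum_norm_cpow hr hS hsymm X⟩

theorem exists_pos_tendsto_residue (hr : r < 1) (hS : ∀ ρ ∈ S, ρ.re < 1)
    (hsymm : S.map (starRingEnd ℂ) = S) :
    ∃ κ : ℝ, 0 < κ ∧ (κ : ℂ) = twistedResidue r S X.logRegular ∧
      Tendsto (fun s : ℂ => (s - 1) * twistedZeta r S X.logRegular s) (𝓝[≠] 1) (𝓝 κ) := by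
  have htendsto := tendsto_sub_one_mul_twistedZeta hr (fun ρ hρ => (hS ρ hρ).le)
    (X.analyticAt_logRegular (s := 1) (by norm_num)).continuousAt
  obtain ⟨κ, hκ0, hκ⟩ := X.toBeurlingPrimes.exists_nonneg_eq_residue
    (X.isZetaContinuation hr hS hsymm).2 htendsto
  refine ⟨κ, hκ0.lt_of_ne' fun h => ?_, hκ, hκ ▸ htendsto⟩
  exact twistedResidue_ne_zero hr hS X.logRegular (by rw [← hκ, h, Complex.ofReal_zero])

theorem axiomA (hr0 : 0 ≤ r) (hr : r < 1) (hS : ∀ ρ ∈ S, ρ.re < 1)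
    (hsymm : S.map (starRingEnd ℂ) = S) {κ θ : ℝ} (hκ0 : 0 < κ)
    (hκ : (κ : ℂ) = twistedResidue r S X.logRegular) (hθ : 1 / 2 < θ) (hrθ : r ≤ θ)
    (hθ1 : θ < 1) : X.toBeurlingPrimes.AxiomA κ θ :=
  axiomA_of_hasSum_twistedZeta hr0 hr (fun ρ hρ => (hS ρ hρ).le) X.differentiableOn_logRegular
    (fun _ => X.exists_norm_logRegular_le continuousOn_zeroDensity_Icc)
    (X.isZetaContinuation hr hS hsymm).2 hκ0 hκ hθ hrθ hθ1

theorem not_axiomA (hr2 : 1 / 2 < r) (hr : r < 1) (hS : ∀ ρ ∈ S, ρ.re < 1)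
    (hrS : (r : ℂ) ∉ S) (hsymm : S.map (starRingEnd ℂ) = S) {θ : ℝ} (hθ : θ < r) (κ : ℝ) :
    ¬ X.toBeurlingPrimes.AxiomA κ θ := fun hA => by
  have hre : (r : ℂ).re = r := Complex.ofReal_re r
  have hnonneg := BeurlingPrimes.meromorphicOrderAt_nonneg_of_axiomA hA
    (X.isZetaContinuation hr hS hsymm) (hre.symm ▸ hr2) (hre.symm ▸ hθ)
    (sub_ne_zero.1 (one_sub_ofReal_ne_zero hr)).symm
  rw [meromorphicOrderAt_twistedZeta_ofReal (by linarith) hr (fun ρ hρ => (hS ρ hρ).le) hrS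
    (X.analyticAt_logRegular (hre.symm ▸ hr2))] at hnonneg
  exact absurd hnonneg (by decide)

theorem exists_norm_psi_sub_sub_le (hr0 : r ≠ 0) (hr : r ≤ 1) (hS0 : ∀ ρ ∈ S, ρ ≠ 0)
    (hS : ∀ ρ ∈ S, ρ.re ≤ 1) (hsymm : S.map (starRingEnd ℂ) = S) :
    ∃ C : ℝ, ∀ x : ℝ, 1 ≤ x → ‖((X.toBeurlingPrimes.psi x - x : ℝ) : ℂ) -
      ((x : ℂ) ^ (r : ℂ) / r - (S.map fun ρ => (x : ℂ) ^ ρ / ρ).sum)‖ ≤ C * √x := by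
  obtain ⟨C, hC⟩ := X.exists_norm_psi_sub_psiMain_le hr0 hr hS0 hS hsymm
  refine ⟨C, fun x hx => le_of_eq_of_le (congrArg _ ?_) (hC x hx)⟩
  rw [psiMain_eq]
  push_cast
  ring

theorem exists_norm_psi_sub_sub_le_of_le_half (hr0 : r ≠ 0) (hr : r ≤ 1 / 2)
    (hS0 : ∀ ρ ∈ S, ρ ≠ 0) (hS : ∀ ρ ∈ S, ρ.re ≤ 1) (hsymm : S.map (starRingEnd ℂ) = S) :
    ∃ C : ℝ, ∀ x : ℝ, 1 ≤ x → ‖((X.toBeurlingPrimes.psi x - x : ℝ) : ℂ) -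
      (-(S.map fun ρ => (x : ℂ) ^ ρ / ρ).sum)‖ ≤ C * √x := by
  obtain ⟨C, hC⟩ := X.exists_norm_psi_sub_sub_le hr0 (by linarith) hS0 hS hsymm
  refine ⟨C + |r|⁻¹, fun x hx => ?_⟩
  have hpow : ‖(x : ℂ) ^ (r : ℂ) / r‖ ≤ |r|⁻¹ * √x := by
    rw [norm_div, Complex.norm_cpow_eq_rpow_re_of_pos (zero_lt_one.trans_le hx),
      Complex.ofReal_re, Complex.norm_real, Real.norm_eq_abs, Real.sqrt_eq_rpow, inv_mul_eq_div]
    gcongr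
  rw [add_mul]
  refine le_trans (le_of_eq_of_le (congrArg _ ?_) (norm_add_le _ _)) (add_le_add (hC x hx) hpow)
  ring

end DensitySampling

end

theorem theorem6p3_general (r : ℝ) (hr0 : 0 < r) (hr1 : r < 1) (S : Multiset ℂ)
    (hS : ∀ ρ ∈ S, ρ.re < 1 ∧ ρ ≠ 0 ∧ ρ ≠ r) (hsymm : S.map (starRingEnd ℂ) = S) :
    ∃ (P : BeurlingPrimes) (κ : ℝ),
      (∀ θ : ℝ, 1 / 2 < θ → r ≤ θ → θ < 1 → P.AxiomA κ θ) ∧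
      (1 / 2 < r → ∀ θ : ℝ, θ < r → ∀ κ' : ℝ, ¬ P.AxiomA κ' θ) ∧
      (P.psi ~[atTop] fun x : ℝ => x) ∧
      (∃ C : ℝ, ∀ x : ℝ, 1 ≤ x →
        ‖((P.psi x - x : ℝ) : ℂ) - ((x : ℂ) ^ (r : ℂ) / r - (S.map fun ρ => (x : ℂ) ^ ρ / ρ).sum)‖
          ≤ C * √x) ∧
      (r ≤ 1 / 2 → ∃ C : ℝ, ∀ x : ℝ, 1 ≤ x →
        ‖((P.psi x - x : ℝ) : ℂ) - (-(S.map fun ρ => (x : ℂ) ^ ρ / ρ).sum)‖ ≤ C * √x) ∧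
      ∃ Z : ℂ → ℂ, P.IsZetaContinuation (1 / 2) Z ∧
        meromorphicOrderAt Z 1 = -1 ∧
        Tendsto (fun s : ℂ => (s - 1) * Z s) (𝓝[≠] 1) (𝓝 κ) ∧
        (1 / 2 < r → meromorphicOrderAt Z r = -1) ∧
        ∀ s : ℂ, 1 / 2 < s.re → s ≠ 1 → s ≠ r →
          AnalyticAt ℂ Z s ∧ (Z s = 0 ↔ s ∈ S) ∧ analyticOrderAt Z s = S.count s := by
  have hS1 : ∀ ρ ∈ S, ρ.re < 1 := fun ρ hρ => (hS ρ hρ).1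
  have hS1' : ∀ ρ ∈ S, ρ.re ≤ 1 := fun ρ hρ => (hS1 ρ hρ).le
  have hS0 : ∀ ρ ∈ S, ρ ≠ 0 := fun ρ hρ => (hS ρ hρ).2.1
  have hrS : (r : ℂ) ∉ S := fun h => (hS r h).2.2 rfl
  obtain ⟨a, ⟨X⟩⟩ := exists_sampling_zeroDensity hr1 hS1
  obtain ⟨κ, hκ0, hκ, hresidue⟩ := X.exists_pos_tendsto_residue hr1 hS1 hsymm
  obtain ⟨C, hC⟩ := X.exists_norm_psi_sub_psiMain_le hr0.ne' hr1.le hS0 hS1' hsymm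
  refine ⟨X.toBeurlingPrimes, κ, fun _ => X.axiomA hr0.le hr1 hS1 hsymm hκ0 hκ,
    fun hr2 _ hθ => X.not_axiomA hr2 hr1 hS1 hrS hsymm hθ,
    isEquivalent_of_norm_sub_psiMain_le hr1 hS1 hC,
    X.exists_norm_psi_sub_sub_le hr0.ne' hr1.le hS0 hS1' hsymm,
    fun hr2 => X.exists_norm_psi_sub_sub_le_of_le_half hr0.ne' hr2 hS0 hS1' hsymm,
    twistedZeta r S X.logRegular, X.isZetaContinuation hr1 hS1 hsymm,
    meromorphicOrderAt_twistedZeta_one hr1 hS1 (X.analyticAt_logRegular (by norm_num)), hresidue,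
    fun hr2 => meromorphicOrderAt_twistedZeta_ofReal hr0 hr1 hS1' hrS
      (X.analyticAt_logRegular (by simpa using hr2)), fun s hs hs1 hsr => ?_⟩
  have hG := X.analyticAt_logRegular hs
  have hs0 : 0 < s.re := one_half_pos.trans hs
  exact ⟨analyticAt_twistedZeta hr1.le hS1' hG hs0 hs1 hsr,
    twistedZeta_eq_zero_iff hr1.le hS1' hG hs0 hs1 hsr,
    analyticOrderAt_twistedZeta hr1.le hS1' hG hs0 hs1 hsr⟩

theorem theorem6p3 (r : ℝ) (hr : 1 / 2 ≤ r) (hr1 : r < 1) (S : Multiset ℂ)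
    (hS : ∀ ρ ∈ S, r < ρ.re ∧ ρ.re < 1) (hsymm : S.map (starRingEnd ℂ) = S) :
    ∃ (P : BeurlingPrimes) (κ : ℝ),
      -- Axiom A, with the optimal exponent if `r > 1/2`
      (1 / 2 < r → P.AxiomA κ r ∧ ∀ θ : ℝ, θ < r → ∀ κ' : ℝ, ¬ P.AxiomA κ' θ) ∧
      (r = 1 / 2 → ∀ θ : ℝ, 1 / 2 < θ → θ < 1 → P.AxiomA κ θ) ∧
      -- the prime number formula and its error term
      (P.psi ~[atTop] fun x : ℝ => x) ∧
      (1 / 2 < r → ∃ C : ℝ, ∀ x : ℝ, 1 ≤ x →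
        ‖((P.psi x - x : ℝ) : ℂ)
          - ((x : ℂ) ^ (r : ℂ) / (r : ℂ) - (S.map fun ρ => (x : ℂ) ^ ρ / ρ).sum)‖
          ≤ C * Real.sqrt x) ∧
      (r = 1 / 2 → ∃ C : ℝ, ∀ x : ℝ, 1 ≤ x →
        ‖((P.psi x - x : ℝ) : ℂ) - (-(S.map fun ρ => (x : ℂ) ^ ρ / ρ).sum)‖
          ≤ C * Real.sqrt x) ∧
      -- poles and zeros of the zeta function in `Re s > 1/2`
      ∃ Z : ℂ → ℂ, P.IsZetaContinuation (1 / 2) Z ∧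
        meromorphicOrderAt Z 1 = -1 ∧
        Tendsto (fun s : ℂ => (s - 1) * Z s) (𝓝[≠] 1) (𝓝 (κ : ℂ)) ∧
        (1 / 2 < r → meromorphicOrderAt Z (r : ℂ) = -1) ∧
        ∀ s : ℂ, 1 / 2 < s.re → s ≠ 1 → s ≠ (r : ℂ) →
          AnalyticAt ℂ Z s ∧ (Z s = 0 ↔ s ∈ S) ∧ analyticOrderAt Z s = S.count s := by
  obtain ⟨P, κ, hA, hnotA, hψ, hψr, hψhalf, hZ⟩ := theorem6p3_general r (by linarith) hr1 S
    (fun ρ hρ => ⟨(hS ρ hρ).2, by rintro rfl; linarith [(hS 0 hρ).1, Complex.zero_re],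
      by rintro rfl; exact (hS r hρ).1.ne' (Complex.ofReal_re r)⟩) hsymm
  exact ⟨P, κ, fun hr2 => ⟨hA r hr2 le_rfl hr1, hnotA hr2⟩,
    fun hr2 θ hθ => hA θ hθ (hr2.trans_lt hθ).le, hψ, fun _ => hψr, fun hr2 => hψhalf hr2.le, hZ⟩
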